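/- **Proposition.** For every constructive ordinal $\alpha>0$, the set $D_{\alpha+1}$ is $\Pi_{2\alpha+1}$, uniformly in $\alpha$. Explicitly: there are a computable function $t:\mathbb N\to\mathbb N$ and a partial computable function $g(a,b,e)$ such that, for every constructive $\alpha>0$ and every notation $a\in\mathcal O$ of $\alpha$, the number $t(a)$ is a notation of $2\alpha+1$; and for every notation $b\in\mathcal O$ of $2\alpha+1$ the function $e\mapsto g(a,b,e)$ is total and one-one, and $$e\in D_{\alpha+1}\iff g(a,b,e)\notin \emptyset_{(b)}\qquad\text{for all } e .$$ Here the notation is as follows. * $2\alpha$ is the ordinal product $2\cdot\alpha$ ($\alpha$ copies of $2$, so that $2\lambda=\lambda$ for limit $\lambda$). * $\varphi_e$ is the $e$-th partial computable function, and $X'=\{e:\varphi^X_e(e)\downarrow\}$ is the Turing jump. * $<_{\mathcal O}$ is the least transitive relation on $\mathbb N$ with: $1<_{\mathcal O}2$; if $a<_{\mathcal O}b$ then $b<_{\mathcal O}2^b$; and if $\varphi_e$ is total with $\varphi_e(n)<_{\mathcal O}\varphi_e(n+1)$ for all $n$, then $\varphi_e(n)<_{\mathcal O}3\cdot5^e$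 for all $n$. Kleene's $\mathcal O$ is its field, and $a\in\mathcal O$ is a notation of the order type $|a|_{\mathcal O}$ of $\{b:b<_{\mathcal O}a\}$; the constructive ordinals are those that have a notation. * $H_1=\emptyset$, $H_{2^b}=(H_b)'$, $H_{3\cdot5^e}=\{\langle x,n\rangle: x\in H_{\varphi_e(n)}\}$. The canonical complete $\Sigma_\beta$ set given by a notation $b$ of $\beta$ is $\emptyset_{(b)}=H_b$ if $\beta<\omega$ and $\emptyset_{(b)}=H_{2^b}$ if $\beta\ge\omega$; a set is $\Pi_\beta$ if it is one-one reducible to the complement of $\emptyset_{(b)}$, for any notation $b$ of $\beta$. * A code for a continuous partial function from $[0,1]$ to $\mathbb R$ is a set $\Phi\subseteq\mathbb N\times(\mathbb Q\cap[0,1])\times\mathbb Q^+\times\mathbb Q\times\mathbb Q^+$ such that, writing $(a,r)\Phi(b,s)$ for $\exists n\,(n,a,r,b,s)\in\Phi$: (1) if $(a,r)\Phi(b,s)$ and $(a,r)\Phi(b',s')$ then $|b-b'|\le s+s'$; (2) if $(a,r)\Phi(b,s)$ and $|a-a'|+r'<r$ then $(a',r')\Phi(b,s)$; (3) if $(a,r)\Phi(b,s)$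 and $|b-b'|+s<s'$ then $(a,r)\Phi(b',s')$. It codes $f\in C[0,1]$ if for all $x\in[0,1]$ and rational $\varepsilon>0$ there are $a,r,b$ with $|x-a|<r$ and $(a,r)\Phi(b,\varepsilon)$, and $|f(x)-b|\le s$ whenever $(a,r)\Phi(b,s)$, $x\in[0,1]$ and $|x-a|<r$. If $\varphi_e$ is the characteristic function of (the set of numbers of the elements of) such a $\Phi$, then $f_e$ denotes this $f$. * For $f\in C[0,1]$ let $\Delta_f(x,y)=\frac{f(x)-f(y)}{x-y}$. For $\varepsilon>0$ and closed $P\subseteq[0,1]$ let $P'_{f,\varepsilon}$ be the set of $x\in P$ such that for every rational $\delta>0$ there are rationals $p<q$, $r<s$ in $B(x,\delta)\cap[0,1]$ with $[p,q]\cap[r,s]\cap P\ne\emptyset$ and $|\Delta_f(p,q)-\Delta_f(r,s)|\ge\varepsilon$. Put $P^0_{f,\varepsilon}=[0,1]$, $P^{\gamma+1}_{f,\varepsilon}=(P^\gamma_{f,\varepsilon})'_{f,\varepsilon}$, and $P^\lambda_{f,\varepsilon}=\bigcap_{\gamma<\lambda}P^\gamma_{f,\varepsilon}$ for limit $\lambda$.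 For differentiable $f$, $|f|_{KW}$ is the least ordinal $\gamma$ such that $P^\gamma_{f,\varepsilon}=\emptyset$ for all $\varepsilon>0$. * $D_\beta$ is the set of all $e$ such that $\varphi_e$ codes a function $f_e\in C[0,1]$ that is differentiable on $[0,1]$ with $|f_e|_{KW}<\beta$. -/

import Mathlib

namespace KW

/-! ### Partial recursive functions and Turing functionals -/

/-- The `e`-th partial recursive function. -/
def phi (e : ℕ) : ℕ →. ℕ := (Denumerable.ofNat Nat.Partrec.Code e).eval

/-- Programs for partial functions that are recursive in an oracle: the programs of
`Nat.Partrec.Code` together with a call to the oracle. -/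
inductive OracleCode : Type
  | zero : OracleCode
  | succ : OracleCode
  | left : OracleCode
  | right : OracleCode
  | oracle : OracleCode
  | pair : OracleCode → OracleCode → OracleCode
  | comp : OracleCode → OracleCode → OracleCode
  | prec : OracleCode → OracleCode → OracleCode
  | rfind' : OracleCode → OracleCode

namespace OracleCode

open Classical in
/-- The partial function computed by a program with the characteristic function of `X` as its
oracle. Apart from the oracle call this is `Nat.Partrec.Code.eval`. -/
noncomputable def eval (X : Set ℕ) : OracleCode → ℕ →. ℕ
  | zero => pure 0
  | succ => fun n => Part.some (n + 1)
  | left => fun n => Part.some n.unpair.1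
  | right => fun n => Part.some n.unpair.2
  | oracle => fun n => Part.some (if n ∈ X then 1 else 0)
  | pair cf cg => fun n => Nat.pair <$> eval X cf n <*> eval X cg n
  | comp cf cg => fun n => eval X cg n >>= eval X cf
  | prec cf cg =>
    Nat.unpaired fun a n =>
      n.rec (eval X cf a) fun y IH => do
        let i ← IH
        eval X cg (Nat.pair a (Nat.pair y i))
  | rfind' cf =>
    Nat.unpaired fun a m =>
      (Nat.rfind fun n => (fun m => m = 0) <$> eval X cf (Nat.pair a (n + m))).map (· + m)

/-- The Gödel number of an oracle program. -/
def encodeCode : OracleCode → ℕ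
  | zero => 0
  | succ => 1
  | left => 2
  | right => 3
  | oracle => 4
  | pair cf cg => 2 * (2 * Nat.pair (encodeCode cf) (encodeCode cg)) + 5
  | comp cf cg => 2 * (2 * Nat.pair (encodeCode cf) (encodeCode cg) + 1) + 5
  | prec cf cg => (2 * (2 * Nat.pair (encodeCode cf) (encodeCode cg)) + 1) + 5
  | rfind' cf => (2 * (2 * encodeCode cf + 1) + 1) + 5

/-- The oracle program with a given Gödel number. -/
def ofNatCode : ℕ → OracleCode
  | 0 => zero
  | 1 => succ
  | 2 => left
  | 3 => right
  | 4 => oracle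
  | n + 5 =>
    let m := n.div2.div2
    have hm : m < n + 5 := by simp only [m, Nat.div2_val]; omega
    have _m1 : m.unpair.1 < n + 5 := lt_of_le_of_lt m.unpair_left_le hm
    have _m2 : m.unpair.2 < n + 5 := lt_of_le_of_lt m.unpair_right_le hm
    match n.bodd, n.div2.bodd with
    | false, false => pair (ofNatCode m.unpair.1) (ofNatCode m.unpair.2)
    | false, true => comp (ofNatCode m.unpair.1) (ofNatCode m.unpair.2)
    | true, false => prec (ofNatCode m.unpair.1) (ofNatCode m.unpair.2)
    | true, true => rfind' (ofNatCode m)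
  decreasing_by all_goals first | exact _m1 | exact _m2 | exact hm

theorem encode_ofNatCode : ∀ n, encodeCode (ofNatCode n) = n
  | 0 => by simp [ofNatCode, encodeCode]
  | 1 => by simp [ofNatCode, encodeCode]
  | 2 => by simp [ofNatCode, encodeCode]
  | 3 => by simp [ofNatCode, encodeCode]
  | 4 => by simp [ofNatCode, encodeCode]
  | n + 5 => by
    let m := n.div2.div2
    have hm : m < n + 5 := by simp only [m, Nat.div2_val]; omega
    have _m1 : m.unpair.1 < n + 5 := lt_of_le_of_lt m.unpair_left_le hm
    have _m2 : m.unpair.2 < n + 5 := lt_of_le_of_lt m.unpair_right_le hm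
    have IH := encode_ofNatCode m
    have IH1 := encode_ofNatCode m.unpair.1
    have IH2 := encode_ofNatCode m.unpair.2
    conv_rhs => rw [← Nat.bit_bodd_div2 n, ← Nat.bit_bodd_div2 n.div2]
    simp only [ofNatCode.eq_6]
    cases n.bodd <;> cases n.div2.bodd <;>
      simp [m, encodeCode, IH, IH1, IH2, Nat.bit_val]
  decreasing_by all_goals first | exact _m1 | exact _m2 | exact hm

theorem ofNatCode_encode (c : OracleCode) : ofNatCode (encodeCode c) = c := by
  induction c <;> simp [encodeCode, ofNatCode, Nat.div2_val, *]

instance instDenumerable : Denumerable OracleCode :=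
  Denumerable.mk' ⟨encodeCode, ofNatCode, ofNatCode_encode, encode_ofNatCode⟩

end OracleCode

/-- The `e`-th Turing functional with oracle `X`. -/
noncomputable def phiOracle (X : Set ℕ) (e : ℕ) : ℕ →. ℕ :=
  (Denumerable.ofNat OracleCode e).eval X

/-- The Turing jump of `X`. -/
def turingJump (X : Set ℕ) : Set ℕ := {e | (phiOracle X e e).Dom}

/-! ### Ordinal notations -/

/-- Kleene's relation `a <_𝒪 b`. -/
inductive KleeneLT : ℕ → ℕ → Prop
  | one_two : KleeneLT 1 2
  | succ {a b : ℕ} : KleeneLT a b → KleeneLT b (2 ^ b)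
  | limit {e : ℕ} (h : ℕ → ℕ) (hh : ∀ n, h n ∈ phi e n)
      (hlt : ∀ n, KleeneLT (h n) (h (n + 1))) (n : ℕ) : KleeneLT (h n) (3 * 5 ^ e)
  | trans {a b c : ℕ} : KleeneLT a b → KleeneLT b c → KleeneLT a c

/-- Kleene's `𝒪`: the field of `<_𝒪`. -/
def KleeneO : Set ℕ := {a | ∃ b, KleeneLT a b ∨ KleeneLT b a}

theorem three_mul_ne_two_pow (e b : ℕ) : 3 * 5 ^ e ≠ 2 ^ b := by
  intro h
  have h3 : (3 : ℕ) ∣ 2 ^ b := h ▸ Dvd.intro _ rfl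
  have := Nat.prime_three.dvd_of_dvd_pow h3
  omega

theorem KleeneLT.inv {c x : ℕ} (h : KleeneLT c x) :
    (∃ b, x = 2 ^ b ∧ (c = b ∨ KleeneLT c b)) ∨
      ∃ e, x = 3 * 5 ^ e ∧ ∃ g : ℕ → ℕ, (∀ n, g n ∈ phi e n) ∧
        (∀ n, KleeneLT (g n) (g (n + 1))) ∧ ∃ n, c = g n ∨ KleeneLT c (g n) := by
  induction h with
  | one_two => exact .inl ⟨1, rfl, .inl rfl⟩
  | @succ a b _ _ => exact .inl ⟨b, rfl, .inl rfl⟩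
  | @limit e g hg hlt n _ => exact .inr ⟨e, rfl, g, hg, hlt, n, .inl rfl⟩
  | @trans a b c hab _ _ ih =>
    rcases ih with ⟨d, rfl, hd⟩ | ⟨e, rfl, g, hg, hlt, n, hn⟩
    · refine .inl ⟨d, rfl, .inr ?_⟩
      rcases hd with rfl | hd
      · exact hab
      · exact hab.trans hd
    · refine .inr ⟨e, rfl, g, hg, hlt, n, .inr ?_⟩
      rcases hn with rfl | hn
      · exact hab
      · exact hab.trans hn

theorem KleeneLT.inv_succ {c b : ℕ} (h : KleeneLT c (2 ^ b)) : c = b ∨ KleeneLT c b := by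
  rcases h.inv with ⟨d, hd, h⟩ | ⟨e, he, _⟩
  · exact Nat.pow_right_injective le_rfl hd ▸ h
  · exact absurd he.symm (three_mul_ne_two_pow e b)

theorem KleeneLT.inv_limit {c e : ℕ} (h : KleeneLT c (3 * 5 ^ e)) :
    ∃ g : ℕ → ℕ, (∀ n, g n ∈ phi e n) ∧ (∀ n, KleeneLT (g n) (g (n + 1))) ∧
      ∃ n, c = g n ∨ KleeneLT c (g n) := by
  rcases h.inv with ⟨d, hd, _⟩ | ⟨e', he, h⟩
  · exact absurd hd (three_mul_ne_two_pow e d)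
  · have : 5 ^ e = 5 ^ e' := by omega
    exact Nat.pow_right_injective (by norm_num) this ▸ h

theorem not_kleeneLT_zero (c : ℕ) : ¬ KleeneLT c 0 := by
  intro h
  rcases h.inv with ⟨b, hb, _⟩ | ⟨e, he, _⟩
  · exact absurd hb.symm (by positivity)
  · exact absurd he.symm (by positivity)

theorem not_zero_kleeneLT (c : ℕ) : ¬ KleeneLT 0 c := by
  have main : ∀ x y, KleeneLT x y → x ≠ 0 := by
    intro x y h
    induction h with
    | one_two => exact one_ne_zero
    | succ h _ => rintro rfl; exact not_kleeneLT_zero _ h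
    | limit g _ _ n ih => exact ih n
    | trans _ _ ih _ => exact ih
  exact fun h => main _ _ h rfl

theorem not_kleeneLT_one (c : ℕ) : ¬ KleeneLT c 1 := by
  intro h
  rcases KleeneLT.inv_succ (b := 0) h with rfl | h
  · exact not_zero_kleeneLT _ h
  · exact not_kleeneLT_zero _ h

theorem KleeneLT.eq_one_or {x y : ℕ} (h : KleeneLT x y) : x = 1 ∨ ∃ z, KleeneLT z x := by
  induction h with
  | one_two => exact .inl rfl
  | succ h _ => exact .inr ⟨_, h⟩
  | limit g _ _ n ih => exact ih n
  | trans _ _ ih _ => exact ih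

theorem kleeneLT_wf : WellFounded KleeneLT := by
  refine ⟨fun b => ?_⟩
  by_cases hb : ∃ a, KleeneLT a b
  · obtain ⟨a, hab⟩ := hb
    induction hab with
    | one_two =>
      refine ⟨_, fun c hc => ?_⟩
      rcases KleeneLT.inv_succ (b := 1) hc with rfl | h
      · exact ⟨_, fun d hd => absurd hd (not_kleeneLT_one d)⟩
      · exact absurd h (not_kleeneLT_one c)
    | succ _ ih =>
      refine ⟨_, fun c hc => ?_⟩
      rcases hc.inv_succ with rfl | h
      · exact ih
      · exact ih.inv h
    | @limit e g hg _ n ih =>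
      refine ⟨_, fun c hc => ?_⟩
      obtain ⟨g', hg', _, m, hm⟩ := hc.inv_limit
      have hgg : KleeneLT c (g (m + 1)) := by
        have h1 : g' m = g m := Part.mem_unique (hg' m) (hg m)
        rw [h1] at hm
        rcases hm with rfl | hm
        · exact ‹∀ n, KleeneLT (g n) (g (n + 1))› m
        · exact hm.trans (‹∀ n, KleeneLT (g n) (g (n + 1))› m)
      exact (ih m).inv hgg
    | trans _ _ _ ih => exact ih
  · exact ⟨_, fun c hc => absurd ⟨c, hc⟩ hb⟩

theorem kleeneLT_trichotomous {a x y : ℕ} (hx : KleeneLT x a) (hy : KleeneLT y a) :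
    KleeneLT x y ∨ x = y ∨ KleeneLT y x := by
  induction a using kleeneLT_wf.induction generalizing x y with
  | _ a ih =>
    have key : ∀ d, KleeneLT d a → (x = d ∨ KleeneLT x d) → (y = d ∨ KleeneLT y d) →
        KleeneLT x y ∨ x = y ∨ KleeneLT y x := by
      rintro d hd (rfl | hx') (rfl | hy')
      · exact .inr (.inl rfl)
      · exact .inr (.inr hy')
      · exact .inl hx'
      · exact ih d hd hx' hy'
    rcases hx.inv with ⟨b, rfl, hxb⟩ | ⟨e, rfl, -⟩
    · have hb : KleeneLT b (2 ^ b) := by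
        rcases hxb with rfl | h
        · exact hx
        · exact h.succ
      exact key b hb hxb hy.inv_succ
    · obtain ⟨g, hg, hlt, m, hm⟩ := hx.inv_limit
      obtain ⟨g', hg', _, n, hn⟩ := hy.inv_limit
      have h1 : g' n = g n := Part.mem_unique (hg' n) (hg n)
      rw [h1] at hn
      have mono : ∀ i j, i ≤ j → ∀ z, (z = g i ∨ KleeneLT z (g i)) →
          (z = g j ∨ KleeneLT z (g j)) := by
        intro i j hij z hz
        induction j, hij using Nat.le_induction with
        | base => exact hz
        | succ j _ ihj =>
          rcases ihj with rfl | h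
          · exact .inr (hlt j)
          · exact .inr (h.trans (hlt j))
      exact key (g (max m n)) (.limit g hg hlt _) (mono _ _ (le_max_left m n) x hm)
        (mono _ _ (le_max_right m n) y hn)

instance isWellOrder_subrel (a : ℕ) :
    IsWellOrder {b // KleeneLT b a} (Subrel KleeneLT (fun b => KleeneLT b a)) where
  wf := InvImage.wf Subtype.val kleeneLT_wf
  trichotomous x y hxy hyx := by
    rcases kleeneLT_trichotomous x.2 y.2 with h | h | h
    · exact absurd h hxy
    · exact Subtype.ext h
    · exact absurd h hyx

/-- `|a|_𝒪`, the order type of `{b : b <_𝒪 a}`. -/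
noncomputable def ordO (a : ℕ) : Ordinal.{0} :=
  Ordinal.type (Subrel KleeneLT (fun b => KleeneLT b a))

/-- `a` is an ordinal notation for `α`. -/
def IsNotation (a : ℕ) (α : Ordinal.{0}) : Prop := a ∈ KleeneO ∧ ordO a = α

/-! ### The hyperarithmetic hierarchy -/

/-- The sets `H_a` for `a ∈ 𝒪`, by recursion along `<_𝒪`; the recursion equations are
`HSet_one`, `HSet_succ` and `HSet_limit` below. -/
noncomputable def HSet : ℕ → Set ℕ :=
  kleeneLT_wf.fix fun a IH =>
    {z | (∃ b, ∃ hb : KleeneLT b a, a = 2 ^ b ∧ z ∈ turingJump (IH b hb)) ∨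
      ∃ e, a = 3 * 5 ^ e ∧ ∃ x n m, ∃ hm : KleeneLT m a,
        z = Nat.pair x n ∧ m ∈ phi e n ∧ x ∈ IH m hm}

theorem HSet_eq (a : ℕ) : HSet a =
    {z | (∃ b, ∃ _ : KleeneLT b a, a = 2 ^ b ∧ z ∈ turingJump (HSet b)) ∨
      ∃ e, a = 3 * 5 ^ e ∧ ∃ x n m, ∃ _ : KleeneLT m a,
        z = Nat.pair x n ∧ m ∈ phi e n ∧ x ∈ HSet m} :=
  kleeneLT_wf.fix_eq _ a

theorem HSet_one : HSet 1 = ∅ := by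
  rw [HSet_eq]
  ext z
  simp [not_kleeneLT_one]

theorem kleeneLT_two_pow {b : ℕ} (hb : b ∈ KleeneO) : KleeneLT b (2 ^ b) := by
  obtain ⟨c, h | h⟩ := hb
  · rcases h.eq_one_or with rfl | ⟨z, hz⟩
    · exact .one_two
    · exact hz.succ
  · exact h.succ

theorem HSet_succ {b : ℕ} (hb : b ∈ KleeneO) : HSet (2 ^ b) = turingJump (HSet b) := by
  rw [HSet_eq (2 ^ b)]
  ext z
  constructor
  · rintro (⟨c, _, hc, hz⟩ | ⟨e, he, _⟩)
    · exact Nat.pow_right_injective le_rfl hc ▸ hz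
    · exact absurd he.symm (three_mul_ne_two_pow e b)
  · exact fun hz => .inl ⟨b, kleeneLT_two_pow hb, rfl, hz⟩

theorem HSet_limit {e : ℕ} (he : 3 * 5 ^ e ∈ KleeneO) :
    HSet (3 * 5 ^ e) = {z | ∃ x n m, z = Nat.pair x n ∧ m ∈ phi e n ∧ x ∈ HSet m} := by
  have hpred : ∃ c, KleeneLT c (3 * 5 ^ e) := by
    have h2 := kleeneLT_two_pow he
    by_contra hno
    push Not at hno
    rcases h2.eq_one_or with h | ⟨z, hz⟩
    · omega
    · exact hno z hz
  obtain ⟨c, hc⟩ := hpred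
  obtain ⟨g, hg, hlt, -⟩ := hc.inv_limit
  rw [HSet_eq (3 * 5 ^ e)]
  ext z
  constructor
  · rintro (⟨c, _, hc, _⟩ | ⟨e', he', x, n, m, _, hz, hm, hx⟩)
    · exact absurd hc (three_mul_ne_two_pow e c)
    · have : 5 ^ e = 5 ^ e' := by omega
      have := Nat.pow_right_injective (by norm_num) this
      subst this
      exact ⟨x, n, m, hz, hm, hx⟩
  · rintro ⟨x, n, m, hz, hm, hx⟩
    refine .inr ⟨e, rfl, x, n, m, ?_, hz, hm, hx⟩
    rw [Part.mem_unique hm (hg n)]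
    exact .limit g hg hlt n

open Classical in
/-- The canonical complete `Σ_β` set given by a notation `b` of `β`: it is `H_b = ∅^(β)` when `β` is
finite and `H_{2^b}` when `β` is infinite. -/
noncomputable def sigmaComplete (b : ℕ) : Set ℕ :=
  if ordO b < Ordinal.omega0 then HSet b else HSet (2 ^ b)

/-! ### Codes of computable functions in `C[0,1]` -/

/-- The number of a rational. -/
def ratCode (q : ℚ) : ℕ := Nat.pair (Encodable.encode q.num) q.den

/-- The number of a quintuple. -/
def quintCode : ℕ × ℚ × ℚ × ℚ × ℚ → ℕ
  | (n, a, r, b, s) =>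
    Nat.pair n (Nat.pair (ratCode a) (Nat.pair (ratCode r) (Nat.pair (ratCode b) (ratCode s))))

/-- `(a, r) Φ (b, s)`. -/
def Rel (Φ : Set (ℕ × ℚ × ℚ × ℚ × ℚ)) (a r b s : ℚ) : Prop := ∃ n : ℕ, (n, a, r, b, s) ∈ Φ

/-- `Φ` is a code for a continuous partial function from `[0,1]` to `ℝ`: `(a, r) Φ (b, s)` says that
the function maps `B(a, r)` into the closed ball of radius `s` about `b`. -/
structure IsCode (Φ : Set (ℕ × ℚ × ℚ × ℚ × ℚ)) : Prop where
  dom : ∀ {a r b s}, Rel Φ a r b s → 0 ≤ a ∧ a ≤ 1 ∧ 0 < r ∧ 0 < s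
  consistent : ∀ {a r b s b' s'}, Rel Φ a r b s → Rel Φ a r b' s' → |b - b'| ≤ s + s'
  shrink : ∀ {a r b s a' r'}, Rel Φ a r b s → 0 ≤ a' → a' ≤ 1 → 0 < r' → |a - a'| + r' < r →
    Rel Φ a' r' b s
  enlarge : ∀ {a r b s b' s'}, Rel Φ a r b s → |b - b'| + s < s' → Rel Φ a r b' s'

/-- `Φ` is a code for the (total) function `f ∈ C[0,1]`. -/
structure IsCodeOf (Φ : Set (ℕ × ℚ × ℚ × ℚ × ℚ)) (f : ℝ → ℝ) : Prop where
  isCode : IsCode Φ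
  total : ∀ x ∈ Set.Icc (0 : ℝ) 1, ∀ ε : ℚ, 0 < ε →
    ∃ a r b : ℚ, |x - a| < r ∧ Rel Φ a r b ε
  value : ∀ a r b s : ℚ, Rel Φ a r b s → ∀ x ∈ Set.Icc (0 : ℝ) 1, |x - a| < r → |f x - b| ≤ s

/-- `φ_e` is the characteristic function of the set `X`. -/
def Computes (e : ℕ) (X : Set ℕ) : Prop :=
  ∀ k, (k ∈ X → 1 ∈ phi e k) ∧ (k ∉ X → 0 ∈ phi e k)

/-- `φ_e` encodes the function `f ∈ C[0,1]`, that is `f = f_e` on `[0,1]`. The values of `f` outside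
`[0,1]` play no role. -/
def Encodes (e : ℕ) (f : ℝ → ℝ) : Prop :=
  ∃ Φ : Set (ℕ × ℚ × ℚ × ℚ × ℚ), Computes e (quintCode '' Φ) ∧ IsCodeOf Φ f

/-! ### The differentiability rank of Kechris and Woodin -/

/-- The slope of the secant of `f` through `x` and `y`. -/
noncomputable def secant (f : ℝ → ℝ) (x y : ℝ) : ℝ := (f x - f y) / (x - y)

/-- The derivative `P'_{f,ε}` of a set `P`. -/
def kwDeriv (f : ℝ → ℝ) (ε : ℝ) (P : Set ℝ) : Set ℝ :=
  {x ∈ P | ∀ δ : ℚ, 0 < δ → ∃ p q r s : ℚ, p < q ∧ r < s ∧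
    (∀ u ∈ ({p, q, r, s} : Set ℚ), (u : ℝ) ∈ Metric.ball x δ ∩ Set.Icc 0 1) ∧
    (Set.Icc (p : ℝ) q ∩ Set.Icc (r : ℝ) s ∩ P).Nonempty ∧
    ε ≤ |secant f p q - secant f r s|}

/-- The sets `P^α_{f,ε}`. -/
noncomputable def kwIter (f : ℝ → ℝ) (ε : ℝ) (α : Ordinal.{0}) : Set ℝ :=
  Ordinal.limitRecOn α (Set.Icc 0 1) (fun _ P => kwDeriv f ε P)
    (fun l _ P => ⋂ β, ⋂ h : β < l, P β h)

/-- `|f|_KW`, the least `α` such that `P^α_{f,ε}` is empty for all `ε > 0`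
(and `⊤` if there is no such `α`). -/
noncomputable def kwRank (f : ℝ → ℝ) : WithTop Ordinal.{0} :=
  sInf ((fun α : Ordinal.{0} => (α : WithTop Ordinal.{0})) ''
    {α | ∀ ε : ℝ, 0 < ε → kwIter f ε α = ∅})

/-- `D_α`: the indices `e` of functions `f_e ∈ C[0,1]` that are differentiable on `[0,1]`
(one-sidedly at the end points) with `|f_e|_KW < α`. -/
def DSet (α : Ordinal.{0}) : Set ℕ :=
  {e | ∃ f : ℝ → ℝ, ContinuousOn f (Set.Icc 0 1) ∧ Encodes e f ∧
    DifferentiableOn ℝ f (Set.Icc 0 1) ∧ kwRank f < (α : WithTop Ordinal.{0})}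

end KW

/-! The index `e` lies in `DSet (α + 1)` iff `φ_e` computes a code and `kwIter f ε α` is empty for
every `ε = 1/(m+1)`. Differentiability comes for free: a point where `f` is not differentiable
survives in every `kwIter f ε γ` for some fixed `ε` (`exists_forall_mem_kwIter`). Being an index of
a code is `Π₂`, because totality on the reals of `[0,1]` reduces by compactness to finite covers.

Emptiness of `[a,b] ∩ P^γ` for rational `a`, `b` is an iterated `∃∀` condition. It holds at `γ + 1`
iff there is a rational `δ > 0` such that for all rational `p < q`, `r < s` within `δ` of a rational
point of `[a,b]` and with slopes differing by more than `ε`, the interval `[p,q] ∩ [r,s]` misses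
`P^γ`. One `δ` serves all of `[a,b]` by a Lebesgue number argument. At a limit, compactness yields
an earlier stage that is already empty. The mismatch between `>` and `≥` costs an arbitrarily small
change of `ε`, which is harmless since all `ε` are considered. Hence the claims that hold at stage
`γ` are those generated in `γ` iterations of an operator `Y ↦ {x | ∃ u, ∀ v, next x u v ∈ Y}`; this
is `Derivable`. The `Π₂` condition is absorbed as further claims, derivable at any positive stage;
this is where `α > 0` enters.

It remains to see that `α` iterations of such an operator are `Σ_{2α}`, uniformly in notations; the
outer quantifier over `m` then gives `Π_{2α+1}`. By the recursion theorem a program `j` computes,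
from a notation `c` of `2γ` or `2γ + 1` and a claim `x`, a membership question about `sigmaComplete
c` that decides derivability of `x` at stage `γ`. Two successor steps are two jumps and pay for one
`∃∀`; the single step from an even to an odd level just copies the answer. At a limit one searches
through the columns of `H_c`. Since `sigmaComplete` is `H_c` below `ω` and `H_{2^c}` from `ω` on, a
second family of questions, addressed to `H_c` itself (`limitTest`), is carried along. The reduction
is one-one because the input is a constant inside the program whose halting is asked. The main
lemmas are `IsTestProgram.testsCorrect`, `exists_uniform_reduction`, `mem_DSet_iff`. -/

namespace KW

open Nat.Partrec (Code)

/-! ### Oracle programs that search for a passed test -/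

namespace OracleCode

/-- An ordinary program, seen as a program that does not use its oracle. -/
def ofCode : Code → OracleCode
  | .zero => zero
  | .succ => succ
  | .left => left
  | .right => right
  | .pair cf cg => pair (ofCode cf) (ofCode cg)
  | .comp cf cg => comp (ofCode cf) (ofCode cg)
  | .prec cf cg => prec (ofCode cf) (ofCode cg)
  | .rfind' cf => rfind' (ofCode cf)

theorem eval_ofCode (X : Set ℕ) (c : Code) : eval X (ofCode c) = c.eval := by
  induction c with
  | zero => rfl
  | succ => rfl
  | left => rfl
  | right => rfl
  | pair cf cg hf hg => simp only [ofCode, eval, Code.eval, hf, hg]; rfl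
  | comp cf cg hf hg => simp only [ofCode, eval, Code.eval, hf, hg]; rfl
  | prec cf cg hf hg => simp only [ofCode, eval, Code.eval, hf, hg]; rfl
  | rfind' cf hf => simp only [ofCode, eval, Code.eval, hf]; rfl

/-- A program for a constant function. -/
def const : ℕ → OracleCode
  | 0 => zero
  | n + 1 => comp succ (const n)

theorem eval_const (X : Set ℕ) (n m : ℕ) : eval X (const n) m = Part.some n := by
  induction n with
  | zero => rfl
  | succ n ih => simp [const, eval, ih]

theorem primrec_encodeCode_const : Primrec fun n => encodeCode (const n) := by
  have h : Primrec fun n : ℕ =>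
      -- Here `1` is the Gödel number of `succ`, and the rest is the clause of `encodeCode` for
      -- `comp`.
      (Nat.rec 0 (fun _ i => 2 * (2 * Nat.pair 1 i + 1) + 5) n : ℕ) := by
    refine Primrec.nat_rec₁ 0 ?_
    refine Primrec.nat_add.comp (Primrec.nat_mul.comp (.const 2) (Primrec.nat_add.comp
      (Primrec.nat_mul.comp (.const 2) (Primrec₂.natPair.comp (.const 1) Primrec.snd))
      (.const 1))) (.const 5)
  refine h.of_eq fun n => ?_
  induction n with
  | zero => rfl
  | succ n ih => simp only [const, encodeCode, ← ih]

theorem encodeCode_injective : Function.Injective encodeCode :=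
  Function.LeftInverse.injective ofNatCode_encode

theorem const_injective : Function.Injective const := fun m n h => by
  have := congrArg (fun c => eval ∅ c 0) h
  simpa [eval_const] using this

end OracleCode

theorem mem_turingJump_encodeCode (X : Set ℕ) (c : OracleCode) :
    OracleCode.encodeCode c ∈ turingJump X ↔ (c.eval X (OracleCode.encodeCode c)).Dom := by
  have : (Denumerable.ofNat OracleCode (OracleCode.encodeCode c)) = c :=
    OracleCode.ofNatCode_encode c
  simp only [turingJump, phiOracle, Set.mem_ofPred_eq, this]

/-- The test with number `⟨m, z⟩` about a set `X`: it is passed if `m = 0`, or if `m = 1` and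
`z ∉ X`, or if `m = 2` and `z ∈ X`. -/
def Passes (X : Set ℕ) (p : ℕ × ℕ) : Prop :=
  p.1 = 0 ∨ p.1 = 1 ∧ p.2 ∉ X ∨ p.1 = 2 ∧ p.2 ∈ X

/-- The complementary test. -/
def negTest (p : ℕ × ℕ) : ℕ × ℕ :=
  (if p.1 = 0 then 3 else if p.1 = 1 then 2 else if p.1 = 2 then 1 else 0, p.2)

theorem passes_negTest (X : Set ℕ) (p : ℕ × ℕ) : Passes X (negTest p) ↔ ¬ Passes X p := by
  obtain ⟨m, z⟩ := p
  simp only [Passes, negTest]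
  split_ifs <;> simp_all

theorem primrec_negTest : Primrec negTest := by
  have h (k : ℕ) : PrimrecPred fun p : ℕ × ℕ => p.1 = k := Primrec.eq.comp .fst (.const k)
  exact (Primrec.ite (h 0) (.const 3) (Primrec.ite (h 1) (.const 2)
    (Primrec.ite (h 2) (.const 1) (.const 0)))).pair .snd

open OracleCode in
/-- There is a program that searches for `v` such that `φ_j(⟨y, v⟩)` is a test passed by the
oracle. -/
theorem exists_searchProgram : ∃ K : OracleCode, ∀ (X : Set ℕ) (j y : ℕ) (F : ℕ → ℕ × ℕ),
    (∀ v, Nat.pair (F v).1 (F v).2 ∈ phi j (Nat.pair y v)) → ∀ n,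
      ((comp K (const (Nat.pair j y))).eval X n).Dom ↔ ∃ v, Passes X (F v) := by
  obtain ⟨U, hU⟩ : ∃ U : Code, U.eval = fun n =>
      phi n.unpair.1.unpair.1 (Nat.pair n.unpair.1.unpair.2 n.unpair.2) := by
    refine Code.exists_code.1 (Partrec.nat_iff.1 ?_)
    have h1 : Computable fun n : ℕ => n.unpair.1 := Computable.fst.comp .unpair
    have h2 : Computable fun n : ℕ => n.unpair.2 := Computable.snd.comp .unpair
    exact Code.eval_part.comp ((Computable.ofNat Code).comp (h1.comp h1))
      (Primrec₂.natPair.to_comp.comp (h2.comp h1) h2)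
  -- From `⟨m, χ⟩`, with `χ` the oracle's answer, `N` returns `0` exactly when the test is passed,
  -- because the unbounded search stops at a zero.
  obtain ⟨N, hN⟩ : ∃ N : Code, N.eval = fun n => Part.some
      (if n.unpair.1 = 0 then 0 else if n.unpair.1 = 1 then n.unpair.2 else
        if n.unpair.1 = 2 then 1 - n.unpair.2 else 1) := by
    refine Code.exists_code.1 (Partrec.nat_iff.1 (Primrec.to_comp ?_).partrec)
    have h1 : Primrec fun n : ℕ => n.unpair.1 := Primrec.fst.comp .unpair
    have h2 : Primrec fun n : ℕ => n.unpair.2 := Primrec.snd.comp .unpair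
    have h (k : ℕ) : PrimrecPred fun n : ℕ => n.unpair.1 = k := Primrec.eq.comp h1 (.const k)
    exact Primrec.ite (h 0) (.const 0) (Primrec.ite (h 1) h2
      (Primrec.ite (h 2) (Primrec.nat_sub.comp (.const 1) h2) (.const 1)))
  let C : OracleCode := comp (ofCode N) (comp (pair left (comp oracle right)) (ofCode U))
  -- `pair left right` computes the identity, so `rfind'` starts at `⟨⟨j, y⟩, 0⟩`.
  refine ⟨comp (rfind' C) (pair (pair left right) zero), fun X j y F hF n => ?_⟩
  have hC (v : ℕ) : ∃ b, C.eval X (Nat.pair (Nat.pair j y) v) = Part.some b ∧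
      (b = 0 ↔ Passes X (F v)) := by
    classical
    have hv := Part.eq_some_iff.2 (hF v)
    refine ⟨if (F v).1 = 0 then 0 else if (F v).1 = 1 then if (F v).2 ∈ X then 1 else 0 else
        if (F v).1 = 2 then 1 - if (F v).2 ∈ X then 1 else 0 else 1, ?_, ?_⟩
    · simp only [C, eval, eval_ofCode, hU, hN, Nat.unpair_pair, hv]
      simp [Seq.seq]
    · simp only [Passes]
      split_ifs <;> simp_all
  choose b hb hb' using hC
  have hrun : (comp (comp (rfind' C) (pair (pair left right) zero)) (const (Nat.pair j y))).eval X n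
      = (Nat.rfind fun v => Part.some (decide (b v = 0))).map (· + 0) := by
    have h0 : (pure 0 : ℕ →. ℕ) (Nat.pair j y) = Part.some 0 := rfl
    simp [eval, eval_const, Seq.seq, hb, h0]
  rw [hrun]
  refine Nat.rfind_dom'.trans ⟨fun ⟨v, hv, _⟩ => ⟨v, ?_⟩, fun ⟨v, hv⟩ => ⟨v, ?_, fun _ => trivial⟩⟩
  · simpa [hb'] using hv
  · simpa [hb'] using hv

/-- A program as in `exists_searchProgram`. -/
noncomputable def searchProgram : OracleCode := exists_searchProgram.choose

/-- The number of the program that searches for `v` such that `φ_j(⟨y, v⟩)` is a test passed by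
the oracle. -/
noncomputable def query (j y : ℕ) : ℕ :=
  OracleCode.encodeCode (.comp searchProgram (.const (Nat.pair j y)))

/-- The program ignores its input, so running it on its own number, as the jump demands, is just the
search. -/
theorem query_mem_turingJump {X : Set ℕ} {j y : ℕ} {F : ℕ → ℕ × ℕ}
    (hF : ∀ v, Nat.pair (F v).1 (F v).2 ∈ phi j (Nat.pair y v)) :
    query j y ∈ turingJump X ↔ ∃ v, Passes X (F v) := by
  rw [query, mem_turingJump_encodeCode]
  exact exists_searchProgram.choose_spec X j y F hF _

/-- The data `y` is a constant inside the program and can be read off its number. This is the source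
of one-one reducibility. -/
theorem query_injective (j : ℕ) : Function.Injective (query j) := fun y y' h => by
  have := OracleCode.encodeCode_injective h
  simp only [OracleCode.comp.injEq, true_and] at this
  have := OracleCode.const_injective this
  simpa using this

theorem primrec_query : Primrec₂ query := by
  have h : Primrec fun p : ℕ × ℕ => OracleCode.encodeCode (.const (Nat.pair p.1 p.2)) :=
    OracleCode.primrec_encodeCode_const.comp Primrec₂.natPair
  exact Primrec.nat_add.comp (Primrec.nat_mul.comp (.const 2) (Primrec.nat_add.comp
    (Primrec.nat_mul.comp (.const 2) (Primrec₂.natPair.comp (.const _) h)) (.const 1))) (.const 5)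

end KW

/-! ### Order types of notations -/

namespace KW

open Nat.Partrec (Code)
open Ordinal

/-- By transitivity the predecessors of `x <_𝒪 a` form an initial segment of those of `a`, so `ordO
x` is the position of `x` in the well-order below `a`. -/
theorem lt_ordO_iff {o : Ordinal.{0}} {a : ℕ} : o < ordO a ↔ ∃ x, KleeneLT x a ∧ ordO x = o := by
  have key (x : {b // KleeneLT b a}) :
      typein (Subrel KleeneLT (fun b => KleeneLT b a)) x = ordO x.1 := by
    rw [typein, ordO]
    refine Ordinal.type_eq.2 ⟨⟨⟨fun y => ⟨y.1.1, y.2⟩, fun y => ⟨⟨y.1, y.2.trans x.2⟩, y.2⟩,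
      fun y => rfl, fun y => rfl⟩, Iff.rfl⟩⟩
  constructor
  · intro h
    obtain ⟨x, hx⟩ := typein_surj _ h
    exact ⟨x.1, x.2, by rw [← hx, key]⟩
  · rintro ⟨x, hx, rfl⟩
    rw [← key ⟨x, hx⟩]
    exact typein_lt_type _ _

theorem ordO_lt {x a : ℕ} (h : KleeneLT x a) : ordO x < ordO a := lt_ordO_iff.2 ⟨x, h, rfl⟩

theorem ordO_one : ordO 1 = 0 := by
  by_contra h
  obtain ⟨x, hx, -⟩ := lt_ordO_iff.1 (pos_iff_ne_zero.2 h)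
  exact not_kleeneLT_one x hx

theorem ordO_two_pow {a : ℕ} (ha : a ∈ KleeneO) : ordO (2 ^ a) = ordO a + 1 := by
  refine eq_of_forall_lt_iff fun o => ?_
  rw [lt_ordO_iff, ← Order.succ_eq_add_one, Order.lt_succ_iff]
  constructor
  · rintro ⟨x, hx, rfl⟩
    rcases hx.inv_succ with rfl | h
    · exact le_rfl
    · exact (ordO_lt h).le
  · intro h
    rcases h.eq_or_lt with rfl | h
    · exact ⟨a, kleeneLT_two_pow ha, rfl⟩
    · obtain ⟨x, hx, rfl⟩ := lt_ordO_iff.1 h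
      exact ⟨x, hx.trans (kleeneLT_two_pow ha), rfl⟩

/-- `g` is the fundamental sequence of the limit notation `3 * 5 ^ e`. -/
structure IsFundamental (e : ℕ) (g : ℕ → ℕ) : Prop where
  mem : ∀ n, g n ∈ phi e n
  lt : ∀ n, KleeneLT (g n) (g (n + 1))

namespace IsFundamental

variable {e : ℕ} {g : ℕ → ℕ}

theorem kleeneLT (h : IsFundamental e g) (n : ℕ) : KleeneLT (g n) (3 * 5 ^ e) :=
  .limit g h.mem h.lt n

theorem mem_kleeneO (h : IsFundamental e g) (n : ℕ) : g n ∈ KleeneO := ⟨_, .inl (h.lt n)⟩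

theorem lt_ordO_iff (h : IsFundamental e g) {o : Ordinal.{0}} :
    o < ordO (3 * 5 ^ e) ↔ ∃ n, o < ordO (g n) := by
  rw [KW.lt_ordO_iff]
  constructor
  · rintro ⟨x, hx, rfl⟩
    obtain ⟨g', hg', -, n, hn⟩ := hx.inv_limit
    have : g' n = g n := Part.mem_unique (hg' n) (h.mem n)
    rw [this] at hn
    refine ⟨n + 1, ?_⟩
    rcases hn with rfl | hn
    · exact ordO_lt (h.lt n)
    · exact (ordO_lt hn).trans (ordO_lt (h.lt n))
  · rintro ⟨n, hn⟩
    obtain ⟨x, hx, rfl⟩ := KW.lt_ordO_iff.1 hn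
    exact ⟨x, hx.trans (h.kleeneLT n), rfl⟩

theorem add_one_lt (h : IsFundamental e g) {o : Ordinal.{0}} (ho : o < ordO (3 * 5 ^ e)) :
    o + 1 < ordO (3 * 5 ^ e) := by
  obtain ⟨n, hn⟩ := h.lt_ordO_iff.1 ho
  refine h.lt_ordO_iff.2 ⟨n + 1, lt_of_le_of_lt ?_ (ordO_lt (h.lt n))⟩
  rwa [← Order.succ_eq_add_one, Order.succ_le_iff]

theorem isSuccLimit (h : IsFundamental e g) : Order.IsSuccLimit (ordO (3 * 5 ^ e)) := by
  refine (Order.isSuccLimit_iff _).2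
    ⟨?_, Order.isSuccPrelimit_of_succ_lt fun o ho => h.add_one_lt ho⟩
  simpa using (bot_le.trans_lt (ordO_lt (h.kleeneLT 0))).ne'

end IsFundamental

theorem one_mem_kleeneO : 1 ∈ KleeneO := ⟨2, .inl .one_two⟩

/-- The exception comes from `2 ^ 0 = 1`, a notation although `0` is not one. It is the reason for
the conditions `d ≠ 0` in what follows. -/
theorem two_pow_mem_kleeneO {b : ℕ} : 2 ^ b ∈ KleeneO ↔ b ∈ KleeneO ∨ b = 0 := by
  constructor
  · rintro ⟨c, h | h⟩
    · rcases h.eq_one_or with h | ⟨z, hz⟩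
      · exact .inr (by simpa using h)
      · rcases hz.inv_succ with rfl | h'
        · exact .inl ⟨_, .inl hz⟩
        · exact .inl ⟨_, .inr h'⟩
    · rcases h.inv_succ with rfl | h'
      · exact .inl ⟨_, .inl h⟩
      · exact .inl ⟨_, .inr h'⟩
  · rintro (h | rfl)
    · exact ⟨_, .inr (kleeneLT_two_pow h)⟩
    · exact one_mem_kleeneO

theorem kleeneO_cases {c : ℕ} (hc : c ∈ KleeneO) :
    c = 1 ∨ (∃ d ∈ KleeneO, d ≠ 0 ∧ c = 2 ^ d) ∨ ∃ e g, c = 3 * 5 ^ e ∧ IsFundamental e g := by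
  have main : ∀ z, KleeneLT z c →
      (∃ d ∈ KleeneO, d ≠ 0 ∧ c = 2 ^ d) ∨ ∃ e g, c = 3 * 5 ^ e ∧ IsFundamental e g := by
    intro z hz
    rcases hz.inv with ⟨d, rfl, h⟩ | ⟨e, rfl, g, h1, h2, -⟩
    · have hd : d ≠ 0 := by
        rintro rfl
        exact not_kleeneLT_one _ hz
      exact .inl ⟨d, by simpa [hd] using two_pow_mem_kleeneO.1 hc, hd, rfl⟩
    · exact .inr ⟨e, g, rfl, h1, h2⟩
  obtain ⟨b, h | h⟩ := id hc
  · rcases h.eq_one_or with rfl | ⟨z, hz⟩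
    · exact .inl rfl
    · exact .inr (main z hz)
  · exact .inr (main b h)

theorem zero_notMem_kleeneO : 0 ∉ KleeneO := by
  rintro ⟨b, h | h⟩
  · exact not_zero_kleeneLT b h
  · exact not_kleeneLT_zero b h

@[elab_as_elim]
theorem kleeneO_induction {P : ℕ → Prop} {c : ℕ} (hc : c ∈ KleeneO) (one : P 1)
    (succ : ∀ d ∈ KleeneO, P d → P (2 ^ d))
    (limit : ∀ e g, IsFundamental e g → (∀ n, P (g n)) → P (3 * 5 ^ e)) :
    P c := by
  induction c using kleeneLT_wf.induction with
  | _ c ih =>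
    rcases kleeneO_cases hc with rfl | ⟨d, hd, -, rfl⟩ | ⟨e, g, rfl, h⟩
    · exact one
    · exact succ d hd (ih d (kleeneLT_two_pow hd) hd)
    · exact limit e g h fun n => ih _ (h.kleeneLT n) (h.mem_kleeneO n)

/-! ### Computing with notations -/

theorem primrec_pow : Primrec₂ fun a b : ℕ => a ^ b := Primrec₂.unpaired'.1 Nat.Primrec.pow

theorem primrec_log (b : ℕ) (hb : 1 < b) : Primrec (Nat.log b) := by
  have h : Primrec fun n => Nat.findGreatest (fun k => b ^ k ≤ n) n :=
    Primrec.nat_findGreatest .id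
      (Primrec.nat_le.comp (primrec_pow.comp (.const b) .snd) .fst)
  refine h.of_eq fun n => ?_
  rcases eq_or_ne n 0 with rfl | hn
  · simp
  · refine (Nat.findGreatest_eq_iff).2 ⟨(Nat.log_le_self b n), fun _ => Nat.pow_log_le_self b hn,
      fun k hk _ h => ?_⟩
    exact absurd (Nat.le_log_of_pow_le hb h) (by omega)

theorem log_three_mul_five_pow (e : ℕ) : Nat.log 5 (3 * 5 ^ e) = e := by
  rw [Nat.log_eq_iff (.inr ⟨by norm_num, by positivity⟩)]
  have : 0 < 5 ^ e := by positivity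
  rw [pow_succ]
  omega

/-- A definition by cases according to the form of a notation. -/
def notationCases {α : Type*} (c : ℕ) (one : α) (succ limit : ℕ → α) (other : α) : α :=
  if c = 1 then one else if c = 2 ^ Nat.log 2 c then succ (Nat.log 2 c) else
    if c = 3 * 5 ^ Nat.log 5 c then limit (Nat.log 5 c) else other

section notationCases

variable {α : Type*} (one : α) (succ limit : ℕ → α) (other : α)

theorem notationCases_one : notationCases 1 one succ limit other = one := rfl

theorem notationCases_two_pow {d : ℕ} (hd : d ≠ 0) :
    notationCases (2 ^ d) one succ limit other = succ d := by
  simp [notationCases, hd]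

theorem notationCases_limit (e : ℕ) :
    notationCases (3 * 5 ^ e) one succ limit other = limit e := by
  rw [notationCases, if_neg (by omega), if_neg (three_mul_ne_two_pow _ _), log_three_mul_five_pow,
    if_pos rfl]

end notationCases

theorem primrecPred_eq_two_pow_log : PrimrecPred fun c : ℕ => c = 2 ^ Nat.log 2 c :=
  Primrec.eq.comp .id (primrec_pow.comp (.const 2) (primrec_log 2 (by norm_num)))

theorem primrecPred_eq_limit_log : PrimrecPred fun c : ℕ => c = 3 * 5 ^ Nat.log 5 c :=
  Primrec.eq.comp .id
    (Primrec.nat_mul.comp (.const 3) (primrec_pow.comp (.const 5) (primrec_log 5 (by norm_num))))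

theorem partrec_ite {α σ : Type*} [Primcodable α] [Primcodable σ] {p : α → Prop} [DecidablePred p]
    {f g : α →. σ} (hp : ComputablePred p) (hf : Partrec f) (hg : Partrec g) :
    Partrec fun a => if p a then f a else g a :=
  (Partrec.cond hp.decide hf hg).of_eq fun a => by by_cases h : p a <;> simp [h]

theorem computable_ite {α σ : Type*} [Primcodable α] [Primcodable σ] {p : α → Prop}
    [DecidablePred p] {f g : α → σ} (hp : ComputablePred p) (hf : Computable f)
    (hg : Computable g) : Computable fun a => if p a then f a else g a :=
  (Computable.cond hp.decide hf hg).of_eq fun a => by by_cases h : p a <;> simp [h]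

theorem partrec_notationCases {α σ : Type*} [Primcodable α] [Primcodable σ] {c : α → ℕ}
    {one : α →. σ} {succ limit : α → ℕ →. σ} {other : α →. σ} (hc : Primrec c)
    (hone : Partrec one) (hsucc : Partrec₂ succ) (hlimit : Partrec₂ limit)
    (hother : Partrec other) :
    Partrec fun a => notationCases (c a) (one a) (succ a) (limit a) (other a) := by
  have h2 : Computable fun a => Nat.log 2 (c a) := ((primrec_log 2 (by norm_num)).comp hc).to_comp
  have h5 : Computable fun a => Nat.log 5 (c a) := ((primrec_log 5 (by norm_num)).comp hc).to_comp
  exact partrec_ite (Primrec.eq.comp hc (.const 1)).computablePred hone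
    (partrec_ite (primrecPred_eq_two_pow_log.comp hc).computablePred (hsucc.comp .id h2)
      (partrec_ite (primrecPred_eq_limit_log.comp hc).computablePred (hlimit.comp .id h5) hother))

theorem computable_notationCases {α σ : Type*} [Primcodable α] [Primcodable σ] {c : α → ℕ}
    {one : α → σ} {succ limit : α → ℕ → σ} {other : α → σ} (hc : Primrec c)
    (hone : Computable one) (hsucc : Computable₂ succ) (hlimit : Computable₂ limit)
    (hother : Computable other) :
    Computable fun a => notationCases (c a) (one a) (succ a) (limit a) (other a) := by
  have h2 : Computable fun a => Nat.log 2 (c a) := ((primrec_log 2 (by norm_num)).comp hc).to_comp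
  have h5 : Computable fun a => Nat.log 5 (c a) := ((primrec_log 5 (by norm_num)).comp hc).to_comp
  exact computable_ite (Primrec.eq.comp hc (.const 1)).computablePred hone
    (computable_ite (primrecPred_eq_two_pow_log.comp hc).computablePred (hsucc.comp .id h2)
      (computable_ite (primrecPred_eq_limit_log.comp hc).computablePred (hlimit.comp .id h5)
        hother))

theorem log_two_lt {c : ℕ} (h : c = 2 ^ Nat.log 2 c) : Nat.log 2 c < c :=
  lt_of_lt_of_eq Nat.lt_two_pow_self h.symm

/-- Recursion along the successor notations. -/
def notationRec {σ : Type*} (one : σ) (succ : σ → σ) (limit : σ) (c : ℕ) : σ :=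
  if c = 1 then one else if _h : c = 2 ^ Nat.log 2 c then
    succ (notationRec one succ limit (Nat.log 2 c)) else limit
  termination_by c
  decreasing_by exact log_two_lt _h

section notationRec

variable {σ : Type*} (one : σ) (succ : σ → σ) (limit : σ)

theorem notationRec_one : notationRec one succ limit 1 = one := by
  rw [notationRec, if_pos rfl]

theorem notationRec_two_pow {d : ℕ} (hd : d ≠ 0) :
    notationRec one succ limit (2 ^ d) = succ (notationRec one succ limit d) := by
  rw [notationRec]
  simp [hd]

theorem notationRec_limit (e : ℕ) : notationRec one succ limit (3 * 5 ^ e) = limit := by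
  rw [notationRec, if_neg (by omega), dif_neg (three_mul_ne_two_pow _ _)]

theorem computable_notationRec [Primcodable σ] (hsucc : Computable succ) :
    Computable (notationRec one succ limit) := by
  have hlen : Primrec fun p : Unit × List σ => p.2.length := Primrec.list_length.comp .snd
  have hlog : Computable fun p : Unit × List σ => Nat.log 2 p.2.length :=
    ((primrec_log 2 (by norm_num)).comp hlen).to_comp
  -- Course-of-values recursion: `l` lists the values below `c`, so `c` is its length.
  have hg : Computable₂ fun (_ : Unit) (l : List σ) =>
      if l.length = 1 then some one else if l.length = 2 ^ Nat.log 2 l.length then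
        (l[Nat.log 2 l.length]?).map succ else some limit := by
    refine computable_ite (Primrec.eq.comp hlen (.const 1)).computablePred (.const _)
      (computable_ite (primrecPred_eq_two_pow_log.comp hlen).computablePred ?_ (.const _))
    exact Computable.option_map (Computable.list_getElem?.comp .snd hlog)
      (hsucc.comp .snd).to₂
  refine (Computable.nat_strong_rec (fun _ : Unit => notationRec one succ limit) hg
    fun _ n => ?_).comp (.const ()) .id
  simp only [List.length_map, List.length_range]
  rw [notationRec]
  by_cases h1 : n = 1
  · simp [h1]
  · by_cases h2 : n = 2 ^ Nat.log 2 n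
    · rw [if_neg h1, if_neg h1, if_pos h2, dif_pos h2, List.getElem?_map,
        List.getElem?_range (log_two_lt h2)]
      rfl
    · simp [h1, h2]

end notationRec

/-- Whether a notation denotes a finite ordinal. -/
def isFinite : ℕ → Bool := notationRec true id false

/-- Whether a notation denotes an odd ordinal. -/
def isOdd : ℕ → Bool := notationRec false not false

theorem computable_isFinite : Computable isFinite := computable_notationRec _ _ _ .id

theorem computable_isOdd : Computable isOdd :=
  computable_notationRec _ _ _ Primrec.not.to_comp

theorem ne_zero_of_mem_kleeneO {d : ℕ} (hd : d ∈ KleeneO) : d ≠ 0 := by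
  rintro rfl
  exact zero_notMem_kleeneO hd

theorem isFinite_iff {c : ℕ} (hc : c ∈ KleeneO) : isFinite c = true ↔ ordO c < ω := by
  refine kleeneO_induction hc ?_ (fun d hd ih => ?_) fun e g h _ => ?_
  · simp [isFinite, notationRec_one, ordO_one]
  · rw [isFinite, notationRec_two_pow _ _ _ (ne_zero_of_mem_kleeneO hd), ordO_two_pow hd]
    refine ih.trans ⟨fun h => isSuccLimit_omega0.add_one_lt h, fun h => lt_of_le_of_lt ?_ h⟩
    exact le_self_add
  · simpa [isFinite, notationRec_limit] using omega0_le_of_isSuccLimit h.isSuccLimit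

/-- Parity alternates along successors. A limit `l` is even, since `2 * (l / 2) < l` would give `2 *
(l / 2) + 2 < l`, against the choice of the quotient. -/
theorem ordO_eq {c : ℕ} (hc : c ∈ KleeneO) :
    ordO c = 2 * (ordO c / 2) + if isOdd c then 1 else 0 := by
  have h2 : (2 : Ordinal.{0}) ≠ 0 := two_ne_zero
  have h12 : (1 : Ordinal.{0}) / 2 = 0 := Ordinal.div_eq_zero_of_lt one_lt_two
  refine kleeneO_induction hc ?_ (fun d hd ih => ?_) fun e g h _ => ?_
  · simp [isOdd, notationRec_one, ordO_one]
  · rw [isOdd, notationRec_two_pow _ _ _ (ne_zero_of_mem_kleeneO hd), ordO_two_pow hd, ← isOdd]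
    generalize hγ : ordO d / 2 = γ at ih
    cases hodd : isOdd d with
    | false =>
      simp only [hodd, Bool.false_eq_true, if_false, add_zero] at ih
      simp [ih, mul_add_div _ h2, h12]
    | true =>
      simp only [hodd, if_true] at ih
      have : 2 * γ + 1 + 1 = 2 * (γ + 1) := by
        rw [mul_add, mul_one, add_assoc, one_add_one_eq_two]
      simp [ih, this, mul_div_cancel _ h2]
  · simp only [isOdd, notationRec_limit, Bool.false_eq_true, if_false, add_zero]
    refine le_antisymm (le_of_not_gt fun hlt => ?_) (mul_div_le _ _)
    have := h.add_one_lt (h.add_one_lt hlt)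
    have h3 := lt_mul_div_add (ordO (3 * 5 ^ e)) h2
    rw [add_assoc, one_add_one_eq_two] at this
    exact lt_asymm this h3

theorem ordO_two_pow_div {d : ℕ} (hd : d ∈ KleeneO) (h : isOdd d = false) :
    ordO (2 ^ d) / 2 = ordO d / 2 := by
  have h1 := ordO_eq hd
  rw [h] at h1
  generalize ordO d / 2 = γ at h1
  rw [ordO_two_pow hd, h1]
  simp [mul_add_div _ (two_ne_zero : (2 : Ordinal.{0}) ≠ 0), Ordinal.div_eq_zero_of_lt one_lt_two]

theorem ordO_two_pow_two_pow_div {d : ℕ} (hd : d ∈ KleeneO) :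
    ordO (2 ^ 2 ^ d) / 2 = ordO d / 2 + 1 := by
  have h1 := ordO_eq hd
  have h2 : (2 : Ordinal.{0}) ≠ 0 := two_ne_zero
  generalize ordO d / 2 = γ at h1
  have h4 (x : Ordinal.{0}) : x + 1 + 1 = x + 2 := by rw [add_assoc, one_add_one_eq_two]
  rw [ordO_two_pow (two_pow_mem_kleeneO.2 (.inl hd)), ordO_two_pow hd, h4, h1]
  split_ifs
  · have : 2 * γ + 1 + 2 = 2 * (γ + 1) + 1 := by
      rw [mul_add, mul_one, ← one_add_one_eq_two]
      simp only [add_assoc]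
    rw [this, mul_add_div _ h2, Ordinal.div_eq_zero_of_lt one_lt_two, add_zero]
  · have : 2 * γ + 0 + 2 = 2 * (γ + 1) := by rw [mul_add, mul_one, add_zero]
    rw [this, mul_div_cancel _ h2]

/-! ### Doubling -/

/-- There is a computable function that turns notations of `α` into notations of `2 * α`. -/
theorem exists_computable_double : ∃ D : ℕ → ℕ, Computable D ∧
    ∀ a ∈ KleeneO, D a ∈ KleeneO ∧ ordO (D a) = 2 * ordO a := by
  -- Recursion theorem: `j` stands for the program being defined. A limit notation goes to an index
  -- of `j ∘ φ_e`, without running either program.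
  let F : Code → ℕ →. ℕ := fun j n => notationCases n (Part.some 1)
    (fun a => (j.eval a).map fun x => 2 ^ 2 ^ x)
    (fun e => Part.some (3 * 5 ^ Encodable.encode (Code.comp j (Denumerable.ofNat Code e))))
    (Part.some 0)
  have hF : Partrec₂ F := by
    have hpow : Primrec fun x : ℕ => 2 ^ x := primrec_pow.comp (.const 2) .id
    refine partrec_notationCases (c := fun p : Code × ℕ => p.2) .snd (Computable.const 1).partrec
      ?_ ?_ (Computable.const 0).partrec
    · exact (Code.eval_part.comp (Computable.fst.comp .fst) .snd).map
        ((hpow.comp hpow).comp Primrec.snd).to_comp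
    · have : Primrec fun p : (Code × ℕ) × ℕ =>
          3 * 5 ^ Encodable.encode (Code.comp p.1.1 (Denumerable.ofNat Code p.2)) :=
        Primrec.nat_mul.comp (.const 3) (primrec_pow.comp (.const 5) (Primrec.encode.comp
          (Code.primrec₂_comp.comp (Primrec.fst.comp .fst) ((Primrec.ofNat Code).comp .snd))))
      exact this.to_comp.partrec
  obtain ⟨j, hj⟩ := Code.fixed_point₂ hF
  -- Totality holds for all numbers, notations or not: the only recursive call is at a smaller
  -- logarithm.
  have htot : ∀ n, (j.eval n).Dom := by
    intro n
    induction n using Nat.strong_induction_on with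
    | _ n ih =>
      rw [hj]
      simp only [F, notationCases]
      split_ifs with h1 h2 h3
      · trivial
      · exact ih _ (log_two_lt h2)
      · trivial
      · trivial
  let D : ℕ → ℕ := fun n => (j.eval n).get (htot n)
  have hD (n : ℕ) : j.eval n = Part.some (D n) := (Part.some_get _).symm
  have D_one : D 1 = 1 := by
    have := hD 1
    rw [hj] at this
    simpa [F, notationCases_one] using this.symm
  have D_succ {a : ℕ} (ha : a ≠ 0) : D (2 ^ a) = 2 ^ 2 ^ D a := by
    have := hD (2 ^ a)
    rw [hj] at this
    simpa [F, notationCases_two_pow _ _ _ _ ha, hD] using this.symm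
  have D_limit (e : ℕ) : D (3 * 5 ^ e) =
      3 * 5 ^ Encodable.encode (Code.comp j (Denumerable.ofNat Code e)) := by
    have := hD (3 * 5 ^ e)
    rw [hj] at this
    simp only [F, notationCases_limit] at this
    simpa using this.symm
  have D_fund {e : ℕ} {g : ℕ → ℕ} (hg : ∀ n, g n ∈ phi e n) (n : ℕ) :
      D (g n) ∈ phi (Encodable.encode (Code.comp j (Denumerable.ofNat Code e))) n := by
    have h1 : (Denumerable.ofNat Code e).eval n = Part.some (g n) := Part.eq_some_iff.2 (hg n)
    simp only [phi, Denumerable.ofNat_encode, Code.eval, h1]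
    exact Part.mem_bind (Part.mem_some _) (by simp [hD])
  have hlt : ∀ {a b : ℕ}, KleeneLT a b → KleeneLT (D a) (D b) := by
    intro a b h
    induction h with
    | one_two =>
      have : D 2 = 2 ^ 2 := by simpa [D_one] using D_succ one_ne_zero
      rw [D_one, this]
      exact .trans .one_two (.succ .one_two)
    | @succ a b hab ih =>
      rw [D_succ (ne_zero_of_mem_kleeneO ⟨_, .inr hab⟩)]
      exact .trans (.succ ih) (.succ (.succ ih))
    | @limit e g hg _ n ih =>
      rw [D_limit]
      exact .limit (fun n => D (g n)) (D_fund hg) ih n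
    | trans _ _ h1 h2 => exact h1.trans h2
  have hmem {a : ℕ} : a ∈ KleeneO → D a ∈ KleeneO := by
    rintro ⟨b, h | h⟩
    · exact ⟨_, .inl (hlt h)⟩
    · exact ⟨_, .inr (hlt h)⟩
  refine ⟨D, (show Partrec j.eval from Partrec.nat_iff.2 (Code.exists_code.2 ⟨j, rfl⟩)).of_eq_tot
    fun n => by simp [hD], fun a ha => ⟨hmem ha, ?_⟩⟩
  refine kleeneO_induction ha ?_ (fun d hd ih => ?_) fun e g h ih => ?_
  · rw [D_one, ordO_one, mul_zero]
  · rw [D_succ (ne_zero_of_mem_kleeneO hd), ordO_two_pow (two_pow_mem_kleeneO.2 (.inl (hmem hd))),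
      ordO_two_pow (hmem hd), ordO_two_pow hd, ih, mul_add, mul_one, add_assoc, one_add_one_eq_two]
  · have h' : IsFundamental _ fun n => D (g n) := ⟨D_fund h.mem, fun n => hlt (h.lt n)⟩
    rw [D_limit]
    -- Continuity of `2 * ·` at limits: both sides are the supremum of `2 * ordO (g n)`.
    refine eq_of_forall_lt_iff fun o => ?_
    rw [h'.lt_ordO_iff, lt_mul_iff_of_isSuccLimit h.isSuccLimit]
    constructor
    · rintro ⟨n, hn⟩
      exact ⟨_, ordO_lt (h.kleeneLT n), by rwa [← ih]⟩
    · rintro ⟨β, hβ, ho⟩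
      obtain ⟨n, hn⟩ := h.lt_ordO_iff.1 hβ
      exact ⟨n, by rw [ih]; exact ho.trans_le (by gcongr)⟩

end KW

/-! ### Complete sets along the notations -/

namespace KW

open Nat.Partrec (Code)
open Ordinal

theorem mem_HSet_limit {e : ℕ} {g : ℕ → ℕ} (h : IsFundamental e g) (z n : ℕ) :
    Nat.pair z n ∈ HSet (3 * 5 ^ e) ↔ z ∈ HSet (g n) := by
  rw [HSet_limit ⟨_, .inr (h.kleeneLT 0)⟩, Set.mem_ofPred_eq]
  constructor
  · rintro ⟨x, n', m, hz, hm, hx⟩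
    obtain ⟨rfl, rfl⟩ := Nat.pair_eq_pair.1 hz
    rwa [← Part.mem_unique hm (h.mem n)]
  · exact fun hz => ⟨z, n, g n, rfl, h.mem n, hz⟩

theorem sigmaComplete_of_isFinite {d : ℕ} (hd : d ∈ KleeneO) (h : isFinite d = true) :
    sigmaComplete d = HSet d := by
  rw [sigmaComplete, if_pos ((isFinite_iff hd).1 h)]

theorem sigmaComplete_of_not_isFinite {d : ℕ} (hd : d ∈ KleeneO) (h : ¬ isFinite d = true) :
    sigmaComplete d = HSet (2 ^ d) := by
  rw [sigmaComplete, if_neg (mt (isFinite_iff hd).2 h)]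

theorem isFinite_two_pow {d : ℕ} (hd : d ∈ KleeneO) : isFinite (2 ^ d) = isFinite d :=
  notationRec_two_pow _ _ _ (ne_zero_of_mem_kleeneO hd)

theorem isOdd_two_pow {d : ℕ} (hd : d ∈ KleeneO) : isOdd (2 ^ d) = !isOdd d :=
  notationRec_two_pow _ _ _ (ne_zero_of_mem_kleeneO hd)

/-- The shift of index happens at limits only, because `d` and `2 ^ d` are both finite or both
infinite. -/
theorem sigmaComplete_two_pow {d : ℕ} (hd : d ∈ KleeneO) :
    sigmaComplete (2 ^ d) = turingJump (sigmaComplete d) := by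
  have hd' : 2 ^ d ∈ KleeneO := two_pow_mem_kleeneO.2 (.inl hd)
  by_cases h : isFinite d = true
  · rw [sigmaComplete_of_isFinite hd h, sigmaComplete_of_isFinite hd' (by rwa [isFinite_two_pow hd]),
      HSet_succ hd]
  · rw [sigmaComplete_of_not_isFinite hd h,
      sigmaComplete_of_not_isFinite hd' (by rwa [isFinite_two_pow hd]), HSet_succ hd']

/-- A limit notation is infinite, so the shifted definition applies. One unbounded search over the
columns `H_{g n}` is thus available at a limit. -/
theorem sigmaComplete_limit {e : ℕ} {g : ℕ → ℕ} (h : IsFundamental e g) :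
    sigmaComplete (3 * 5 ^ e) = turingJump (HSet (3 * 5 ^ e)) := by
  have hc : 3 * 5 ^ e ∈ KleeneO := ⟨_, .inr (h.kleeneLT 0)⟩
  rw [sigmaComplete_of_not_isFinite hc, HSet_succ hc]
  simp [isFinite, notationRec_limit]

/-! ### Iterated `∃∀` operators and the tests for them -/

/-- The elements that are obtained after `γ` iterations, starting from `base`, of the operator
`Y ↦ {x | ∃ u, ∀ v, next x u v ∈ Y}`. -/
inductive Derivable {X : Type*} (base : X → Prop) (next : X → ℕ → ℕ → X) : Ordinal.{0} → X → Prop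
  | base {γ : Ordinal.{0}} {x : X} : base x → Derivable base next γ x
  | step {γ β : Ordinal.{0}} {x : X} (u : ℕ) : β < γ →
      (∀ v, Derivable base next β (next x u v)) → Derivable base next γ x

section Derivable

variable {X : Type*} {base : X → Prop} {next : X → ℕ → ℕ → X}

theorem Derivable.mono {γ δ : Ordinal.{0}} {x : X} (h : Derivable base next γ x) (hγ : γ ≤ δ) :
    Derivable base next δ x := by
  cases h with
  | base h => exact .base h
  | step u hβ h => exact .step u (hβ.trans_le hγ) h

theorem derivable_zero_iff {x : X} : Derivable base next 0 x ↔ base x := by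
  constructor
  · rintro (h | ⟨u, hβ, h⟩)
    · exact h
    · exact absurd hβ not_lt_bot
  · exact .base

/-- Base elements must themselves be reproduced by the operator; then a successor stage is exactly
one more `∃ u, ∀ v`, with no separate base case. -/
theorem derivable_add_one_iff (hbase : ∀ x, base x → ∃ u, ∀ v, base (next x u v))
    {γ : Ordinal.{0}} {x : X} :
    Derivable base next (γ + 1) x ↔ ∃ u, ∀ v, Derivable base next γ (next x u v) := by
  constructor
  · rintro (h | ⟨u, hβ, h⟩)
    · obtain ⟨u, hu⟩ := hbase x h
      exact ⟨u, fun v => .base (hu v)⟩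
    · exact ⟨u, fun v => (h v).mono (Order.lt_add_one_iff.1 hβ)⟩
  · rintro ⟨u, h⟩
    exact .step u (Order.lt_add_one_iff.2 le_rfl) h

end Derivable

section Reduction

variable {X : Type*} [Primcodable X] (base : X → Prop) (next : X → ℕ → ℕ → X) (init : ℕ → ℕ → X)

/-- The number of the program that searches for `v` such that the test `φ_j(⟨y, v⟩)` is passed. -/
noncomputable def ask (j : Code) (y : ℕ × ℕ × X × ℕ) : ℕ :=
  query (Encodable.encode j) (Encodable.encode y)

open Classical in
/-- A test for `Derivable base next (ordO c / 2) x`, to be applied to `sigmaComplete c`. -/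
noncomputable def derivableTest (j : Code) (c : ℕ) (x : X) : ℕ × ℕ :=
  notationCases c (if base x then 0 else 3, 0)
    (fun d => (2, if isOdd d = true then ask j (1, Nat.log 2 d, x, 0) else ask j (0, d, x, 0)))
    (fun _ => (2, ask j (3, c, x, 0))) (3, 0)

/-- Tests, to be applied to `HSet c`, at least one of which is passed if
`Derivable base next γ x` for some `γ` with `2 * γ < ordO c`. -/
noncomputable def limitTest (j : Code) (c : ℕ) (x : X) (v : ℕ) : Part (ℕ × ℕ) :=
  notationCases c (Part.some (3, 0))
    (fun d => Part.some
      (if isFinite d = true then (2, ask j (0, d, x, 0)) else derivableTest base j d x))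
    (fun e => if v = 0 then Part.some (3, 0) else
      (phi e v.pred.unpair.1).bind fun k =>
        (j.eval (Nat.pair (Encodable.encode ((3, k, x, 0) : ℕ × ℕ × X × ℕ)) v.pred.unpair.2)).map
          fun r => (r.unpair.1, Nat.pair r.unpair.2 v.pred.unpair.1))
    (Part.some (3, 0))

/-- The tests computed by the program `j`. -/
noncomputable def testStep (j : Code) (p : (ℕ × ℕ × X × ℕ) × ℕ) : Part (ℕ × ℕ) :=
  if p.1.1 = 0 then Part.some (derivableTest base j p.1.2.1 p.1.2.2.1) else
  if p.1.1 = 1 then Part.some (1, ask j (2, p.1.2.1, p.1.2.2.1, p.2)) else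
  if p.1.1 = 2 then
    Part.some (negTest (derivableTest base j p.1.2.1 (next p.1.2.2.1 p.1.2.2.2 p.2))) else
  if p.1.1 = 3 then limitTest base j p.1.2.1 p.1.2.2.1 p.2 else
    Part.some (negTest (derivableTest base j p.1.2.1 (init p.1.2.2.2 p.2)))

theorem primrec_ask : Primrec₂ (ask (X := X)) :=
  primrec_query.comp (Primrec.encode.comp .fst) (Primrec.encode.comp .snd)

variable {base next init}

theorem primrec_ask_comp {α : Type*} [Primcodable α]
    {j : α → Code} {m d : α → ℕ} {x : α → X} {u : α → ℕ} (hj : Primrec j) (hm : Primrec m)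
    (hd : Primrec d) (hx : Primrec x) (hu : Primrec u) :
    Primrec fun a => ask (j a) (m a, d a, x a, u a) :=
  Primrec₂.comp (f := KW.ask) primrec_ask hj (hm.pair (hd.pair (hx.pair hu)))

theorem computable_derivableTest (hbase : ComputablePred base) :
    Computable fun p : Code × ℕ × X => derivableTest base p.1 p.2.1 p.2.2 := by
  classical
  have hask {f : (Code × ℕ × X) × ℕ → ℕ} {d : (Code × ℕ × X) × ℕ → ℕ} (hf : Primrec f)
      (hd : Primrec d) :
      Computable fun p : (Code × ℕ × X) × ℕ => ask p.1.1 (f p, d p, p.1.2.2, 0) :=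
    (primrec_ask_comp (Primrec.fst.comp .fst) hf hd (Primrec.snd.comp (Primrec.snd.comp .fst))
      (.const 0)).to_comp
  refine computable_notationCases (c := fun p : Code × ℕ × X => p.2.1) (Primrec.fst.comp .snd)
    ?_ ?_ ?_ (.const _)
  · refine Computable.pair (computable_ite ?_ (.const 0) (.const 3)) (.const 0)
    obtain ⟨_, h⟩ := hbase
    exact ⟨fun _ => Classical.dec _, (h.comp (Computable.snd.comp .snd)).of_eq fun _ => by congr⟩
  · have hodd : ComputablePred fun p : (Code × ℕ × X) × ℕ => isOdd p.2 = true :=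
      ⟨inferInstance, by simpa using computable_isOdd.comp .snd⟩
    exact (Computable.pair (.const 2) (computable_ite hodd (hask (.const 1)
      ((primrec_log 2 (by norm_num)).comp .snd)) (hask (.const 0) .snd))).to₂
  · exact (Computable.pair (.const 2)
      (hask (.const 3) (Primrec.fst.comp (Primrec.snd.comp .fst)))).to₂

theorem computable_derivableTest_comp {α : Type*} [Primcodable α] (hbase : ComputablePred base)
    {j : α → Code} {c : α → ℕ} {x : α → X} (hj : Computable j) (hc : Computable c)
    (hx : Computable x) : Computable fun a => derivableTest base (j a) (c a) (x a) :=
  Computable.comp (f := fun p : Code × ℕ × X => KW.derivableTest base p.1 p.2.1 p.2.2)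
    (g := fun a => (j a, c a, x a)) (computable_derivableTest hbase) (hj.pair (hc.pair hx))

theorem partrec_limitTest (hbase : ComputablePred base) :
    Partrec fun p : Code × ℕ × X × ℕ => limitTest base p.1 p.2.1 p.2.2.1 p.2.2.2 := by
  have hx : Primrec fun q : (Code × ℕ × X × ℕ) × ℕ => q.1.2.2.1 :=
    Primrec.fst.comp (Primrec.snd.comp (Primrec.snd.comp .fst))
  refine partrec_notationCases (c := fun p : Code × ℕ × X × ℕ => p.2.1) (Primrec.fst.comp .snd)
    (Computable.const (3, 0)).partrec ?_ ?_ (Computable.const (3, 0)).partrec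
  · have hfin : ComputablePred fun p : (Code × ℕ × X × ℕ) × ℕ => isFinite p.2 = true :=
      ⟨inferInstance, by simpa using computable_isFinite.comp .snd⟩
    refine Computable.partrec (computable_ite hfin (Computable.pair (.const 2) ?_) ?_)
    · exact (primrec_ask_comp (Primrec.fst.comp .fst) (.const 0) .snd hx (.const 0)).to_comp
    · exact computable_derivableTest_comp hbase (Computable.fst.comp .fst) .snd hx.to_comp
  · have hv : Primrec fun q : (Code × ℕ × X × ℕ) × ℕ => q.1.2.2.2 :=
      Primrec.snd.comp (Primrec.snd.comp (Primrec.snd.comp .fst))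
    have hv1 : Primrec fun q : (Code × ℕ × X × ℕ) × ℕ => q.1.2.2.2.pred.unpair.1 :=
      Primrec.fst.comp (Primrec.unpair.comp (Primrec.pred.comp hv))
    have hv2 : Primrec fun q : (Code × ℕ × X × ℕ) × ℕ => q.1.2.2.2.pred.unpair.2 :=
      Primrec.snd.comp (Primrec.unpair.comp (Primrec.pred.comp hv))
    refine partrec_ite (Primrec.eq.comp hv (.const 0)).computablePred
      (Computable.const (3, 0)).partrec (Partrec.bind ?_ (Partrec.map ?_ ?_))
    · exact Code.eval_part.comp ((Computable.ofNat Code).comp .snd) hv1.to_comp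
    · refine Code.eval_part.comp (Computable.fst.comp (Computable.fst.comp .fst))
        (Primrec₂.natPair.comp (Primrec.encode.comp ?_) (hv2.comp .fst)).to_comp
      exact (Primrec.const 3).pair (Primrec.snd.pair ((hx.comp .fst).pair (.const 0)))
    · exact ((Primrec.fst.comp (Primrec.unpair.comp .snd)).pair (Primrec₂.natPair.comp
        (Primrec.snd.comp (Primrec.unpair.comp .snd))
        (hv1.comp (Primrec.fst.comp .fst)))).to_comp

theorem partrec_testStep (hbase : ComputablePred base)
    (hnext : Computable fun p : X × ℕ × ℕ => next p.1 p.2.1 p.2.2) (hinit : Computable₂ init) :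
    Partrec₂ (testStep base next init) := by
  have hm : Primrec fun p : Code × (ℕ × ℕ × X × ℕ) × ℕ => p.2.1.1 :=
    Primrec.fst.comp (Primrec.fst.comp .snd)
  have hd : Primrec fun p : Code × (ℕ × ℕ × X × ℕ) × ℕ => p.2.1.2.1 :=
    Primrec.fst.comp (Primrec.snd.comp (Primrec.fst.comp .snd))
  have hx : Primrec fun p : Code × (ℕ × ℕ × X × ℕ) × ℕ => p.2.1.2.2.1 :=
    Primrec.fst.comp (Primrec.snd.comp (Primrec.snd.comp (Primrec.fst.comp .snd)))
  have hu : Primrec fun p : Code × (ℕ × ℕ × X × ℕ) × ℕ => p.2.1.2.2.2 :=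
    Primrec.snd.comp (Primrec.snd.comp (Primrec.snd.comp (Primrec.fst.comp .snd)))
  have hv : Primrec fun p : Code × (ℕ × ℕ × X × ℕ) × ℕ => p.2.2 := Primrec.snd.comp .snd
  have hk (k : ℕ) : ComputablePred fun p : Code × (ℕ × ℕ × X × ℕ) × ℕ => p.2.1.1 = k :=
    (Primrec.eq.comp hm (.const k)).computablePred
  have hτ {f : Code × (ℕ × ℕ × X × ℕ) × ℕ → X} (hf : Computable f) :
      Computable fun p : Code × (ℕ × ℕ × X × ℕ) × ℕ => derivableTest base p.1 p.2.1.2.1 (f p) :=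
    computable_derivableTest_comp hbase .fst hd.to_comp hf
  refine partrec_ite (hk 0) (hτ hx.to_comp).partrec (partrec_ite (hk 1) ?_ (partrec_ite (hk 2)
    (primrec_negTest.to_comp.comp (hτ ?_)).partrec (partrec_ite (hk 3) ?_
      (primrec_negTest.to_comp.comp (hτ ?_)).partrec)))
  · exact ((Primrec.const 1).pair (primrec_ask_comp .fst (.const 2) hd hx hv)).to_comp.partrec
  · exact Computable.comp (f := fun p : X × ℕ × ℕ => next p.1 p.2.1 p.2.2)
      (g := fun p : Code × (ℕ × ℕ × X × ℕ) × ℕ => (p.2.1.2.2.1, p.2.1.2.2.2, p.2.2))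
      hnext (hx.pair (hu.pair hv)).to_comp
  · exact Partrec.comp
      (f := fun p : Code × ℕ × X × ℕ => limitTest base p.1 p.2.1 p.2.2.1 p.2.2.2)
      (g := fun p : Code × (ℕ × ℕ × X × ℕ) × ℕ => (p.1, p.2.1.2.1, p.2.1.2.2.1, p.2.2))
      (partrec_limitTest hbase) (Computable.fst.pair (hd.pair (hx.pair hv)).to_comp)
  · exact hinit.comp hu.to_comp hv.to_comp

/-- A program that computes `testStep` of itself. -/
theorem exists_testProgram (hbase : ComputablePred base)
    (hnext : Computable fun p : X × ℕ × ℕ => next p.1 p.2.1 p.2.2) (hinit : Computable₂ init) :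
    ∃ j : Code, ∀ (y : ℕ × ℕ × X × ℕ) (v : ℕ), j.eval (Nat.pair (Encodable.encode y) v) =
      (testStep base next init j (y, v)).map fun r => Nat.pair r.1 r.2 := by
  -- The recursion theorem again: `testStep` mentions only the number of `j`, except in `limitTest`,
  -- which runs `j`.
  have hF : Partrec₂ fun (j : Code) (n : ℕ) =>
      (((Encodable.decode n : Option ((ℕ × ℕ × X × ℕ) × ℕ)) : Part _).bind fun p =>
        (testStep base next init j p).map fun r => Nat.pair r.1 r.2) := by
    refine Partrec.bind (Computable.ofOption (Computable.decode.comp .snd)) (Partrec.map ?_ ?_)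
    · exact (partrec_testStep hbase hnext hinit).comp (Computable.fst.comp .fst) .snd
    · exact (Primrec₂.natPair.comp (Primrec.fst.comp .snd) (Primrec.snd.comp .snd)).to_comp
  obtain ⟨j, hj⟩ := Code.fixed_point₂ hF
  refine ⟨j, fun y v => ?_⟩
  have : Nat.pair (Encodable.encode y) v = Encodable.encode (y, v) := by simp
  rw [hj, this]
  simp only [Encodable.encodek]
  simp

end Reduction
end KW

/-! ### Correctness of the tests and the uniform reduction -/

namespace KW

open Nat.Partrec (Code)
open Ordinal

section Reduction

variable {X : Type*} [Primcodable X] {base : X → Prop} {next : X → ℕ → ℕ → X} {init : ℕ → ℕ → X}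

/-- The program `j` computes `testStep` of itself. -/
def IsTestProgram (base : X → Prop) (next : X → ℕ → ℕ → X) (init : ℕ → ℕ → X) (j : Code) : Prop :=
  ∀ (y : ℕ × ℕ × X × ℕ) (v : ℕ), j.eval (Nat.pair (Encodable.encode y) v) =
    (testStep base next init j (y, v)).map fun r => Nat.pair r.1 r.2

namespace IsTestProgram

variable {j : Code}

theorem ask_mem (hj : IsTestProgram base next init j) {Y : Set ℕ} {y : ℕ × ℕ × X × ℕ}
    {G : ℕ → ℕ × ℕ} (hG : ∀ v, testStep base next init j (y, v) = Part.some (G v)) :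
    ask j y ∈ turingJump Y ↔ ∃ v, Passes Y (G v) := by
  refine query_mem_turingJump fun v => ?_
  rw [phi, Denumerable.ofNat_encode, hj, hG]
  simp

/-- A search through copies of one test: it carries a question about `Y` over to the jump of `Y`. -/
theorem ask_zero_mem (hj : IsTestProgram base next init j) {Y : Set ℕ} (d : ℕ) (x : X) (u : ℕ) :
    ask j (0, d, x, u) ∈ turingJump Y ↔ Passes Y (derivableTest base j d x) := by
  rw [hj.ask_mem fun v => rfl]
  simp

theorem ask_two_mem (hj : IsTestProgram base next init j) {Y : Set ℕ} (d : ℕ) (x : X) (u : ℕ) :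
    ask j (2, d, x, u) ∈ turingJump Y ↔ ∃ v, ¬ Passes Y (derivableTest base j d (next x u v)) := by
  rw [hj.ask_mem fun v => rfl]
  simp [passes_negTest]

/-- The outer `∃` of the operator. The inner `∀` is the negation of the search in `ask_two_mem`, so
two jumps evaluate one `∃∀`. -/
theorem ask_one_mem (hj : IsTestProgram base next init j) {Y : Set ℕ} (d : ℕ) (x : X) (u : ℕ) :
    ask j (1, d, x, u) ∈ turingJump Y ↔ ∃ v, ask j (2, d, x, v) ∉ Y := by
  rw [hj.ask_mem fun v => rfl]
  simp [Passes]

theorem ask_four_mem (hj : IsTestProgram base next init j) {Y : Set ℕ} (d : ℕ) (x : X) (u : ℕ) :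
    ask j (4, d, x, u) ∈ turingJump Y ↔ ∃ v, ¬ Passes Y (derivableTest base j d (init u v)) := by
  rw [hj.ask_mem fun v => rfl]
  simp [passes_negTest]

theorem ask_three_mem (hj : IsTestProgram base next init j) {Y : Set ℕ} {d : ℕ} {x : X}
    {G : ℕ → ℕ × ℕ} (hG : ∀ v, limitTest base j d x v = Part.some (G v)) (u : ℕ) :
    ask j (3, d, x, u) ∈ turingJump Y ↔ ∃ v, Passes Y (G v) :=
  hj.ask_mem hG

theorem eval_three (hj : IsTestProgram base next init j) {d : ℕ} {x : X} {u v : ℕ} {r : ℕ × ℕ}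
    (h : limitTest base j d x v = Part.some r) :
    j.eval (Nat.pair (Encodable.encode ((3, d, x, u) : ℕ × ℕ × X × ℕ)) v) =
      Part.some (Nat.pair r.1 r.2) := by
  have : testStep base next init j ((3, d, x, u), v) = limitTest base j d x v := rfl
  rw [hj, this, h]
  simp

end IsTestProgram

/-- The tests at the notation `c` are correct. -/
structure TestsCorrect (base : X → Prop) (next : X → ℕ → ℕ → X) (j : Code) (c : ℕ) : Prop where
  passes_iff : ∀ x, Passes (sigmaComplete c) (derivableTest base j c x) ↔
    Derivable base next (ordO c / 2) x
  limit : ∃ G : X → ℕ → ℕ × ℕ, (∀ x v, limitTest base j c x v = Part.some (G x v)) ∧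
    (∀ x v, Passes (HSet c) (G x v) → Derivable base next (ordO c / 2) x) ∧
    ∀ x γ, Derivable base next γ x → 2 * γ < ordO c → ∃ v, Passes (HSet c) (G x v)

theorem testsCorrect_one (j : Code) : TestsCorrect base next j 1 where
  passes_iff x := by
    rw [ordO_one, Ordinal.zero_div, derivable_zero_iff, derivableTest, notationCases_one]
    by_cases h : base x <;> simp [Passes, h]
  limit := ⟨fun _ _ => (3, 0), fun _ _ => notationCases_one _ _ _ _, by simp [Passes],
    fun x γ _ h => by simp [ordO_one] at h⟩

/-- From `2 * γ < ordO d + 1` follows `γ ≤ ordO d / 2`, so the one test for `d` suffices. -/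
theorem IsTestProgram.testsCorrect_two_pow_limit {j : Code} (hj : IsTestProgram base next init j)
    {d : ℕ} (hd : d ∈ KleeneO) (h : TestsCorrect base next j d) :
    ∃ G : X → ℕ → ℕ × ℕ, (∀ x v, limitTest base j (2 ^ d) x v = Part.some (G x v)) ∧
    (∀ x v, Passes (HSet (2 ^ d)) (G x v) → Derivable base next (ordO (2 ^ d) / 2) x) ∧
    ∀ x γ, Derivable base next γ x → 2 * γ < ordO (2 ^ d) →
      ∃ v, Passes (HSet (2 ^ d)) (G x v) := by
  -- The test for `d` is about `sigmaComplete d`. For infinite `d` this already is `HSet (2 ^ d)`;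
  -- for finite `d` it is `HSet d`, one jump lower.
  have key (x : X) : Passes (HSet (2 ^ d)) (if isFinite d = true then (2, ask j (0, d, x, 0))
      else derivableTest base j d x) ↔ Derivable base next (ordO d / 2) x := by
    rw [← h.passes_iff]
    split_ifs with hfin
    · rw [HSet_succ hd, sigmaComplete_of_isFinite hd hfin, ← hj.ask_zero_mem d x 0]
      simp [Passes]
    · rw [sigmaComplete_of_not_isFinite hd hfin]
  refine ⟨_, fun x v => notationCases_two_pow _ _ _ _ (ne_zero_of_mem_kleeneO hd),
    fun x v hp => ((key x).1 hp).mono (div_le_left ?_ _), fun x γ hx hγ => ⟨0, (key x).2 (hx.mono ?_)⟩⟩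
  · exact (ordO_lt (kleeneLT_two_pow hd)).le
  · rw [ordO_two_pow hd, Order.lt_add_one_iff] at hγ
    rwa [← Ordinal.mul_le_iff_le_div two_ne_zero]

theorem IsTestProgram.testsCorrect_two_pow_even {j : Code} (hj : IsTestProgram base next init j)
    {d : ℕ} (hd : d ∈ KleeneO) (hodd : isOdd d = false) (h : TestsCorrect base next j d) :
    TestsCorrect base next j (2 ^ d) where
  passes_iff x := by
    rw [ordO_two_pow_div hd hodd, ← h.passes_iff, sigmaComplete_two_pow hd, ← hj.ask_zero_mem d x 0,
      derivableTest, notationCases_two_pow _ _ _ _ (ne_zero_of_mem_kleeneO hd)]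
    simp [Passes, hodd]
  limit := hj.testsCorrect_two_pow_limit hd h

/-- From one even level to the next the stage grows by one, and the two jumps in between evaluate
the additional `∃ u, ∀ v`. -/
theorem IsTestProgram.testsCorrect_two_pow_two_pow {j : Code}
    (hj : IsTestProgram base next init j)
    (hbase : ∀ x, base x → ∃ u, ∀ v, base (next x u v)) {d : ℕ} (hd : d ∈ KleeneO)
    (hodd : isOdd d = false) (h : TestsCorrect base next j d) :
    TestsCorrect base next j (2 ^ 2 ^ d) where
  passes_iff x := by
    have hd' : 2 ^ d ∈ KleeneO := two_pow_mem_kleeneO.2 (.inl hd)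
    have : Passes (sigmaComplete (2 ^ 2 ^ d)) (derivableTest base j (2 ^ 2 ^ d) x) ↔
        ask j (1, d, x, 0) ∈ turingJump (turingJump (sigmaComplete d)) := by
      rw [sigmaComplete_two_pow hd', sigmaComplete_two_pow hd, derivableTest,
        notationCases_two_pow _ _ _ _ (ne_zero_of_mem_kleeneO hd')]
      simp [Passes, isOdd_two_pow hd, hodd]
    rw [this, ordO_two_pow_two_pow_div hd, derivable_add_one_iff hbase, hj.ask_one_mem]
    simp only [hj.ask_two_mem, h.passes_iff, not_exists, not_not]
  limit := hj.testsCorrect_two_pow_limit (two_pow_mem_kleeneO.2 (.inl hd))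
    (hj.testsCorrect_two_pow_even hd hodd h)

/-- The search runs over all members `g n` of the fundamental sequence and all their tests. It needs
tests about `H_{g n}`, since only these sets are columns of the limit set; hence the field `limit`
of `TestsCorrect`. -/
theorem IsTestProgram.testsCorrect_limit {j : Code} (hj : IsTestProgram base next init j)
    {e : ℕ} {g : ℕ → ℕ} (hg : IsFundamental e g) (h : ∀ n, TestsCorrect base next j (g n)) :
    TestsCorrect base next j (3 * 5 ^ e) := by
  choose G hG hG1 hG2 using fun n => (h n).limit
  -- `v = 0` is a test that always fails; `v = ⟨n, w⟩ + 1` is the `w`-th test for `g n`, moved to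
  -- column `n`.
  let G' : X → ℕ → ℕ × ℕ := fun x v => if v = 0 then (3, 0) else
    ((G v.pred.unpair.1 x v.pred.unpair.2).1,
      Nat.pair (G v.pred.unpair.1 x v.pred.unpair.2).2 v.pred.unpair.1)
  have h1 (x v) : limitTest base j (3 * 5 ^ e) x v = Part.some (G' x v) := by
    rw [limitTest, notationCases_limit]
    by_cases hv : v = 0
    · simp [G', hv]
    · have hphi (n : ℕ) : phi e n = Part.some (g n) := Part.eq_some_iff.2 (hg.mem n)
      simp only [G', hv, if_false, hphi, Part.bind_some, hj.eval_three (hG _ _ _), Part.map_some,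
        Nat.unpair_pair]
  have hpass (n : ℕ) (r : ℕ × ℕ) :
      Passes (HSet (3 * 5 ^ e)) (r.1, Nat.pair r.2 n) ↔ Passes (HSet (g n)) r := by
    simp only [Passes, mem_HSet_limit hg]
  have h2 (x v) (hp : Passes (HSet (3 * 5 ^ e)) (G' x v)) :
      Derivable base next (ordO (3 * 5 ^ e) / 2) x := by
    by_cases hv : v = 0
    · simp [G', hv, Passes] at hp
    · simp only [G', hv, if_false, hpass] at hp
      exact (hG1 _ _ _ hp).mono (div_le_left (ordO_lt (hg.kleeneLT _)).le _)
  have h3 (x γ) (hx : Derivable base next γ x) (hγ : 2 * γ < ordO (3 * 5 ^ e)) :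
      ∃ v, Passes (HSet (3 * 5 ^ e)) (G' x v) := by
    obtain ⟨n, hn⟩ := hg.lt_ordO_iff.1 hγ
    obtain ⟨w, hw⟩ := hG2 n x γ hx hn
    refine ⟨Nat.pair n w + 1, ?_⟩
    simp only [G', Nat.add_eq_zero_iff, one_ne_zero, and_false, if_false, hpass]
    simpa using hw
  refine ⟨fun x => ?_, G', h1, h2, h3⟩
  have : Passes (sigmaComplete (3 * 5 ^ e)) (derivableTest base j (3 * 5 ^ e) x) ↔
      ∃ v, Passes (HSet (3 * 5 ^ e)) (G' x v) := by
    rw [← hj.ask_three_mem (h1 x) 0, sigmaComplete_limit hg, derivableTest, notationCases_limit]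
    simp [Passes]
  rw [this]
  refine ⟨fun ⟨v, hv⟩ => h2 x v hv, fun hx => ?_⟩
  have hle := mul_div_le (ordO (3 * 5 ^ e)) 2
  -- A derivation at stage `l / 2`, for the limit ordinal `l`, already lives at stage `0` or at some
  -- `β + 1` with `β < l / 2`, and `2 * (β + 1) < l` because `l` is a limit.
  rcases hx with hx | ⟨u, hβ, hx⟩
  · exact h3 x 0 (.base hx) (by
      rw [mul_zero]
      exact bot_le.trans_lt (ordO_lt (hg.kleeneLT 0)))
  · rename_i β
    refine h3 x (β + 1) (.step u (Order.lt_add_one_iff.2 le_rfl) hx) ?_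
    have hlt : 2 * β < ordO (3 * 5 ^ e) :=
      lt_of_lt_of_le (by gcongr) hle
    rw [mul_add, mul_one, ← one_add_one_eq_two, ← add_assoc, one_add_one_eq_two]
    exact hg.add_one_lt (hg.add_one_lt hlt)

theorem IsTestProgram.testsCorrect {j : Code} (hj : IsTestProgram base next init j)
    (hbase : ∀ x, base x → ∃ u, ∀ v, base (next x u v)) {c : ℕ} (hc : c ∈ KleeneO) :
    TestsCorrect base next j c := by
  induction c using kleeneLT_wf.induction with
  | _ c ih =>
    rcases kleeneO_cases hc with rfl | ⟨d, hd, -, rfl⟩ | ⟨e, g, rfl, h⟩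
    · exact testsCorrect_one j
    · have hlt := kleeneLT_two_pow hd
      cases hodd : isOdd d with
      | false => exact hj.testsCorrect_two_pow_even hd hodd (ih d hlt hd)
      | true =>
        -- An odd notation is the successor of an even one, so the induction steps back by two.
        rcases kleeneO_cases hd with rfl | ⟨d, hd', -, rfl⟩ | ⟨e, g, rfl, h⟩
        · simp [isOdd, notationRec_one] at hodd
        · rw [isOdd_two_pow hd', Bool.not_eq_true'] at hodd
          exact hj.testsCorrect_two_pow_two_pow hbase hd' hodd
            (ih d ((kleeneLT_two_pow hd').trans hlt) hd')
        · simp [isOdd, notationRec_limit] at hodd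
    · exact hj.testsCorrect_limit h fun n => ih _ (h.kleeneLT n) (h.mem_kleeneO n)

/-- Uniformly in a notation `d` of `2 * α`, the relation
`∃ m, ¬ Derivable base next α (init e m)` is one-one reducible to the jump of
`sigmaComplete d`. -/
theorem exists_reduction (hbase : ComputablePred base)
    (hnext : Computable fun p : X × ℕ × ℕ => next p.1 p.2.1 p.2.2) (hinit : Computable₂ init)
    (hbase' : ∀ x, base x → ∃ u, ∀ v, base (next x u v)) :
    ∃ r : ℕ → ℕ → ℕ, Computable₂ r ∧ ∀ d ∈ KleeneO, Function.Injective (r d) ∧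
      ∀ e, r d e ∈ turingJump (sigmaComplete d) ↔
        ∃ m, ¬ Derivable base next (ordO d / 2) (init e m) := by
  obtain ⟨j, hj⟩ := exists_testProgram hbase hnext hinit
  refine ⟨fun d e => ask j (4, d, init 0 0, e), (primrec_ask_comp (.const j) (.const 4) .fst
    (.const _) .snd).to_comp, fun d hd => ⟨fun e e' h => ?_, fun e => ?_⟩⟩
  · have h := query_injective _ h
    simpa using h
  · rw [IsTestProgram.ask_four_mem hj]
    simp only [(IsTestProgram.testsCorrect hj hbase' hd).passes_iff]

end Reduction

/-- A family of sets that are uniformly of the form `{e | ∀ m, Derivable base next α (init e m)}`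
is `Π_{2α+1}`, uniformly in `α`. -/
theorem exists_uniform_reduction {X : Type*} [Primcodable X] {base : X → Prop}
    {next : X → ℕ → ℕ → X} {init : ℕ → ℕ → X} (hbase : ComputablePred base)
    (hnext : Computable fun p : X × ℕ × ℕ => next p.1 p.2.1 p.2.2) (hinit : Computable₂ init)
    (hbase' : ∀ x, base x → ∃ u, ∀ v, base (next x u v)) {D : Ordinal.{0} → Set ℕ}
    (hD : ∀ α, 0 < α → ∀ e, e ∈ D α ↔ ∀ m, Derivable base next α (init e m)) :
    ∃ (t : ℕ → ℕ) (g : ℕ → ℕ → ℕ →. ℕ),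
      Computable t ∧ Partrec (fun p : ℕ × ℕ × ℕ => g p.1 p.2.1 p.2.2) ∧
      ∀ α : Ordinal.{0}, 0 < α → ∀ a : ℕ, IsNotation a α →
        IsNotation (t a) (2 * α + 1) ∧
        ∀ b : ℕ, IsNotation b (2 * α + 1) →
          ∃ f : ℕ → ℕ, (∀ e, f e ∈ g a b e) ∧ Function.Injective f ∧
            ∀ e, e ∈ D α ↔ f e ∉ sigmaComplete b := by
  obtain ⟨T, hT, hT'⟩ := exists_computable_double
  obtain ⟨r, hr, hr'⟩ := exists_reduction hbase hnext hinit hbase'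
  -- A notation `b` of the successor `2 * α + 1` has the form `2 ^ d` with `d` a notation of `2 *
  -- α`, so `d` is recovered as the logarithm of `b`.
  refine ⟨fun a => 2 ^ T a, fun _ b e => Part.some (r (Nat.log 2 b) e),
    (primrec_pow.comp (.const 2) .id).to_comp.comp hT, ?_, fun α hα a ha => ⟨?_, fun b hb => ?_⟩⟩
  · exact (hr.comp ((primrec_log 2 (by norm_num)).to_comp.comp (Computable.fst.comp .snd))
      (Computable.snd.comp .snd)).partrec
  · obtain ⟨h1, h2⟩ := hT' a ha.1
    exact ⟨two_pow_mem_kleeneO.2 (.inl h1), by rw [ordO_two_pow h1, h2, ha.2]⟩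
  · obtain ⟨hb, hb'⟩ := hb
    rcases kleeneO_cases hb with rfl | ⟨d, hd, -, rfl⟩ | ⟨e, g, rfl, h⟩
    · rw [ordO_one] at hb'
      exact absurd (Order.lt_add_one_iff.2 (zero_le (a := 2 * α))) (by rw [← hb']; exact lt_irrefl _)
    · have hα2 : ordO d / 2 = α := by
        rw [ordO_two_pow hd] at hb'
        rw [Order.add_one_inj.1 hb', mul_div_cancel _ two_ne_zero]
      refine ⟨r d, fun e => by simp, (hr' d hd).1, fun e => ?_⟩
      rw [sigmaComplete_two_pow hd, (hr' d hd).2, hα2, hD α hα]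
      simp
    · have := h.add_one_lt (o := 2 * α) (by rw [hb']; exact Order.lt_add_one_iff.2 le_rfl)
      rw [hb'] at this
      exact absurd this (lt_irrefl _)

end KW

namespace KW

open Set Filter Topology

/-! ### Analysis of the derivation -/

/-- The ball of radius `δ` about `x` contains two intervals that meet in a point of `P` and on which
the slopes of `f` differ by at least `ε`. -/
def Oscillates (f : ℝ → ℝ) (ε : ℝ) (P : Set ℝ) (x δ : ℝ) : Prop :=
  ∃ p q r s : ℚ, p < q ∧ r < s ∧
    (∀ u ∈ ({p, q, r, s} : Set ℚ), (u : ℝ) ∈ Metric.ball x δ ∩ Set.Icc 0 1) ∧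
    (Set.Icc (p : ℝ) q ∩ Set.Icc (r : ℝ) s ∩ P).Nonempty ∧
    ε ≤ |secant f p q - secant f r s|

variable {f : ℝ → ℝ} {ε : ℝ}

theorem mem_kwDeriv_iff {P : Set ℝ} {x : ℝ} :
    x ∈ kwDeriv f ε P ↔ x ∈ P ∧ ∀ δ : ℝ, 0 < δ → Oscillates f ε P x δ := by
  refine ⟨fun h => ⟨h.1, fun δ hδ => ?_⟩, fun h => ⟨h.1, fun δ hδ => h.2 δ (by exact_mod_cast hδ)⟩⟩
  obtain ⟨d, hd, hd'⟩ := exists_rat_btwn hδ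
  obtain ⟨p, q, r, s, hpq, hrs, hu, h2⟩ := h.2 d (by exact_mod_cast hd)
  exact ⟨p, q, r, s, hpq, hrs, fun u hu' => ⟨Metric.ball_subset_ball hd'.le (hu u hu').1,
    (hu u hu').2⟩, h2⟩

theorem Oscillates.mono {P : Set ℝ} {x y δ δ' : ℝ} (h : Oscillates f ε P x δ)
    (hb : Metric.ball x δ ⊆ Metric.ball y δ') : Oscillates f ε P y δ' := by
  obtain ⟨p, q, r, s, hpq, hrs, hu, h2⟩ := h
  exact ⟨p, q, r, s, hpq, hrs, fun u hu' => ⟨hb (hu u hu').1, (hu u hu').2⟩, h2⟩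

theorem isClosed_kwDeriv {P : Set ℝ} (hP : IsClosed P) : IsClosed (kwDeriv f ε P) := by
  refine isClosed_of_closure_subset fun x hx => mem_kwDeriv_iff.2 ⟨?_, fun δ hδ => ?_⟩
  · exact closure_minimal (fun y hy => hy.1) hP hx
  · obtain ⟨z, hz, hxz⟩ := Metric.mem_closure_iff.1 hx (δ / 2) (by positivity)
    refine ((mem_kwDeriv_iff.1 hz).2 (δ / 2) (by positivity)).mono fun y hy => ?_
    rw [Metric.mem_ball] at hy ⊢
    have := dist_triangle y z x
    rw [dist_comm z x] at this
    linarith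

theorem kwIter_zero : kwIter f ε 0 = Icc 0 1 := Ordinal.limitRecOn_zero ..

theorem kwIter_add_one (γ : Ordinal.{0}) : kwIter f ε (γ + 1) = kwDeriv f ε (kwIter f ε γ) :=
  Ordinal.limitRecOn_add_one ..

theorem kwIter_limit {l : Ordinal.{0}} (hl : Order.IsSuccLimit l) :
    kwIter f ε l = ⋂ β, ⋂ _ : β < l, kwIter f ε β :=
  Ordinal.limitRecOn_limit _ _ _ _ hl

theorem isClosed_kwIter (γ : Ordinal.{0}) : IsClosed (kwIter f ε γ) := by
  induction γ using Ordinal.limitRecOn with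
  | zero => rw [kwIter_zero]; exact isClosed_Icc
  | add_one γ ih => rw [kwIter_add_one]; exact isClosed_kwDeriv ih
  | limit l hl ih => rw [kwIter_limit hl]; exact isClosed_biInter fun β hβ => ih β hβ

theorem kwIter_antitone : Antitone (kwIter f ε) := by
  intro β γ h
  induction γ using Ordinal.limitRecOn with
  | zero => rw [le_bot_iff.1 h]; rfl
  | add_one γ ih =>
    rcases h.eq_or_lt with rfl | h
    · exact le_rfl
    · rw [kwIter_add_one]
      exact fun x hx => ih (Order.lt_add_one_iff.1 h) hx.1
  | limit l hl ih =>
    rcases h.eq_or_lt with rfl | h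
    · exact le_rfl
    · rw [kwIter_limit hl]
      exact biInter_subset_of_mem (t := fun β => kwIter f ε β) h

theorem kwIter_subset_kwDeriv {β γ : Ordinal.{0}} (h : β < γ) :
    kwIter f ε γ ⊆ kwDeriv f ε (kwIter f ε β) := by
  rw [← kwIter_add_one]
  exact kwIter_antitone (Order.add_one_le_of_lt h)

theorem kwRank_lt_add_one_iff {α : Ordinal.{0}} :
    kwRank f < ((α + 1 : Ordinal.{0}) : WithTop Ordinal.{0}) ↔ ∀ ε : ℝ, 0 < ε → kwIter f ε α = ∅ := by
  rw [kwRank, sInf_lt_iff]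
  constructor
  · rintro ⟨_, ⟨β, hβ, rfl⟩, hlt⟩ ε hε
    have : β ≤ α := Order.lt_add_one_iff.1 (WithTop.coe_lt_coe.1 hlt)
    exact subset_eq_empty (kwIter_antitone this) (hβ ε hε)
  · exact fun h => ⟨α, ⟨α, h, rfl⟩, WithTop.coe_lt_coe.2 (Order.lt_add_one_iff.2 le_rfl)⟩

/-- The radius in the definition of the derivative can be chosen uniformly on a compact set. -/
theorem exists_forall_not_oscillates {K P : Set ℝ} (hK : IsCompact K) (hP : IsClosed P)
    (h : K ∩ kwDeriv f ε P = ∅) : ∃ δ : ℚ, 0 < δ ∧ ∀ x ∈ K, ¬ Oscillates f ε P x δ := by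
  have hloc (x : K) : ∃ δ : ℝ, 0 < δ ∧ ¬ Oscillates f ε P x δ := by
    by_cases hx : (x : ℝ) ∈ P
    · by_contra! hno
      exact notMem_empty (x : ℝ) (h ▸ ⟨x.2, mem_kwDeriv_iff.2 ⟨hx, hno⟩⟩)
    -- A ball that misses `P` contains every interval with end points in it, so no such interval can
    -- meet `P`.
    · obtain ⟨δ, hδ, hb⟩ := Metric.isOpen_iff.1 hP.isOpen_compl x hx
      refine ⟨δ, hδ, ?_⟩
      rintro ⟨p, q, r, s, -, -, hu, ⟨z, ⟨hz, -⟩, hzP⟩, -⟩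
      refine hb ?_ hzP
      rw [Real.ball_eq_Ioo] at hu ⊢
      exact ordConnected_Ioo.out (hu p (by simp)).1 (hu q (by simp)).1 hz
  choose δ hδ hδ' using hloc
  obtain ⟨d, hd, hd'⟩ := lebesgue_number_lemma_of_metric (c := fun x : K => Metric.ball (x : ℝ) (δ x))
    hK (fun _ => Metric.isOpen_ball) fun x hx => mem_iUnion.2 ⟨⟨x, hx⟩, Metric.mem_ball_self (hδ _)⟩
  obtain ⟨d', h0, h1⟩ := exists_rat_btwn hd
  refine ⟨d', by exact_mod_cast h0, fun x hx hosc => ?_⟩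
  obtain ⟨i, hi⟩ := hd' x hx
  exact hδ' i (hosc.mono ((Metric.ball_subset_ball h1.le).trans hi))

theorem exists_rat_le {x δ : ℝ} (hx : x ∈ Icc (0 : ℝ) 1) (hδ : 0 < δ) :
    ∃ p : ℚ, (p : ℝ) ∈ Icc (0 : ℝ) 1 ∧ (p : ℝ) ≤ x ∧ x - δ < p := by
  rcases hx.1.eq_or_lt with rfl | h0
  · exact ⟨0, by simp, by simp, by simpa using hδ⟩
  · obtain ⟨p, h1, h2⟩ := exists_rat_btwn (max_lt h0 (sub_lt_self x hδ))
    exact ⟨p, ⟨(le_max_left _ _).trans h1.le, h2.le.trans hx.2⟩, h2.le,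
      (le_max_right _ _).trans_lt h1⟩

theorem exists_rat_ge {x δ : ℝ} (hx : x ∈ Icc (0 : ℝ) 1) (hδ : 0 < δ) :
    ∃ p : ℚ, (p : ℝ) ∈ Icc (0 : ℝ) 1 ∧ x ≤ p ∧ (p : ℝ) < x + δ := by
  obtain ⟨p, h1, h2, h3⟩ := exists_rat_le (x := 1 - x) ⟨by linarith [hx.2], by linarith [hx.1]⟩ hδ
  refine ⟨1 - p, ⟨?_, ?_⟩, ?_, ?_⟩ <;> push_cast <;> linarith [h1.1, h1.2]

theorem secant_comm (f : ℝ → ℝ) (x y : ℝ) : secant f x y = secant f y x := by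
  rw [secant, secant, ← neg_sub (f y), ← neg_sub y, neg_div_neg_eq]

theorem exists_secant_close (hf : ContinuousOn f (Icc 0 1)) {x y : ℝ} (hx : x ∈ Icc (0 : ℝ) 1)
    (hy : y ∈ Icc (0 : ℝ) 1) (hxy : x ≠ y) {η : ℝ} (hη : 0 < η) :
    ∃ δ > 0, ∀ u ∈ Icc (0 : ℝ) 1, ∀ v ∈ Icc (0 : ℝ) 1, |u - x| < δ → |v - y| < δ →
      |secant f u v - secant f x y| < η := by
  have h : ContinuousWithinAt (fun p : ℝ × ℝ => secant f p.1 p.2) (Icc 0 1 ×ˢ Icc 0 1) (x, y) := by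
    have h1 : ContinuousWithinAt (fun p : ℝ × ℝ => f p.1) (Icc 0 1 ×ˢ Icc 0 1) (x, y) :=
      ContinuousWithinAt.comp (t := Icc 0 1) (hf x hx) continuousWithinAt_fst fun p hp => hp.1
    have h2 : ContinuousWithinAt (fun p : ℝ × ℝ => f p.2) (Icc 0 1 ×ˢ Icc 0 1) (x, y) :=
      ContinuousWithinAt.comp (t := Icc 0 1) (hf y hy) continuousWithinAt_snd fun p hp => hp.2
    exact (h1.sub h2).div (continuousWithinAt_fst.sub continuousWithinAt_snd) (sub_ne_zero.2 hxy)
  obtain ⟨δ, hδ, h⟩ := Metric.continuousWithinAt_iff.1 h η hη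
  exact ⟨δ, hδ, fun u hu v hv hux hvy => h (x := (u, v)) ⟨hu, hv⟩ (max_lt hux hvy)⟩

/-- The rational end points are taken outside the segment between `x` and `y`; thus the interval
contains `x`, as is needed for it to meet a set containing `x`. -/
theorem exists_rat_secant_close (hf : ContinuousOn f (Icc 0 1)) {x y δ η : ℝ}
    (hx : x ∈ Icc (0 : ℝ) 1) (hy : y ∈ Icc (0 : ℝ) 1) (hxy : x ≠ y) (hδ : |y - x| < δ)
    (hη : 0 < η) : ∃ p q : ℚ, p < q ∧ (p : ℝ) ∈ Metric.ball x δ ∩ Icc 0 1 ∧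
      (q : ℝ) ∈ Metric.ball x δ ∩ Icc 0 1 ∧ x ∈ Icc (p : ℝ) q ∧
      |secant f p q - secant f x y| < η := by
  obtain ⟨d, hd, h⟩ := exists_secant_close hf hx hy hxy hη
  have hxy' : 0 < |y - x| := abs_pos.2 (sub_ne_zero.2 hxy.symm)
  obtain ⟨ρ, hρ, hρ'⟩ : ∃ ρ > 0, ρ ≤ d ∧ ρ ≤ δ - |y - x| ∧ ρ ≤ |y - x| :=
    ⟨min d (min (δ - |y - x|) |y - x|), by
      simp only [gt_iff_lt, lt_min_iff]
      exact ⟨hd, by linarith, hxy'⟩, by simp⟩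
  obtain ⟨h1, h2, h3⟩ := hρ'
  simp only [Metric.mem_ball, Real.dist_eq, mem_inter_iff]
  rcases lt_or_gt_of_ne hxy with hlt | hlt
  · rw [abs_of_pos (sub_pos.2 hlt)] at *
    obtain ⟨p, hp, hp1, hp2⟩ := exists_rat_le hx hρ
    obtain ⟨q, hq, hq1, hq2⟩ := exists_rat_ge hy hρ
    have hpq : (p : ℝ) < q := hp1.trans_lt (hlt.trans_le hq1)
    refine ⟨p, q, by exact_mod_cast hpq, ⟨?_, hp⟩, ⟨?_, hq⟩, ⟨hp1, by linarith⟩,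
      h p hp q hq ?_ ?_⟩ <;> rw [abs_lt] <;> constructor <;> linarith
  · rw [abs_of_neg (sub_neg.2 hlt)] at *
    obtain ⟨p, hp, hp1, hp2⟩ := exists_rat_le hy hρ
    obtain ⟨q, hq, hq1, hq2⟩ := exists_rat_ge hx hρ
    have hpq : (p : ℝ) < q := hp1.trans_lt (hlt.trans_le hq1)
    refine ⟨p, q, by exact_mod_cast hpq, ⟨?_, hp⟩, ⟨?_, hq⟩, ⟨by linarith, hq1⟩, ?_⟩
    rotate_right
    · rw [secant_comm]
      apply h q hq p hp <;> rw [abs_lt] <;> constructor <;> linarith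
    all_goals rw [abs_lt]; constructor <;> linarith

/-- A point at which `f` is not differentiable is never removed. -/
theorem exists_forall_mem_kwIter (hf : ContinuousOn f (Icc 0 1)) {x : ℝ} (hx : x ∈ Icc (0 : ℝ) 1)
    (hnd : ¬ DifferentiableWithinAt ℝ f (Icc 0 1) x) : ∃ ε > 0, ∀ γ, x ∈ kwIter f ε γ := by
  by_contra! hno
  -- If intervals through `x` itself oscillated at every scale, `x` would survive every derivation,
  -- by transfinite induction.
  have hosc : ∀ ε > 0, ∃ δ > 0, ¬ Oscillates f ε {x} x δ := by
    intro ε hε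
    by_contra! hall
    obtain ⟨γ, hγ⟩ := hno ε hε
    refine hγ ?_
    clear hγ
    induction γ using Ordinal.limitRecOn with
    | zero => rwa [kwIter_zero]
    | add_one γ ih =>
      rw [kwIter_add_one]
      refine mem_kwDeriv_iff.2 ⟨ih, fun δ hδ => ?_⟩
      obtain ⟨p, q, r, s, hpq, hrs, hu, hne, h2⟩ := hall δ hδ
      exact ⟨p, q, r, s, hpq, hrs, hu, hne.mono (inter_subset_inter_right _
        (singleton_subset_iff.2 ih)), h2⟩
    | limit l hl ih => rw [kwIter_limit hl]; exact mem_iInter₂.2 fun β hβ => ih β hβ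
  have hslope : ∀ ε > 0, ∃ δ > 0, ∀ y ∈ Icc (0 : ℝ) 1, ∀ z ∈ Icc (0 : ℝ) 1, y ≠ x → z ≠ x →
      |y - x| < δ → |z - x| < δ → |secant f x y - secant f x z| < ε := by
    intro ε hε
    obtain ⟨δ, hδ, h⟩ := hosc (ε / 2) (by positivity)
    refine ⟨δ, hδ, fun y hy z hz hyx hzx hyδ hzδ => ?_⟩
    obtain ⟨p, q, hpq, hp, hq, hxpq, h1⟩ :=
      exists_rat_secant_close hf hx hy hyx.symm hyδ (η := ε / 4) (by positivity)
    obtain ⟨r, s, hrs, hr, hs, hxrs, h2⟩ :=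
      exists_rat_secant_close hf hx hz hzx.symm hzδ (η := ε / 4) (by positivity)
    have h3 : |secant f p q - secant f r s| < ε / 2 := by
      by_contra! hge
      refine h ⟨p, q, r, s, hpq, hrs, ?_, ⟨x, ⟨hxpq, hxrs⟩, rfl⟩, hge⟩
      rintro u (rfl | rfl | rfl | rfl) <;> assumption
    rw [abs_lt] at *
    constructor <;> linarith [h1.1, h1.2, h2.1, h2.2, h3.1, h3.2]
  refine hnd ?_
  rcases (𝓝[Icc (0 : ℝ) 1 \ {x}] x).eq_or_neBot with hbot | hne
  · exact ((hasDerivWithinAt_iff_tendsto_slope (f' := 0)).2 (by rw [hbot]; exact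
      tendsto_bot)).differentiableWithinAt
  -- Completeness of `ℝ` provides the derivative as the limit of the slopes.
  · have hc : Cauchy (map (slope f x) (𝓝[Icc (0 : ℝ) 1 \ {x}] x)) := by
      refine Metric.cauchy_iff.2 ⟨hne.map _, fun ε hε => ?_⟩
      obtain ⟨δ, hδ, h⟩ := hslope ε hε
      refine ⟨_, image_mem_map (inter_mem_nhdsWithin _ (Metric.ball_mem_nhds x hδ)), ?_⟩
      rintro _ ⟨y, ⟨⟨hy, hyx⟩, hyδ⟩, rfl⟩ _ ⟨z, ⟨⟨hz, hzx⟩, hzδ⟩, rfl⟩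
      have hs (w : ℝ) : slope f x w = secant f x w := by rw [slope_def_field, secant_comm, secant]
      rw [Real.dist_eq, hs, hs]
      exact h y hy z hz hyx hzx hyδ hzδ
    obtain ⟨f', hf'⟩ := cauchy_map_iff_exists_tendsto.1 hc
    exact (hasDerivWithinAt_iff_tendsto_slope.2 hf').differentiableWithinAt

theorem differentiableOn_of_kwIter_eq_empty (hf : ContinuousOn f (Icc 0 1)) {α : Ordinal.{0}}
    (h : ∀ ε > 0, kwIter f ε α = ∅) : DifferentiableOn ℝ f (Icc 0 1) := by
  intro x hx
  by_contra hnd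
  obtain ⟨ε, hε, hmem⟩ := exists_forall_mem_kwIter hf hx hnd
  exact notMem_empty x (h ε hε ▸ hmem α)

/-! ### Functions given by codes -/

variable {Φ : Set (ℕ × ℚ × ℚ × ℚ × ℚ)}

/-- Consistency speaks of a single ball. Both balls are shrunk to a common small ball about a
rational near `x`. -/
theorem IsCode.abs_sub_le (hΦ : IsCode Φ) {x : ℝ} (hx : x ∈ Icc (0 : ℝ) 1)
    {a r b s a' r' b' s' : ℚ} (h : Rel Φ a r b s) (h' : Rel Φ a' r' b' s') (ha : |x - a| < r)
    (ha' : |x - a'| < r') : |(b : ℝ) - b'| ≤ s + s' := by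
  obtain ⟨η, hη, hη'⟩ := exists_rat_btwn (show (0 : ℝ) < min (r - |x - a|) (r' - |x - a'|) / 2 by
    have := lt_min (sub_pos.2 ha) (sub_pos.2 ha')
    positivity)
  obtain ⟨c, hc, hcx, hxc⟩ := exists_rat_le hx hη
  have h1 := min_le_left ((r : ℝ) - |x - a|) (r' - |x - a'|)
  have h2 := min_le_right ((r : ℝ) - |x - a|) (r' - |x - a'|)
  have hcx' : |x - c| < η := by rw [abs_lt]; constructor <;> linarith
  have key (a r : ℚ) (h : 2 * (η : ℝ) < r - |x - a|) : |a - c| + η < r := by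
    have h3 : |(a : ℝ) - c| ≤ |x - a| + |x - c| := by
      rw [abs_sub_comm x a]; exact _root_.abs_sub_le _ _ _
    have : |(a : ℝ) - c| + η < r := by linarith
    exact_mod_cast this
  have hη0 : 0 < η := by exact_mod_cast hη
  have hc0 : 0 ≤ c := by exact_mod_cast hc.1
  have hc1 : c ≤ 1 := by exact_mod_cast hc.2
  have := hΦ.consistent (hΦ.shrink h hc0 hc1 hη0 (key a r (by linarith)))
    (hΦ.shrink h' hc0 hc1 hη0 (key a' r' (by linarith)))
  exact_mod_cast this

/-- The value at `x` is the supremum of the lower bounds `b - s`; each upper bound `b' + s'`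
dominates them by `IsCode.abs_sub_le`. -/
theorem IsCode.exists_isCodeOf (hΦ : IsCode Φ) (htotal : ∀ x ∈ Icc (0 : ℝ) 1, ∀ ε : ℚ, 0 < ε →
    ∃ a r b : ℚ, |x - a| < r ∧ Rel Φ a r b ε) : ∃ f, IsCodeOf Φ f := by
  let S (x : ℝ) : Set ℝ := {y | ∃ a r b s : ℚ, |x - a| < r ∧ Rel Φ a r b s ∧ y = b - s}
  refine ⟨fun x => sSup (S x), hΦ, htotal, fun a r b s h x hx hxa => ?_⟩
  have hub : ∀ y ∈ S x, y ≤ b + s := by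
    rintro _ ⟨a', r', b', s', h', hR, rfl⟩
    have := abs_le.1 (hΦ.abs_sub_le hx h hR hxa h')
    linarith [this.1]
  have hmem : (b : ℝ) - s ∈ S x := ⟨a, r, b, s, hxa, h, rfl⟩
  rw [abs_le]
  constructor
  · linarith [le_csSup ⟨_, hub⟩ hmem]
  · linarith [csSup_le ⟨_, hmem⟩ hub]

theorem IsCodeOf.continuousOn (h : IsCodeOf Φ f) : ContinuousOn f (Icc 0 1) := by
  refine Metric.continuousOn_iff.2 fun x hx ε hε => ?_
  obtain ⟨η, hη, hη'⟩ := exists_rat_btwn (half_pos hε)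
  obtain ⟨a, r, b, hxa, hR⟩ := h.total x hx η (by exact_mod_cast hη)
  refine ⟨r - |x - a|, sub_pos.2 hxa, fun y hy hyx => ?_⟩
  have hya : |y - a| < r := by
    rw [Real.dist_eq] at hyx
    linarith [abs_sub_le y x a]
  have h1 := abs_le.1 (h.value a r b η hR x hx hxa)
  have h2 := abs_le.1 (h.value a r b η hR y hy hya)
  rw [Real.dist_eq, abs_lt]
  constructor <;> linarith [h1.1, h1.2, h2.1, h2.2]

end KW

namespace KW

/-! ### Computing with rationals -/

theorem encode_int_ofNat (n : ℕ) : Encodable.encode (n : ℤ) = 2 * n := rfl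

theorem encode_int_negSucc (n : ℕ) : Encodable.encode (Int.negSucc n) = 2 * n + 1 := rfl

/-- The rational with a given number. -/
def ratVal (m : ℕ) : ℚ :=
  (if m.unpair.1 % 2 = 0 then ((m.unpair.1 / 2 : ℕ) : ℚ) else -((m.unpair.1 / 2 + 1 : ℕ) : ℚ)) /
    (m.unpair.2 : ℚ)

/-- `m` is the number of a rational. -/
def IsRat (m : ℕ) : Prop :=
  m.unpair.2 ≠ 0 ∧ ∀ k < m.unpair.2 + 1, ((m.unpair.1 + 1) / 2) % k = 0 → m.unpair.2 % k = 0 → k = 1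

theorem ratVal_ratCode (q : ℚ) : ratVal (ratCode q) = q := by
  have h : (q.num : ℚ) / q.den = q := Rat.num_div_den q
  conv_rhs => rw [← h]
  simp only [ratVal, ratCode, Nat.unpair_pair]
  congr 1
  cases q.num with
  | ofNat n =>
    have : Encodable.encode (Int.ofNat n) = 2 * n := encode_int_ofNat n
    rw [this]
    simp
  | negSucc n =>
    rw [encode_int_negSucc, if_neg (by omega), show (2 * n + 1) / 2 = n by omega]
    push_cast [Int.negSucc_eq]
    ring

theorem isRat_iff {m : ℕ} : IsRat m ↔ ∃ q, ratCode q = m := by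
  have hcop (a d : ℕ) (hd : d ≠ 0) : (∀ k < d + 1, a % k = 0 → d % k = 0 → k = 1) ↔ a.Coprime d := by
    constructor
    · intro h
      refine h _ (Nat.lt_succ_of_le (Nat.gcd_le_right _ (Nat.pos_of_ne_zero hd))) ?_ ?_
      · exact Nat.mod_eq_zero_of_dvd (Nat.gcd_dvd_left _ _)
      · exact Nat.mod_eq_zero_of_dvd (Nat.gcd_dvd_right _ _)
    · intro h k _ h1 h2
      exact Nat.eq_one_of_dvd_coprimes h (Nat.dvd_of_mod_eq_zero h1) (Nat.dvd_of_mod_eq_zero h2)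
  -- The number of `n` is `2n` and that of `-(n+1)` is `2n + 1`.
  have habs (z : ℤ) : (Encodable.encode z + 1) / 2 = z.natAbs := by
    cases z with
    | ofNat n =>
      have : Encodable.encode (Int.ofNat n) = 2 * n := encode_int_ofNat n
      rw [this, Int.natAbs_ofNat']
      omega
    | negSucc n => rw [encode_int_negSucc, Int.natAbs_negSucc]; omega
  constructor
  · rintro ⟨h0, h⟩
    obtain ⟨z, hz⟩ : ∃ z : ℤ, Encodable.encode z = m.unpair.1 :=
      Equiv.intEquivNat.surjective m.unpair.1
    rw [hcop _ _ h0, ← hz, habs] at h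
    refine ⟨⟨z, m.unpair.2, h0, h⟩, ?_⟩
    rw [ratCode, hz, Nat.pair_unpair]
  · rintro ⟨q, rfl⟩
    simp only [IsRat, ratCode, Nat.unpair_pair]
    exact ⟨q.den_nz, (hcop _ _ q.den_nz).2 (by rw [habs]; exact q.reduced)⟩

/-- `2` is the number of the integer `1`. -/
theorem ratVal_pair_one (k : ℕ) : ratVal (Nat.pair 2 k) = 1 / k := by
  simp [ratVal]

theorem ratVal_pair_zero (k : ℕ) : ratVal (Nat.pair 0 k) = 0 := by
  simp [ratVal]

theorem primrecPred_imp {α : Type*} [Primcodable α] {p q : α → Prop} (hp : PrimrecPred p)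
    (hq : PrimrecPred q) : PrimrecPred fun a => p a → q a :=
  (hp.not.or hq).of_eq fun _ => imp_iff_not_or.symm

theorem primrecPred_isRat : PrimrecPred IsRat := by
  have h1 : Primrec fun m : ℕ => m.unpair.1 := Primrec.fst.comp .unpair
  have h2 : Primrec fun m : ℕ => m.unpair.2 := Primrec.snd.comp .unpair
  have hR : PrimrecRel fun k m : ℕ =>
      ((m.unpair.1 + 1) / 2) % k = 0 → m.unpair.2 % k = 0 → k = 1 := by
    have h3 : PrimrecPred fun p : ℕ × ℕ => ((p.2.unpair.1 + 1) / 2) % p.1 = 0 :=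
      Primrec.eq.comp (Primrec.nat_mod.comp (Primrec.nat_div.comp
        (Primrec.succ.comp (h1.comp .snd)) (.const 2)) .fst) (.const 0)
    have h4 : PrimrecPred fun p : ℕ × ℕ => p.2.unpair.2 % p.1 = 0 :=
      Primrec.eq.comp (Primrec.nat_mod.comp (h2.comp .snd) .fst) (.const 0)
    exact primrecPred_imp h3 (primrecPred_imp h4 (Primrec.eq.comp .fst (.const 1)))
  exact PrimrecPred.and (Primrec.eq.comp h2 (.const 0)).not
    (hR.forall_lt.comp (Primrec.succ.comp h2) .id)

/-- A primitive recursive function with rational values. -/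
def PrimrecRat {α : Type*} [Primcodable α] (f : α → ℚ) : Prop :=
  ∃ A B C : α → ℕ, Primrec A ∧ Primrec B ∧ Primrec C ∧
    ∀ a, C a ≠ 0 ∧ f a = ((A a : ℚ) - B a) / C a

namespace PrimrecRat

variable {α : Type*} [Primcodable α] {f g : α → ℚ}

theorem natCast {n : α → ℕ} (hn : Primrec n) : PrimrecRat fun a => (n a : ℚ) :=
  ⟨n, fun _ => 0, fun _ => 1, hn, .const 0, .const 1, fun a => by simp⟩

theorem ratVal {n : α → ℕ} (hn : Primrec n) : PrimrecRat fun a => ratVal (n a) := by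
  have h1 : Primrec fun a => (n a).unpair.1 := Primrec.fst.comp (Primrec.unpair.comp hn)
  have h2 : Primrec fun a => (n a).unpair.2 := Primrec.snd.comp (Primrec.unpair.comp hn)
  have hd : PrimrecPred fun a => (n a).unpair.2 = 0 := Primrec.eq.comp h2 (.const 0)
  have hp : PrimrecPred fun a => (n a).unpair.1 % 2 = 0 :=
    Primrec.eq.comp (Primrec.nat_mod.comp h1 (.const 2)) (.const 0)
  have hh : Primrec fun a => (n a).unpair.1 / 2 := Primrec.nat_div.comp h1 (.const 2)
  refine ⟨_, _, _, Primrec.ite hd (.const 0) (Primrec.ite hp hh (.const 0)),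
    Primrec.ite hd (.const 0) (Primrec.ite hp (.const 0) (Primrec.succ.comp hh)),
    Primrec.ite hd (.const 1) h2, fun a => ?_⟩
  by_cases h : (n a).unpair.2 = 0
  · simp [h, KW.ratVal]
  · by_cases h' : (n a).unpair.1 % 2 = 0
    · simp [h, h', KW.ratVal]
    · simp [h, h', KW.ratVal]

theorem neg (hf : PrimrecRat f) : PrimrecRat fun a => -f a := by
  obtain ⟨A, B, C, hA, hB, hC, h⟩ := hf
  exact ⟨B, A, C, hB, hA, hC, fun a => ⟨(h a).1, by beta_reduce; rw [(h a).2]; ring⟩⟩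

theorem add (hf : PrimrecRat f) (hg : PrimrecRat g) : PrimrecRat fun a => f a + g a := by
  obtain ⟨A, B, C, hA, hB, hC, h⟩ := hf
  obtain ⟨A', B', C', hA', hB', hC', h'⟩ := hg
  refine ⟨_, _, _, Primrec.nat_add.comp (Primrec.nat_mul.comp hA hC') (Primrec.nat_mul.comp hA' hC),
    Primrec.nat_add.comp (Primrec.nat_mul.comp hB hC') (Primrec.nat_mul.comp hB' hC),
    Primrec.nat_mul.comp hC hC', fun a => ⟨mul_ne_zero (h a).1 (h' a).1, ?_⟩⟩
  have h1 : (C a : ℚ) ≠ 0 := by exact_mod_cast (h a).1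
  have h2 : (C' a : ℚ) ≠ 0 := by exact_mod_cast (h' a).1
  beta_reduce
  rw [(h a).2, (h' a).2]
  push_cast
  field_simp
  ring

theorem sub (hf : PrimrecRat f) (hg : PrimrecRat g) : PrimrecRat fun a => f a - g a := by
  simpa only [sub_eq_add_neg] using hf.add hg.neg

theorem mul (hf : PrimrecRat f) (hg : PrimrecRat g) : PrimrecRat fun a => f a * g a := by
  obtain ⟨A, B, C, hA, hB, hC, h⟩ := hf
  obtain ⟨A', B', C', hA', hB', hC', h'⟩ := hg
  refine ⟨_, _, _, Primrec.nat_add.comp (Primrec.nat_mul.comp hA hA') (Primrec.nat_mul.comp hB hB'),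
    Primrec.nat_add.comp (Primrec.nat_mul.comp hA hB') (Primrec.nat_mul.comp hB hA'),
    Primrec.nat_mul.comp hC hC', fun a => ⟨mul_ne_zero (h a).1 (h' a).1, ?_⟩⟩
  beta_reduce
  rw [(h a).2, (h' a).2, div_mul_div_comm]
  push_cast
  ring

theorem inv (hf : PrimrecRat f) : PrimrecRat fun a => (f a)⁻¹ := by
  obtain ⟨A, B, C, hA, hB, hC, h⟩ := hf
  have h1 : PrimrecPred fun a => B a < A a := Primrec.nat_lt.comp hB hA
  have h2 : PrimrecPred fun a => A a < B a := Primrec.nat_lt.comp hA hB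
  refine ⟨_, _, _, Primrec.ite h1 hC (.const 0), Primrec.ite h2 hC (.const 0),
    Primrec.ite h1 (Primrec.nat_sub.comp hA hB) (Primrec.ite h2 (Primrec.nat_sub.comp hB hA)
      (.const 1)), fun a => ?_⟩
  beta_reduce
  rw [(h a).2]
  rcases lt_trichotomy (A a) (B a) with hlt | heq | hlt
  · simp only [hlt, hlt.not_gt, if_true, if_false, Nat.cast_sub hlt.le]
    refine ⟨by omega, ?_⟩
    rw [inv_div, ← neg_sub (B a : ℚ), div_neg]
    simp [neg_div]
  · simp [heq]
  · simp only [hlt, hlt.not_gt, if_true, if_false, Nat.cast_sub hlt.le]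
    refine ⟨by omega, ?_⟩
    rw [inv_div]
    simp

theorem div (hf : PrimrecRat f) (hg : PrimrecRat g) : PrimrecRat fun a => f a / g a := by
  simpa only [div_eq_mul_inv] using hf.mul hg.inv

theorem abs (hf : PrimrecRat f) : PrimrecRat fun a => |f a| := by
  obtain ⟨A, B, C, hA, hB, hC, h⟩ := hf
  refine ⟨_, fun _ => 0, C, Primrec.nat_add.comp (Primrec.nat_sub.comp hA hB)
    (Primrec.nat_sub.comp hB hA), .const 0, hC, fun a => ⟨(h a).1, ?_⟩⟩
  beta_reduce
  rw [(h a).2, abs_div, Nat.abs_cast]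
  congr 1
  rcases le_total (A a) (B a) with hle | hle
  · rw [Nat.sub_eq_zero_of_le hle, zero_add, Nat.cast_sub hle, abs_sub_comm,
      abs_of_nonneg (sub_nonneg.2 (by exact_mod_cast hle))]
    simp
  · rw [Nat.sub_eq_zero_of_le hle, add_zero, Nat.cast_sub hle,
      abs_of_nonneg (sub_nonneg.2 (by exact_mod_cast hle))]
    simp

theorem lt (hf : PrimrecRat f) (hg : PrimrecRat g) : PrimrecPred fun a => f a < g a := by
  obtain ⟨A, B, C, hA, hB, hC, h⟩ := hf
  obtain ⟨A', B', C', hA', hB', hC', h'⟩ := hg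
  refine (Primrec.nat_lt.comp
    (Primrec.nat_add.comp (Primrec.nat_mul.comp hA hC') (Primrec.nat_mul.comp hB' hC))
    (Primrec.nat_add.comp (Primrec.nat_mul.comp hA' hC) (Primrec.nat_mul.comp hB hC'))).of_eq
    fun a => ?_
  have h1 : (0 : ℚ) < C a := by exact_mod_cast Nat.pos_of_ne_zero (h a).1
  have h2 : (0 : ℚ) < C' a := by exact_mod_cast Nat.pos_of_ne_zero (h' a).1
  rw [(h a).2, (h' a).2, div_lt_div_iff₀ h1 h2, ← Nat.cast_lt (α := ℚ)]
  push_cast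
  constructor <;> intro _ <;> linarith

theorem le (hf : PrimrecRat f) (hg : PrimrecRat g) : PrimrecPred fun a => f a ≤ g a :=
  (hg.lt hf).not.of_eq fun _ => not_lt

end PrimrecRat

/-! ### `Π₂` sets -/

/-- `A` is a `Π₂` set. -/
def IsPiTwo (A : ℕ → Prop) : Prop :=
  ∃ D : ℕ × ℕ × ℕ → Prop, PrimrecPred D ∧ ∀ e, A e ↔ ∀ m, ∃ u, D (e, m, u)

theorem primrec_decode_getD (δ : Type*) [Primcodable δ] [Inhabited δ] :
    Primrec fun n : ℕ => (Encodable.decode n : Option δ).getD default :=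
  Primrec.option_getD.comp Primrec.decode (.const default)

theorem isPiTwo_of_primrecPred {β γ : Type*} [Primcodable β] [Primcodable γ] [Inhabited β]
    [Inhabited γ] {D : ℕ × β × γ → Prop} (hD : PrimrecPred D) :
    IsPiTwo fun e => ∀ b, ∃ c, D (e, b, c) := by
  refine ⟨fun p => D (p.1, (Encodable.decode p.2.1).getD default,
    (Encodable.decode p.2.2).getD default), hD.comp (Primrec.fst.pair
      (((primrec_decode_getD β).comp (Primrec.fst.comp .snd)).pair ((primrec_decode_getD γ).comp (Primrec.snd.comp .snd)))),
    fun e => ⟨fun h m => ?_, fun h b => ?_⟩⟩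
  · obtain ⟨c, hc⟩ := h ((Encodable.decode m).getD default)
    exact ⟨Encodable.encode c, by simpa using hc⟩
  · obtain ⟨u, hu⟩ := h (Encodable.encode b)
    exact ⟨_, by simpa using hu⟩

theorem IsPiTwo.and {A B : ℕ → Prop} (hA : IsPiTwo A) (hB : IsPiTwo B) :
    IsPiTwo fun e => A e ∧ B e := by
  obtain ⟨D, hD, hA⟩ := hA
  obtain ⟨D', hD', hB⟩ := hB
  have hm : Primrec fun p : ℕ × ℕ × ℕ => p.2.1.unpair.1 :=
    Primrec.fst.comp (Primrec.unpair.comp (Primrec.fst.comp .snd))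
  have h0 : PrimrecPred fun p : ℕ × ℕ × ℕ => p.2.1.unpair.1 = 0 := Primrec.eq.comp hm (.const 0)
  have hp : Primrec fun p : ℕ × ℕ × ℕ => (p.1, p.2.1.unpair.2, p.2.2) :=
    Primrec.fst.pair ((Primrec.snd.comp (Primrec.unpair.comp (Primrec.fst.comp .snd))).pair
      (Primrec.snd.comp .snd))
  -- The first component of the universally quantified `m` selects which of the two conditions is
  -- checked.
  refine ⟨fun p => (p.2.1.unpair.1 = 0 → D (p.1, p.2.1.unpair.2, p.2.2)) ∧
    (¬ p.2.1.unpair.1 = 0 → D' (p.1, p.2.1.unpair.2, p.2.2)),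
    (primrecPred_imp h0 (hD.comp hp)).and (primrecPred_imp h0.not (hD'.comp hp)), fun e => ?_⟩
  beta_reduce
  rw [hA, hB]
  constructor
  · rintro ⟨h1, h2⟩ m
    by_cases hm : m.unpair.1 = 0
    · simpa [hm] using h1 _
    · simpa [hm] using h2 _
  · refine fun h => ⟨fun m => ?_, fun m => ?_⟩
    · simpa using h (Nat.pair 0 m)
    · simpa using h (Nat.pair 1 m)

end KW

namespace KW

open Nat.Partrec (Code)
open Set

/-! ### The numbers of codes -/

/-- The components `a`, `r`, `b`, `s` of the number of a quintuple `(n, a, r, b, s)`. -/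
def compA (k : ℕ) : ℕ := k.unpair.2.unpair.1
/-- See `compA`. -/
def compR (k : ℕ) : ℕ := k.unpair.2.unpair.2.unpair.1
/-- See `compA`. -/
def compB (k : ℕ) : ℕ := k.unpair.2.unpair.2.unpair.2.unpair.1
/-- See `compA`. -/
def compS (k : ℕ) : ℕ := k.unpair.2.unpair.2.unpair.2.unpair.2

/-- The number of a quintuple with the given components. -/
def quintNum (n a r b s : ℕ) : ℕ := Nat.pair n (Nat.pair a (Nat.pair r (Nat.pair b s)))

/-- `φ_e(k) = 1`, within `t` steps. -/
def Accepts (t e k : ℕ) : Prop := Code.evaln t (Denumerable.ofNat Code e) k = some 1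

section Primrec

variable {α : Type*} [Primcodable α]

theorem primrec_compA {k : α → ℕ} (hk : Primrec k) : Primrec fun a => compA (k a) :=
  Primrec.fst.comp (Primrec.unpair.comp (Primrec.snd.comp (Primrec.unpair.comp hk)))

theorem primrec_compR {k : α → ℕ} (hk : Primrec k) : Primrec fun a => compR (k a) :=
  Primrec.fst.comp (Primrec.unpair.comp (Primrec.snd.comp (Primrec.unpair.comp (Primrec.snd.comp
    (Primrec.unpair.comp hk)))))

theorem primrec_compB {k : α → ℕ} (hk : Primrec k) : Primrec fun a => compB (k a) :=
  Primrec.fst.comp (Primrec.unpair.comp (Primrec.snd.comp (Primrec.unpair.comp (Primrec.snd.comp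
    (Primrec.unpair.comp (Primrec.snd.comp (Primrec.unpair.comp hk)))))))

theorem primrec_compS {k : α → ℕ} (hk : Primrec k) : Primrec fun a => compS (k a) :=
  Primrec.snd.comp (Primrec.unpair.comp (Primrec.snd.comp (Primrec.unpair.comp (Primrec.snd.comp
    (Primrec.unpair.comp (Primrec.snd.comp (Primrec.unpair.comp hk)))))))

theorem primrec_quintNum {n a r b s : α → ℕ} (hn : Primrec n) (ha : Primrec a) (hr : Primrec r)
    (hb : Primrec b) (hs : Primrec s) :
    Primrec fun x => quintNum (n x) (a x) (r x) (b x) (s x) :=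
  Primrec₂.natPair.comp hn (Primrec₂.natPair.comp ha (Primrec₂.natPair.comp hr
    (Primrec₂.natPair.comp hb hs)))

theorem primrecPred_evaln {t e k : α → ℕ} (ht : Primrec t) (he : Primrec e) (hk : Primrec k)
    (i : ℕ) :
    PrimrecPred fun a => Code.evaln (t a) (Denumerable.ofNat Code (e a)) (k a) = some i :=
  Primrec.eq.comp (Code.primrec_evaln.comp ((ht.pair ((Primrec.ofNat Code).comp he)).pair hk))
    (.const (some i))

theorem primrecPred_accepts {t e k : α → ℕ} (ht : Primrec t) (he : Primrec e) (hk : Primrec k) :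
    PrimrecPred fun a => Accepts (t a) (e a) (k a) :=
  primrecPred_evaln ht he hk 1

theorem PrimrecRat.zero : PrimrecRat fun _ : α => (0 : ℚ) := by
  simpa using PrimrecRat.natCast (Primrec.const (α := α) 0)

theorem PrimrecRat.one : PrimrecRat fun _ : α => (1 : ℚ) := by
  simpa using PrimrecRat.natCast (Primrec.const (α := α) 1)

end Primrec

theorem Accepts.mono {t t' e k : ℕ} (h : Accepts t e k) (ht : t ≤ t') : Accepts t' e k :=
  Code.evaln_mono ht h

theorem mem_phi_iff {e k i : ℕ} :
    i ∈ phi e k ↔ ∃ t, Code.evaln t (Denumerable.ofNat Code e) k = some i :=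
  Code.evaln_complete

variable {Φ : Set (ℕ × ℚ × ℚ × ℚ × ℚ)} {e : ℕ}

theorem Computes.exists_accepts_iff {Y : Set ℕ} (h : Computes e Y) {k : ℕ} :
    (∃ t, Accepts t e k) ↔ k ∈ Y := by
  rw [show (∃ t, Accepts t e k) ↔ 1 ∈ phi e k from mem_phi_iff.symm]
  refine ⟨fun h1 => ?_, (h k).1⟩
  by_contra hk
  exact absurd (Part.mem_unique h1 ((h k).2 hk)) one_ne_zero

theorem quintCode_eq (n : ℕ) (a r b s : ℚ) :
    quintCode (n, a, r, b, s) = quintNum n (ratCode a) (ratCode r) (ratCode b) (ratCode s) := rfl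

theorem ratCode_injective : Function.Injective ratCode :=
  Function.LeftInverse.injective ratVal_ratCode

theorem compA_quintNum (n a r b s : ℕ) : compA (quintNum n a r b s) = a := by
  simp [compA, quintNum]

theorem compR_quintNum (n a r b s : ℕ) : compR (quintNum n a r b s) = r := by
  simp [compR, quintNum]

theorem compB_quintNum (n a r b s : ℕ) : compB (quintNum n a r b s) = b := by
  simp [compB, quintNum]

theorem compS_quintNum (n a r b s : ℕ) : compS (quintNum n a r b s) = s := by
  simp [compS, quintNum]

theorem quintNum_comp (k : ℕ) :
    quintNum k.unpair.1 (compA k) (compR k) (compB k) (compS k) = k := by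
  simp [quintNum, compA, compR, compB, compS]

/-- An accepted number is the number of a quintuple of `Φ`. -/
theorem Accepts.exists_rel (h : Computes e (quintCode '' Φ)) {t k : ℕ} (hk : Accepts t e k) :
    ∃ a r b s, Rel Φ a r b s ∧ compA k = ratCode a ∧ compR k = ratCode r ∧ compB k = ratCode b ∧
      compS k = ratCode s := by
  obtain ⟨⟨n, a, r, b, s⟩, hx, rfl⟩ := h.exists_accepts_iff.1 ⟨t, hk⟩
  exact ⟨a, r, b, s, ⟨n, hx⟩, by simp [quintCode_eq, compA_quintNum, compR_quintNum,
    compB_quintNum, compS_quintNum]⟩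

theorem Rel.exists_accepts (h : Computes e (quintCode '' Φ)) {a r b s : ℚ} (hR : Rel Φ a r b s) :
    ∃ n t, Accepts t e (quintNum n (ratCode a) (ratCode r) (ratCode b) (ratCode s)) := by
  obtain ⟨n, hn⟩ := hR
  obtain ⟨t, ht⟩ := h.exists_accepts_iff.2 (mem_image_of_mem _ hn)
  exact ⟨n, t, ht⟩

theorem Accepts.rel (h : Computes e (quintCode '' Φ)) {t n : ℕ} {a r b s : ℚ}
    (hk : Accepts t e (quintNum n (ratCode a) (ratCode r) (ratCode b) (ratCode s))) :
    Rel Φ a r b s := by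
  obtain ⟨a', r', b', s', hR, h1, h2, h3, h4⟩ := hk.exists_rel h
  simp only [compA_quintNum, compR_quintNum, compB_quintNum, compS_quintNum,
    ratCode_injective.eq_iff] at h1 h2 h3 h4
  rwa [h1, h2, h3, h4]

/-- `φ_e(k)` is `0`, or it is `1` and `k` is the number of a quintuple in the right domain. -/
def TotalCond (p : ℕ × ℕ × ℕ) : Prop :=
  Code.evaln p.2.2 (Denumerable.ofNat Code p.1) p.2.1 = some 0 ∨
    Accepts p.2.2 p.1 p.2.1 ∧ (IsRat (compA p.2.1) ∧ IsRat (compR p.2.1) ∧ IsRat (compB p.2.1) ∧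
      IsRat (compS p.2.1)) ∧ 0 ≤ ratVal (compA p.2.1) ∧ ratVal (compA p.2.1) ≤ 1 ∧
        0 < ratVal (compR p.2.1) ∧ 0 < ratVal (compS p.2.1)

/-- The consistency of a code. -/
def ConsistentCond (p : ℕ × (ℕ × ℕ × ℕ) × ℕ) : Prop :=
  Accepts p.2.1.2.2 p.1 p.2.1.1 → Accepts p.2.1.2.2 p.1 p.2.1.2.1 →
    compA p.2.1.1 = compA p.2.1.2.1 → compR p.2.1.1 = compR p.2.1.2.1 →
      |ratVal (compB p.2.1.1) - ratVal (compB p.2.1.2.1)| ≤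
        ratVal (compS p.2.1.1) + ratVal (compS p.2.1.2.1)

/-- The closure of a code under smaller balls in the domain. -/
def ShrinkCond (p : ℕ × (ℕ × ℕ × ℕ × ℕ) × ℕ × ℕ) : Prop :=
  Accepts p.2.1.2.1 p.1 p.2.1.1 → IsRat p.2.1.2.2.1 → IsRat p.2.1.2.2.2 →
    0 ≤ ratVal p.2.1.2.2.1 → ratVal p.2.1.2.2.1 ≤ 1 → 0 < ratVal p.2.1.2.2.2 →
      |ratVal (compA p.2.1.1) - ratVal p.2.1.2.2.1| + ratVal p.2.1.2.2.2 <
        ratVal (compR p.2.1.1) →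
      Accepts p.2.2.2 p.1
        (quintNum p.2.2.1 p.2.1.2.2.1 p.2.1.2.2.2 (compB p.2.1.1) (compS p.2.1.1))

/-- The closure of a code under larger balls in the range. -/
def EnlargeCond (p : ℕ × (ℕ × ℕ × ℕ × ℕ) × ℕ × ℕ) : Prop :=
  Accepts p.2.1.2.1 p.1 p.2.1.1 → IsRat p.2.1.2.2.1 → IsRat p.2.1.2.2.2 →
    |ratVal (compB p.2.1.1) - ratVal p.2.1.2.2.1| + ratVal (compS p.2.1.1) <
      ratVal p.2.1.2.2.2 →
    Accepts p.2.2.2 p.1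
      (quintNum p.2.2.1 (compA p.2.1.1) (compR p.2.1.1) p.2.1.2.2.1 p.2.1.2.2.2)

/-- The accepted quintuple `w` has error `p.2.1`, and its ball contains the `i`-th of the `p.2.2 + 1`
subintervals of equal length of `[0, 1]`. -/
def CoversPart (w : ℕ × ℕ) (i : ℕ) (p : ℕ × ℕ × ℕ) : Prop :=
  Accepts w.2 p.1 w.1 ∧ compS w.1 = p.2.1 ∧
    |(i : ℚ) / ((p.2.2 + 1 : ℕ) : ℚ) - ratVal (compA w.1)| < ratVal (compR w.1) ∧
    |((i + 1 : ℕ) : ℚ) / ((p.2.2 + 1 : ℕ) : ℚ) - ratVal (compA w.1)| < ratVal (compR w.1)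

/-- The unit interval is covered by balls from finitely many accepted quintuples. -/
def CoverCond (p : ℕ × ℕ × ℕ × List (ℕ × ℕ)) : Prop :=
  IsRat p.2.1 → 0 < ratVal p.2.1 →
    ∀ i ∈ List.range (p.2.2.1 + 1), ∃ w ∈ p.2.2.2, CoversPart w i (p.1, p.2.1, p.2.2.1)

/-- The program with number `e` computes a code of a function in `C[0,1]`. -/
def IsIndex (e : ℕ) : Prop :=
  ((((∀ k, ∃ t, TotalCond (e, k, t)) ∧ ∀ b, ∃ c, ConsistentCond (e, b, c)) ∧
    ∀ b, ∃ c, ShrinkCond (e, b, c)) ∧ ∀ b, ∃ c, EnlargeCond (e, b, c)) ∧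
    ∀ b, ∃ c, CoverCond (e, b, c)

theorem primrecPred_totalCond : PrimrecPred TotalCond := by
  have hk : Primrec fun p : ℕ × ℕ × ℕ => p.2.1 := Primrec.fst.comp .snd
  have ht : Primrec fun p : ℕ × ℕ × ℕ => p.2.2 := Primrec.snd.comp .snd
  have hA := primrec_compA hk
  have hR := primrec_compR hk
  have hS := primrec_compS hk
  refine (primrecPred_evaln ht .fst hk 0).or ((primrecPred_accepts ht .fst hk).and (.and ?_ ?_))
  · exact (primrecPred_isRat.comp hA).and ((primrecPred_isRat.comp hR).and
      ((primrecPred_isRat.comp (primrec_compB hk)).and (primrecPred_isRat.comp hS)))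
  · exact (PrimrecRat.zero.le (.ratVal hA)).and ((PrimrecRat.le (.ratVal hA) .one).and
      ((PrimrecRat.zero.lt (.ratVal hR)).and (PrimrecRat.zero.lt (.ratVal hS))))

theorem primrecPred_consistentCond : PrimrecPred ConsistentCond := by
  have hb : Primrec fun p : ℕ × (ℕ × ℕ × ℕ) × ℕ => p.2.1 := Primrec.fst.comp .snd
  have hk : Primrec fun p : ℕ × (ℕ × ℕ × ℕ) × ℕ => p.2.1.1 := Primrec.fst.comp hb
  have hk' : Primrec fun p : ℕ × (ℕ × ℕ × ℕ) × ℕ => p.2.1.2.1 :=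
    Primrec.fst.comp (Primrec.snd.comp hb)
  have ht : Primrec fun p : ℕ × (ℕ × ℕ × ℕ) × ℕ => p.2.1.2.2 :=
    Primrec.snd.comp (Primrec.snd.comp hb)
  refine primrecPred_imp (primrecPred_accepts ht .fst hk) (primrecPred_imp (primrecPred_accepts ht .fst hk')
    (primrecPred_imp (Primrec.eq.comp (primrec_compA hk) (primrec_compA hk')) (primrecPred_imp (Primrec.eq.comp
      (primrec_compR hk) (primrec_compR hk')) (PrimrecRat.le ?_ ?_))))
  · exact (PrimrecRat.sub (.ratVal (primrec_compB hk)) (.ratVal (primrec_compB hk'))).abs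
  · exact .add (.ratVal (primrec_compS hk)) (.ratVal (primrec_compS hk'))

theorem primrecPred_shrinkCond : PrimrecPred ShrinkCond := by
  have hb : Primrec fun p : ℕ × (ℕ × ℕ × ℕ × ℕ) × ℕ × ℕ => p.2.1 := Primrec.fst.comp .snd
  have hc : Primrec fun p : ℕ × (ℕ × ℕ × ℕ × ℕ) × ℕ × ℕ => p.2.2 := Primrec.snd.comp .snd
  have hk : Primrec fun p : ℕ × (ℕ × ℕ × ℕ × ℕ) × ℕ × ℕ => p.2.1.1 := Primrec.fst.comp hb
  have ht : Primrec fun p : ℕ × (ℕ × ℕ × ℕ × ℕ) × ℕ × ℕ => p.2.1.2.1 :=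
    Primrec.fst.comp (Primrec.snd.comp hb)
  have ha : Primrec fun p : ℕ × (ℕ × ℕ × ℕ × ℕ) × ℕ × ℕ => p.2.1.2.2.1 :=
    Primrec.fst.comp (Primrec.snd.comp (Primrec.snd.comp hb))
  have hr : Primrec fun p : ℕ × (ℕ × ℕ × ℕ × ℕ) × ℕ × ℕ => p.2.1.2.2.2 :=
    Primrec.snd.comp (Primrec.snd.comp (Primrec.snd.comp hb))
  refine primrecPred_imp (primrecPred_accepts ht .fst hk) (primrecPred_imp (primrecPred_isRat.comp ha)
    (primrecPred_imp (primrecPred_isRat.comp hr) (primrecPred_imp (PrimrecRat.zero.le (.ratVal ha))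
      (primrecPred_imp (PrimrecRat.le (.ratVal ha) .one) (primrecPred_imp (PrimrecRat.zero.lt (.ratVal hr))
        (primrecPred_imp (PrimrecRat.lt (.add ?_ (.ratVal hr)) (.ratVal (primrec_compR hk))) ?_))))))
  · exact (PrimrecRat.sub (.ratVal (primrec_compA hk)) (.ratVal ha)).abs
  · exact primrecPred_accepts (Primrec.snd.comp hc) .fst (primrec_quintNum (Primrec.fst.comp hc) ha
      hr (primrec_compB hk) (primrec_compS hk))

theorem primrecPred_enlargeCond : PrimrecPred EnlargeCond := by
  have hb : Primrec fun p : ℕ × (ℕ × ℕ × ℕ × ℕ) × ℕ × ℕ => p.2.1 := Primrec.fst.comp .snd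
  have hc : Primrec fun p : ℕ × (ℕ × ℕ × ℕ × ℕ) × ℕ × ℕ => p.2.2 := Primrec.snd.comp .snd
  have hk : Primrec fun p : ℕ × (ℕ × ℕ × ℕ × ℕ) × ℕ × ℕ => p.2.1.1 := Primrec.fst.comp hb
  have ht : Primrec fun p : ℕ × (ℕ × ℕ × ℕ × ℕ) × ℕ × ℕ => p.2.1.2.1 :=
    Primrec.fst.comp (Primrec.snd.comp hb)
  have ha : Primrec fun p : ℕ × (ℕ × ℕ × ℕ × ℕ) × ℕ × ℕ => p.2.1.2.2.1 :=
    Primrec.fst.comp (Primrec.snd.comp (Primrec.snd.comp hb))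
  have hr : Primrec fun p : ℕ × (ℕ × ℕ × ℕ × ℕ) × ℕ × ℕ => p.2.1.2.2.2 :=
    Primrec.snd.comp (Primrec.snd.comp (Primrec.snd.comp hb))
  refine primrecPred_imp (primrecPred_accepts ht .fst hk) (primrecPred_imp (primrecPred_isRat.comp ha)
    (primrecPred_imp (primrecPred_isRat.comp hr)
      (primrecPred_imp (PrimrecRat.lt (.add ?_ (.ratVal (primrec_compS hk))) (.ratVal hr)) ?_)))
  · exact (PrimrecRat.sub (.ratVal (primrec_compB hk)) (.ratVal ha)).abs
  · exact primrecPred_accepts (Primrec.snd.comp hc) .fst (primrec_quintNum (Primrec.fst.comp hc)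
      (primrec_compA hk) (primrec_compR hk) ha hr)

theorem primrecPred_coverCond : PrimrecPred CoverCond := by
  have hcov : PrimrecRel fun (w : ℕ × ℕ) (q : ℕ × ℕ × ℕ × ℕ) => CoversPart w q.1 q.2 := by
    have hi : Primrec fun x : (ℕ × ℕ) × ℕ × ℕ × ℕ × ℕ => x.2.1 := Primrec.fst.comp .snd
    have hp : Primrec fun x : (ℕ × ℕ) × ℕ × ℕ × ℕ × ℕ => x.2.2 := Primrec.snd.comp .snd
    have hN : Primrec fun x : (ℕ × ℕ) × ℕ × ℕ × ℕ × ℕ => x.2.2.2.2 + 1 :=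
      Primrec.succ.comp (Primrec.snd.comp (Primrec.snd.comp hp))
    have hk : Primrec fun x : (ℕ × ℕ) × ℕ × ℕ × ℕ × ℕ => x.1.1 := Primrec.fst.comp .fst
    have hlt {n : (ℕ × ℕ) × ℕ × ℕ × ℕ × ℕ → ℕ} (hn : Primrec n) :
        PrimrecPred fun x : (ℕ × ℕ) × ℕ × ℕ × ℕ × ℕ =>
          |(n x : ℚ) / ((x.2.2.2.2 + 1 : ℕ) : ℚ) - ratVal (compA x.1.1)| < ratVal (compR x.1.1) :=
      PrimrecRat.lt (.abs (.sub (.div (.natCast hn) (.natCast hN)) (.ratVal (primrec_compA hk))))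
        (.ratVal (primrec_compR hk))
    exact (primrecPred_accepts (Primrec.snd.comp .fst) (Primrec.fst.comp hp) hk).and
      (.and (Primrec.eq.comp (primrec_compS hk) (Primrec.fst.comp (Primrec.snd.comp hp)))
        ((hlt hi).and (hlt (Primrec.succ.comp hi))))
  have hb : Primrec fun p : ℕ × ℕ × ℕ × List (ℕ × ℕ) => p.2.1 := Primrec.fst.comp .snd
  have hN : Primrec fun p : ℕ × ℕ × ℕ × List (ℕ × ℕ) => p.2.2.1 :=
    Primrec.fst.comp (Primrec.snd.comp .snd)
  have hex : PrimrecRel fun (i : ℕ) (p : ℕ × ℕ × ℕ × List (ℕ × ℕ)) =>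
      ∃ w ∈ p.2.2.2, CoversPart w i (p.1, p.2.1, p.2.2.1) :=
    PrimrecRel.comp hcov.exists_mem_list
      (Primrec.snd.comp (Primrec.snd.comp (Primrec.snd.comp .snd)))
      (Primrec.fst.pair ((Primrec.fst.comp .snd).pair ((hb.comp .snd).pair (hN.comp .snd))))
  exact primrecPred_imp (primrecPred_isRat.comp hb) (primrecPred_imp (PrimrecRat.zero.lt (.ratVal hb))
    (PrimrecRel.comp hex.forall_mem_list (Primrec.list_range.comp (Primrec.succ.comp hN)) .id))

theorem isPiTwo_isIndex : IsPiTwo IsIndex :=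
  ((((isPiTwo_of_primrecPred primrecPred_totalCond).and
    (isPiTwo_of_primrecPred primrecPred_consistentCond)).and
      (isPiTwo_of_primrecPred primrecPred_shrinkCond)).and
        (isPiTwo_of_primrecPred primrecPred_enlargeCond)).and
          (isPiTwo_of_primrecPred primrecPred_coverCond)

theorem abs_div_sub_lt_iff {i n : ℕ} {a r : ℚ} :
    |(i : ℚ) / (n : ℚ) - a| < r ↔ |(i : ℝ) / (n : ℝ) - a| < r := by
  rw [← Rat.cast_lt (K := ℝ)]
  simp only [Rat.cast_abs, Rat.cast_sub, Rat.cast_div, Rat.cast_natCast]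

/-- `Φ` is read off from the accepted numbers. The covers give totality at each real `x`, since a
ball containing both ends of a subinterval contains all of it. -/
theorem IsIndex.exists_encodes (h : IsIndex e) : ∃ f, Encodes e f := by
  obtain ⟨⟨⟨⟨htot, hcons⟩, hshrink⟩, henl⟩, hcov⟩ := h
  let Φ : Set (ℕ × ℚ × ℚ × ℚ × ℚ) := {x | 1 ∈ phi e (quintCode x)}
  have hΦ : Computes e (quintCode '' Φ) := by
    refine fun k => ⟨?_, fun hk => ?_⟩
    · rintro ⟨x, hx, rfl⟩
      exact hx
    · obtain ⟨t, h0 | ⟨h1, ⟨hA, hR, hB, hS⟩, -⟩⟩ := htot k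
      · exact mem_phi_iff.2 ⟨t, h0⟩
      · obtain ⟨a, ha⟩ := isRat_iff.1 hA
        obtain ⟨r, hr⟩ := isRat_iff.1 hR
        obtain ⟨b, hb⟩ := isRat_iff.1 hB
        obtain ⟨s, hs⟩ := isRat_iff.1 hS
        have hq : quintCode (k.unpair.1, a, r, b, s) = k := by
          rw [quintCode_eq, ha, hr, hb, hs, quintNum_comp]
        refine absurd ⟨(k.unpair.1, a, r, b, s), ?_, hq⟩ hk
        change 1 ∈ phi e _
        rw [hq]
        exact mem_phi_iff.2 ⟨t, h1⟩
  have hcode : IsCode Φ := by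
    constructor
    · intro a r b s hR
      obtain ⟨n, t, ht⟩ := hR.exists_accepts hΦ
      obtain ⟨t', h0 | ⟨-, -, h1⟩⟩ := htot (quintNum n (ratCode a) (ratCode r) (ratCode b) (ratCode s))
      · have := Part.mem_unique (mem_phi_iff.2 ⟨t, ht⟩) (mem_phi_iff.2 ⟨t', h0⟩)
        exact absurd this one_ne_zero
      · simpa [compA_quintNum, compR_quintNum, compS_quintNum, ratVal_ratCode] using h1
    · intro a r b s b' s' hR hR'
      obtain ⟨n, t, ht⟩ := hR.exists_accepts hΦ
      obtain ⟨n', t', ht'⟩ := hR'.exists_accepts hΦ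
      obtain ⟨_, hc⟩ := hcons (quintNum n (ratCode a) (ratCode r) (ratCode b) (ratCode s),
        quintNum n' (ratCode a) (ratCode r) (ratCode b') (ratCode s'), max t t')
      have := hc (ht.mono (le_max_left _ _)) (ht'.mono (le_max_right _ _))
      simpa [compA_quintNum, compR_quintNum, compS_quintNum, compB_quintNum, ratVal_ratCode]
        using this
    · intro a r b s a' r' hR h0 h1 h2 h3
      obtain ⟨n, t, ht⟩ := hR.exists_accepts hΦ
      obtain ⟨⟨n', t'⟩, hc⟩ := hshrink
        (quintNum n (ratCode a) (ratCode r) (ratCode b) (ratCode s), t, ratCode a', ratCode r')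
      have := hc ht (isRat_iff.2 ⟨_, rfl⟩) (isRat_iff.2 ⟨_, rfl⟩)
      simp only [compA_quintNum, compR_quintNum, compS_quintNum, compB_quintNum, ratVal_ratCode]
        at this
      exact (this h0 h1 h2 h3).rel hΦ
    · intro a r b s b' s' hR h1
      obtain ⟨n, t, ht⟩ := hR.exists_accepts hΦ
      obtain ⟨⟨n', t'⟩, hc⟩ := henl
        (quintNum n (ratCode a) (ratCode r) (ratCode b) (ratCode s), t, ratCode b', ratCode s')
      have := hc ht (isRat_iff.2 ⟨_, rfl⟩) (isRat_iff.2 ⟨_, rfl⟩)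
      simp only [compA_quintNum, compR_quintNum, compS_quintNum, compB_quintNum, ratVal_ratCode]
        at this
      exact (this h1).rel hΦ
  have htotal : ∀ x ∈ Icc (0 : ℝ) 1, ∀ ε : ℚ, 0 < ε →
      ∃ a r b : ℚ, |x - a| < r ∧ Rel Φ a r b ε := by
    intro x hx ε hε
    obtain ⟨⟨N, L⟩, hc⟩ := hcov (ratCode ε)
    have hN : (0 : ℝ) < ((N + 1 : ℕ) : ℝ) := by positivity
    -- The point `x = 1` is separate: the floor would give `N + 1`, one past the last subinterval.
    obtain ⟨i, hiN, hi1, hi2⟩ : ∃ i < N + 1, (i : ℝ) / ((N + 1 : ℕ) : ℝ) ≤ x ∧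
        x ≤ ((i + 1 : ℕ) : ℝ) / ((N + 1 : ℕ) : ℝ) := by
      rcases hx.2.eq_or_lt with rfl | hx1
      · refine ⟨N, by omega, ?_, ?_⟩
        · rw [div_le_one hN]; push_cast; linarith
        · rw [div_self hN.ne']
      · refine ⟨⌊x * ((N + 1 : ℕ) : ℝ)⌋₊, ?_, ?_, ?_⟩
        · rw [Nat.floor_lt (mul_nonneg hx.1 hN.le)]
          nlinarith
        · rw [div_le_iff₀ hN]
          exact Nat.floor_le (mul_nonneg hx.1 hN.le)
        · rw [le_div_iff₀ hN]
          push_cast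
          exact (Nat.lt_floor_add_one _).le
    obtain ⟨⟨k, t⟩, -, hacc, hS, h1, h2⟩ := hc (isRat_iff.2 ⟨_, rfl⟩) (by simpa [ratVal_ratCode] using hε) i
      (List.mem_range.2 hiN)
    obtain ⟨a, r, b, s, hR, hA', hR', -, hS'⟩ := hacc.exists_rel hΦ
    obtain rfl : s = ε := ratCode_injective (hS'.symm.trans hS)
    simp only [hA', hR', ratVal_ratCode] at h1 h2
    refine ⟨a, r, b, ?_, hR⟩
    have h1' : |(i : ℝ) / ((N + 1 : ℕ) : ℝ) - a| < r := abs_div_sub_lt_iff.1 h1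
    have h2' : |((i + 1 : ℕ) : ℝ) / ((N + 1 : ℕ) : ℝ) - a| < r := abs_div_sub_lt_iff.1 h2
    rw [abs_lt] at *
    constructor <;> linarith [h1'.1, h1'.2, h2'.1, h2'.2]
  obtain ⟨f, hf⟩ := hcode.exists_isCodeOf htotal
  exact ⟨f, Φ, hΦ, hf⟩

theorem Encodes.isIndex {f : ℝ → ℝ} (h : Encodes e f) : IsIndex e := by
  obtain ⟨Φ, hΦ, hf⟩ := h
  have hcode := hf.isCode
  refine ⟨⟨⟨⟨fun k => ?_, ?_⟩, ?_⟩, ?_⟩, ?_⟩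
  · by_cases hk : k ∈ quintCode '' Φ
    · obtain ⟨t, ht⟩ := hΦ.exists_accepts_iff.2 hk
      obtain ⟨a, r, b, s, hR, h1, h2, h3, h4⟩ := ht.exists_rel hΦ
      refine ⟨t, .inr ⟨ht, ?_⟩⟩
      simp only [h1, h2, h3, h4, ratVal_ratCode]
      exact ⟨⟨isRat_iff.2 ⟨_, rfl⟩, isRat_iff.2 ⟨_, rfl⟩, isRat_iff.2 ⟨_, rfl⟩,
        isRat_iff.2 ⟨_, rfl⟩⟩, hcode.dom hR⟩
    · obtain ⟨t, ht⟩ := mem_phi_iff.1 ((hΦ k).2 hk)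
      exact ⟨t, .inl ht⟩
  · rintro ⟨k, k', t⟩
    -- The existential variable plays no role here, as consistency is already `Π₁`.
    refine ⟨0, fun h h' hA hR => ?_⟩
    dsimp only at h h' hA hR ⊢
    obtain ⟨a, r, b, s, hrel, h1, h2, h3, h4⟩ := h.exists_rel hΦ
    obtain ⟨a', r', b', s', hrel', h1', h2', h3', h4'⟩ := h'.exists_rel hΦ
    obtain rfl : a = a' := ratCode_injective (by rw [← h1, ← h1', hA])
    obtain rfl : r = r' := ratCode_injective (by rw [← h2, ← h2', hR])
    simp only [h3, h4, h3', h4', ratVal_ratCode]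
    exact hcode.consistent hrel hrel'
  · rintro ⟨k, t, a', r'⟩
    by_cases hk : Accepts t e k ∧ IsRat a' ∧ IsRat r' ∧ 0 ≤ ratVal a' ∧ ratVal a' ≤ 1 ∧
        0 < ratVal r' ∧ |ratVal (compA k) - ratVal a'| + ratVal r' < ratVal (compR k)
    · obtain ⟨hk, ha', hr', h5, h6, h7, h8⟩ := hk
      obtain ⟨a', rfl⟩ := isRat_iff.1 ha'
      obtain ⟨r', rfl⟩ := isRat_iff.1 hr'
      obtain ⟨a, r, b, s, hrel, h1, h2, h3, h4⟩ := hk.exists_rel hΦ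
      simp only [h1, h2, ratVal_ratCode] at h5 h6 h7 h8
      obtain ⟨n, t', h⟩ := (hcode.shrink hrel h5 h6 h7 h8).exists_accepts hΦ
      exact ⟨(n, t'), fun _ _ _ _ _ _ _ => by simpa only [h3, h4] using h⟩
    · exact ⟨(0, 0), fun h1 h2 h3 h4 h5 h6 h7 => absurd ⟨h1, h2, h3, h4, h5, h6, h7⟩ hk⟩
  · rintro ⟨k, t, b', s'⟩
    by_cases hk : Accepts t e k ∧ IsRat b' ∧ IsRat s' ∧
        |ratVal (compB k) - ratVal b'| + ratVal (compS k) < ratVal s'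
    · obtain ⟨hk, hb', hs', h8⟩ := hk
      obtain ⟨b', rfl⟩ := isRat_iff.1 hb'
      obtain ⟨s', rfl⟩ := isRat_iff.1 hs'
      obtain ⟨a, r, b, s, hrel, h1, h2, h3, h4⟩ := hk.exists_rel hΦ
      simp only [h3, h4, ratVal_ratCode] at h8
      obtain ⟨n, t', h⟩ := (hcode.enlarge hrel h8).exists_accepts hΦ
      exact ⟨(n, t'), fun _ _ _ _ => by simpa only [h1, h2] using h⟩
    · exact ⟨(0, 0), fun h1 h2 h3 h4 => absurd ⟨h1, h2, h3, h4⟩ hk⟩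
  · intro ε
    by_cases hε : IsRat ε ∧ 0 < ratVal ε
    · obtain ⟨hε, hpos⟩ := hε
      obtain ⟨ε, rfl⟩ := isRat_iff.1 hε
      rw [ratVal_ratCode] at hpos
      choose! A R B hA hrel using fun x hx => hf.total x hx ε hpos
      -- Subintervals shorter than a Lebesgue number of the cover each lie in one ball, which bounds
      -- the search for a cover to finite data.
      obtain ⟨δ, hδ, hball⟩ := lebesgue_number_lemma_of_metric
        (c := fun x : Icc (0 : ℝ) 1 => Metric.ball (A x : ℝ) (R x)) isCompact_Icc
        (fun _ => Metric.isOpen_ball) fun x hx => mem_iUnion.2 ⟨⟨x, hx⟩, by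
          rw [Metric.mem_ball, Real.dist_eq]; exact hA x hx⟩
      obtain ⟨N, hN⟩ := exists_nat_one_div_lt hδ
      have hN' : (0 : ℝ) < ((N + 1 : ℕ) : ℝ) := by positivity
      have hw (i : ℕ) (hi : i < N + 1) : ∃ w, CoversPart w i (e, ratCode ε, N) := by
        have hi' : ((i + 1 : ℕ) : ℝ) ≤ ((N + 1 : ℕ) : ℝ) := by exact_mod_cast hi
        have hx : (i : ℝ) / ((N + 1 : ℕ) : ℝ) ∈ Icc (0 : ℝ) 1 := by
          refine ⟨by positivity, (div_le_one hN').2 (le_trans ?_ hi')⟩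
          push_cast; linarith
        obtain ⟨⟨x, hxI⟩, hsub⟩ := hball _ hx
        have h1 := hsub (Metric.mem_ball_self hδ)
        have h2 : ((i + 1 : ℕ) : ℝ) / ((N + 1 : ℕ) : ℝ) ∈ Metric.ball (A x : ℝ) (R x) := by
          refine hsub ?_
          rw [Metric.mem_ball, Real.dist_eq, ← sub_div, Nat.cast_add, add_sub_cancel_left,
            Nat.cast_one, abs_of_pos (by positivity)]
          push_cast
          exact hN
        rw [Metric.mem_ball, Real.dist_eq] at h1 h2
        obtain ⟨n, t, ht⟩ := (hrel x hxI).exists_accepts hΦ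
        refine ⟨(quintNum n (ratCode (A x)) (ratCode (R x)) (ratCode (B x)) (ratCode ε), t), ht, compS_quintNum .., ?_, ?_⟩
        · simp only [compA_quintNum, compR_quintNum, ratVal_ratCode]
          exact abs_div_sub_lt_iff.2 h1
        · simp only [compA_quintNum, compR_quintNum, ratVal_ratCode]
          exact abs_div_sub_lt_iff.2 h2
      choose! w hw using hw
      exact ⟨(N, (List.range (N + 1)).map w), fun _ _ i hi => ⟨w i, List.mem_map.2 ⟨i, hi, rfl⟩,
        hw i (List.mem_range.1 hi)⟩⟩
    · exact ⟨default, fun h1 h2 => absurd ⟨h1, h2⟩ hε⟩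

end KW

namespace KW

open Nat.Partrec (Code)
open Set

/-! ### Emptiness of the iterated derivatives -/

/-- `w` is an accepted quintuple, with its running time, that gives the value of the function at
`p` up to an error `η`. -/
def Approximates (e p η : ℕ) (w : ℕ × ℕ) : Prop :=
  Accepts w.2 e w.1 ∧ compS w.1 = η ∧ |ratVal p - ratVal (compA w.1)| < ratVal (compR w.1)

/-- `p` is a point of `[0, 1]` at distance less than `δ` from `y`. -/
def IsNear (y δ p : ℕ) : Prop :=
  0 ≤ ratVal p ∧ ratVal p ≤ 1 ∧ |ratVal p - ratVal y| < ratVal δ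

/-- The slope between `p` and `q` of the function with approximate values `w` and `w'`. -/
def approxSlope (p q : ℕ) (w w' : ℕ × ℕ) : ℚ :=
  (ratVal (compB w.1) - ratVal (compB w'.1)) / (ratVal p - ratVal q)

/-- The points `p < q` and `r < s` are at distance less than `δ` from a point `y` of `[a, b]`, and
the slopes of the function with number `e` between `p` and `q` and between `r` and `s` are seen to
differ by more than `ε`. -/
def IsWitness (e ε a b δ p q r s y η : ℕ) (w₁ w₂ w₃ w₄ : ℕ × ℕ) : Prop :=
  (ratVal p < ratVal q ∧ ratVal r < ratVal s) ∧
  (IsNear y δ p ∧ IsNear y δ q ∧ IsNear y δ r ∧ IsNear y δ s) ∧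
  (ratVal a ≤ ratVal y ∧ ratVal y ≤ ratVal b) ∧
  (Approximates e p η w₁ ∧ Approximates e q η w₂ ∧ Approximates e r η w₃ ∧
    Approximates e s η w₄) ∧
  ratVal ε + ((ratVal η + ratVal η) / (ratVal q - ratVal p) +
    (ratVal η + ratVal η) / (ratVal s - ratVal r)) <
      |approxSlope p q w₁ w₂ - approxSlope r s w₃ w₄|

section Primrec

variable {α : Type*} [Primcodable α]

theorem primrecPred_approximates {e p η : α → ℕ} {w : α → ℕ × ℕ} (he : Primrec e) (hp : Primrec p)
    (hη : Primrec η) (hw : Primrec w) :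
    PrimrecPred fun z => Approximates (e z) (p z) (η z) (w z) := by
  have hk : Primrec fun z => (w z).1 := Primrec.fst.comp hw
  exact (primrecPred_accepts (Primrec.snd.comp hw) he hk).and
    ((Primrec.eq.comp (primrec_compS hk) hη).and (PrimrecRat.lt
      (.abs (.sub (.ratVal hp) (.ratVal (primrec_compA hk)))) (.ratVal (primrec_compR hk))))

theorem primrecPred_isNear {y δ p : α → ℕ} (hy : Primrec y) (hδ : Primrec δ) (hp : Primrec p) :
    PrimrecPred fun z => IsNear (y z) (δ z) (p z) :=
  (PrimrecRat.zero.le (.ratVal hp)).and ((PrimrecRat.le (.ratVal hp) .one).and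
    (PrimrecRat.lt (.abs (.sub (.ratVal hp) (.ratVal hy))) (.ratVal hδ)))

theorem primrecRat_approxSlope {p q : α → ℕ} {w w' : α → ℕ × ℕ} (hp : Primrec p) (hq : Primrec q)
    (hw : Primrec w) (hw' : Primrec w') :
    PrimrecRat fun z => approxSlope (p z) (q z) (w z) (w' z) :=
  .div (.sub (.ratVal (primrec_compB (Primrec.fst.comp hw)))
    (.ratVal (primrec_compB (Primrec.fst.comp hw')))) (.sub (.ratVal hp) (.ratVal hq))

theorem primrecPred_isWitness {e ε a b δ p q r s y η : α → ℕ} {w₁ w₂ w₃ w₄ : α → ℕ × ℕ}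
    (he : Primrec e) (hε : Primrec ε) (ha : Primrec a) (hb : Primrec b) (hδ : Primrec δ)
    (hp : Primrec p) (hq : Primrec q) (hr : Primrec r) (hs : Primrec s) (hy : Primrec y)
    (hη : Primrec η) (hw₁ : Primrec w₁) (hw₂ : Primrec w₂) (hw₃ : Primrec w₃)
    (hw₄ : Primrec w₄) :
    PrimrecPred fun z => IsWitness (e z) (ε z) (a z) (b z) (δ z) (p z) (q z) (r z) (s z) (y z) (η z)
      (w₁ z) (w₂ z) (w₃ z) (w₄ z) := by
  have hη2 : PrimrecRat fun z => ratVal (η z) + ratVal (η z) := .add (.ratVal hη) (.ratVal hη)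
  refine .and (.and (PrimrecRat.lt (.ratVal hp) (.ratVal hq))
    (PrimrecRat.lt (.ratVal hr) (.ratVal hs))) (.and ?_ (.and ?_ (.and ?_ ?_)))
  · exact .and (primrecPred_isNear hy hδ hp) (.and (primrecPred_isNear hy hδ hq)
      (.and (primrecPred_isNear hy hδ hr) (primrecPred_isNear hy hδ hs)))
  · exact .and (PrimrecRat.le (.ratVal ha) (.ratVal hy)) (PrimrecRat.le (.ratVal hy) (.ratVal hb))
  · exact .and (primrecPred_approximates he hp hη hw₁) (.and (primrecPred_approximates he hq hη hw₂)
      (.and (primrecPred_approximates he hr hη hw₃) (primrecPred_approximates he hs hη hw₄)))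
  · exact PrimrecRat.lt (.add (.ratVal hε) (.add (.div hη2 (.sub (.ratVal hq) (.ratVal hp)))
      (.div hη2 (.sub (.ratVal hs) (.ratVal hr)))))
      (.abs (.sub (primrecRat_approxSlope hp hq hw₁ hw₂) (primrecRat_approxSlope hr hs hw₃ hw₄)))

end Primrec

section Encodes

variable {Φ : Set (ℕ × ℚ × ℚ × ℚ × ℚ)} {e : ℕ} {f : ℝ → ℝ}

theorem Approximates.abs_sub_le (hΦ : Computes e (quintCode '' Φ)) (hf : IsCodeOf Φ f)
    {p η : ℕ} {w : ℕ × ℕ} (h : Approximates e p η w) (h0 : 0 ≤ ratVal p) (h1 : ratVal p ≤ 1) :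
    |f (ratVal p) - ratVal (compB w.1)| ≤ ratVal η := by
  obtain ⟨hacc, hS, hlt⟩ := h
  obtain ⟨a, r, b, s, hR, hA', hR', hB', hS'⟩ := hacc.exists_rel hΦ
  rw [hA', hR', ratVal_ratCode, ratVal_ratCode] at hlt
  rw [← hS, hS', hB', ratVal_ratCode, ratVal_ratCode]
  exact hf.value a r b s hR _ ⟨by exact_mod_cast h0, by exact_mod_cast h1⟩ (by exact_mod_cast hlt)

theorem exists_approximates (hΦ : Computes e (quintCode '' Φ)) (hf : IsCodeOf Φ f) {p η : ℚ}
    (hp : (p : ℝ) ∈ Icc (0 : ℝ) 1) (hη : 0 < η) :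
    ∃ w, Approximates e (ratCode p) (ratCode η) w := by
  obtain ⟨a, r, b, hlt, hR⟩ := hf.total p hp η hη
  obtain ⟨n, t, ht⟩ := hR.exists_accepts hΦ
  refine ⟨(quintNum n (ratCode a) (ratCode r) (ratCode b) (ratCode η), t), ht, compS_quintNum _ _ _ _ _, ?_⟩
  rw [compA_quintNum, compR_quintNum, ratVal_ratCode, ratVal_ratCode, ratVal_ratCode]
  exact_mod_cast hlt

theorem abs_secant_sub_approxSlope_le (hΦ : Computes e (quintCode '' Φ)) (hf : IsCodeOf Φ f)
    {p q η : ℕ} {w w' : ℕ × ℕ} (hp : Approximates e p η w) (hq : Approximates e q η w')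
    (hp0 : 0 ≤ ratVal p) (hq1 : ratVal q ≤ 1) (hpq : ratVal p < ratVal q) :
    |secant f (ratVal p) (ratVal q) - approxSlope p q w w'| ≤
      (ratVal η + ratVal η) / (ratVal q - ratVal p) := by
  have h1 := hp.abs_sub_le hΦ hf hp0 (hpq.le.trans hq1)
  have h2 := hq.abs_sub_le hΦ hf (hp0.trans hpq.le) hq1
  have hpos : (0 : ℝ) < ratVal q - ratVal p := sub_pos.2 (by exact_mod_cast hpq)
  rw [approxSlope, secant]
  push_cast
  rw [← sub_div, abs_div, ← neg_sub (ratVal q : ℝ), abs_neg, abs_of_pos hpos]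
  gcongr
  rw [abs_le] at *
  constructor <;> linarith [h1.1, h1.2, h2.1, h2.2]

/-- The two quotients by interval lengths in `IsWitness` are exactly the error bounds of the
approximate slopes. -/
theorem IsWitness.lt_abs_sub (hΦ : Computes e (quintCode '' Φ)) (hf : IsCodeOf Φ f)
    {ε a b δ p q r s y η : ℕ} {w₁ w₂ w₃ w₄ : ℕ × ℕ}
    (h : IsWitness e ε a b δ p q r s y η w₁ w₂ w₃ w₄) :
    (ratVal ε : ℝ) < |secant f (ratVal p) (ratVal q) - secant f (ratVal r) (ratVal s)| := by
  obtain ⟨⟨hpq, hrs⟩, ⟨hp, hq, hr, hs⟩, -, ⟨h1, h2, h3, h4⟩, hlt⟩ := h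
  have h5 := abs_secant_sub_approxSlope_le hΦ hf h1 h2 hp.1 hq.2.1 hpq
  have h6 := abs_secant_sub_approxSlope_le hΦ hf h3 h4 hr.1 hs.2.1 hrs
  have hlt' : (ratVal ε : ℝ) + ((ratVal η + ratVal η) / (ratVal q - ratVal p) +
      (ratVal η + ratVal η) / (ratVal s - ratVal r)) <
        |(approxSlope p q w₁ w₂ : ℝ) - approxSlope r s w₃ w₄| := by exact_mod_cast hlt
  have h7 := abs_sub_abs_le_abs_sub ((approxSlope p q w₁ w₂ : ℝ) - approxSlope r s w₃ w₄)
    (secant f (ratVal p) (ratVal q) - secant f (ratVal r) (ratVal s))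
  have h8 : |(approxSlope p q w₁ w₂ : ℝ) - approxSlope r s w₃ w₄ -
      (secant f (ratVal p) (ratVal q) - secant f (ratVal r) (ratVal s))| ≤
      |secant f (ratVal p) (ratVal q) - approxSlope p q w₁ w₂| +
        |secant f (ratVal r) (ratVal s) - approxSlope r s w₃ w₄| := by
    rw [show (approxSlope p q w₁ w₂ : ℝ) - approxSlope r s w₃ w₄ -
      (secant f (ratVal p) (ratVal q) - secant f (ratVal r) (ratVal s)) =
      (secant f (ratVal r) (ratVal s) - approxSlope r s w₃ w₄) -
      (secant f (ratVal p) (ratVal q) - approxSlope p q w₁ w₂) by ring, add_comm]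
    exact abs_sub _ _
  linarith

/-- A strict inequality between slopes is recognised from sufficiently good approximations. -/
theorem exists_isWitness (hΦ : Computes e (quintCode '' Φ)) (hf : IsCodeOf Φ f) {ε a b δ : ℕ}
    {p q r s y : ℚ} (hpq : p < q) (hrs : r < s)
    (hu : ∀ u ∈ ({p, q, r, s} : Set ℚ), (u : ℝ) ∈ Icc (0 : ℝ) 1 ∧ |(u : ℝ) - y| < ratVal δ)
    (ha : ratVal a ≤ y) (hb : y ≤ ratVal b)
    (h : (ratVal ε : ℝ) < |secant f p q - secant f r s|) :
    ∃ η w₁ w₂ w₃ w₄, IsWitness e ε a b δ (ratCode p) (ratCode q) (ratCode r) (ratCode s)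
      (ratCode y) η w₁ w₂ w₃ w₄ := by
  have hpq' : (0 : ℝ) < q - p := sub_pos.2 (by exact_mod_cast hpq)
  have hrs' : (0 : ℝ) < s - r := sub_pos.2 (by exact_mod_cast hrs)
  -- The slope error is counted twice, once in the definition of a witness and once in passing from
  -- true to approximate slopes. Each time it is `2η (1/(q-p) + 1/(s-r))`, whence the factor `4`.
  obtain ⟨η, hη0, hη⟩ := exists_rat_btwn (show
    (0 : ℝ) < (|secant f p q - secant f r s| - ratVal ε) / (4 * (1 / (q - p) + 1 / (s - r))) from
      div_pos (sub_pos.2 h) (by positivity))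
  rw [lt_div_iff₀ (by positivity)] at hη
  have hη0' : 0 < η := by exact_mod_cast hη0
  obtain ⟨hp, hpy⟩ := hu p (by simp)
  obtain ⟨hq, hqy⟩ := hu q (by simp)
  obtain ⟨hr, hry⟩ := hu r (by simp)
  obtain ⟨hs, hsy⟩ := hu s (by simp)
  obtain ⟨w₁, h1⟩ := exists_approximates hΦ hf hp hη0'
  obtain ⟨w₂, h2⟩ := exists_approximates hΦ hf hq hη0'
  obtain ⟨w₃, h3⟩ := exists_approximates hΦ hf hr hη0'
  obtain ⟨w₄, h4⟩ := exists_approximates hΦ hf hs hη0'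
  have hnear {u : ℚ} (hu : (u : ℝ) ∈ Icc (0 : ℝ) 1) (huy : |(u : ℝ) - y| < ratVal δ) :
      IsNear (ratCode y) δ (ratCode u) := by
    rw [IsNear, ratVal_ratCode, ratVal_ratCode]
    exact ⟨by exact_mod_cast hu.1, by exact_mod_cast hu.2, by exact_mod_cast huy⟩
  refine ⟨ratCode η, w₁, w₂, w₃, w₄, ?_, ⟨hnear hp hpy, hnear hq hqy, hnear hr hry, hnear hs hsy⟩,
    ?_, ⟨h1, h2, h3, h4⟩, ?_⟩
  · simpa only [ratVal_ratCode] using ⟨hpq, hrs⟩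
  · simpa only [ratVal_ratCode] using ⟨ha, hb⟩
  · have h5 := abs_secant_sub_approxSlope_le hΦ hf h1 h2 (hnear hp hpy).1 (hnear hq hqy).2.1
      (by simpa only [ratVal_ratCode] using hpq)
    have h6 := abs_secant_sub_approxSlope_le hΦ hf h3 h4 (hnear hr hry).1 (hnear hs hsy).2.1
      (by simpa only [ratVal_ratCode] using hrs)
    simp only [ratVal_ratCode] at h5 h6 ⊢
    have h7 := abs_sub_abs_le_abs_sub (secant f p q - secant f r s)
      ((approxSlope (ratCode p) (ratCode q) w₁ w₂ : ℝ) - approxSlope (ratCode r) (ratCode s) w₃ w₄)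
    have h8 : |secant f p q - secant f r s - ((approxSlope (ratCode p) (ratCode q) w₁ w₂ : ℝ) -
        approxSlope (ratCode r) (ratCode s) w₃ w₄)| ≤
        |secant f p q - approxSlope (ratCode p) (ratCode q) w₁ w₂| +
          |secant f r s - approxSlope (ratCode r) (ratCode s) w₃ w₄| := by
      rw [sub_sub_sub_comm]
      exact abs_sub _ _
    have h9 : (η : ℝ) * (4 * (1 / (q - p) + 1 / (s - r))) =
        2 * ((η + η) / (q - p) + (η + η) / (s - r)) := by ring
    have : (ratVal ε : ℝ) + ((η + η) / (q - p) + (η + η) / (s - r)) <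
        |(approxSlope (ratCode p) (ratCode q) w₁ w₂ : ℝ) -
          approxSlope (ratCode r) (ratCode s) w₃ w₄| := by linarith
    exact_mod_cast this

end Encodes

/-- The number of the larger of two rationals. -/
def maxCode (p q : ℕ) : ℕ := if ratVal p < ratVal q then q else p

/-- The number of the smaller of two rationals. -/
def minCode (p q : ℕ) : ℕ := if ratVal p < ratVal q then p else q

theorem ratVal_maxCode (p q : ℕ) : ratVal (maxCode p q) = max (ratVal p) (ratVal q) := by
  rw [maxCode]
  split_ifs with h
  · rw [max_eq_right h.le]
  · rw [max_eq_left (not_lt.1 h)]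

theorem ratVal_minCode (p q : ℕ) : ratVal (minCode p q) = min (ratVal p) (ratVal q) := by
  rw [minCode]
  split_ifs with h
  · rw [min_eq_left h.le]
  · rw [min_eq_right (not_lt.1 h)]

/-- The candidates for a witness: points `p`, `q`, `r`, `s`, a point `y` and an error `η`, and four
approximate values. -/
abbrev Candidate : Type :=
  (ℕ × ℕ × ℕ × ℕ) × (ℕ × ℕ) × (ℕ × ℕ) × (ℕ × ℕ) × (ℕ × ℕ) × (ℕ × ℕ)

/-- `IsWitness` for a candidate. -/
def Candidate.IsWitness (e ε a b δ : ℕ) (v : Candidate) : Prop :=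
  KW.IsWitness e ε a b δ v.1.1 v.1.2.1 v.1.2.2.1 v.1.2.2.2 v.2.1.1 v.2.1.2 v.2.2.1 v.2.2.2.1
    v.2.2.2.2.1 v.2.2.2.2.2

/-- The candidate with a given number. -/
def toCandidate (v : ℕ) : Candidate := (Encodable.decode v : Option Candidate).getD default

/-- The statements about which a derivation proceeds. The quintuple `(0, e, ε, a, b)` stands for
`[a, b] ∩ P^γ_{f,ε} = ∅`, where `f` is given by `e`; the quintuple `(1, e, m, _, _)` stands for
`∃ u, D (e, m, u)`; the others are false. -/
abbrev Claim : Type := ℕ × ℕ × ℕ × ℕ × ℕ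

/-- The claim about an empty interval. -/
def trueClaim : Claim := (0, 0, 0, Nat.pair 2 1, Nat.pair 0 1)

/-- A false claim. -/
def falseClaim : Claim := (2, 0, 0, 0, 0)

/-- The claims that are true before any iteration. -/
def BaseClaim (x : Claim) : Prop := x.1 = 0 ∧ ratVal x.2.2.2.2 < ratVal x.2.2.2.1

variable (D : ℕ × ℕ × ℕ → Prop)

open Classical in
/-- The premises of a claim. -/
noncomputable def nextClaim (x : Claim) (u v : ℕ) : Claim :=
  if x.1 = 0 then
    if 0 < ratVal u then
      if (toCandidate v).IsWitness x.2.1 x.2.2.1 x.2.2.2.1 x.2.2.2.2 u then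
        (0, x.2.1, x.2.2.1, maxCode (toCandidate v).1.1 (toCandidate v).1.2.2.1,
          minCode (toCandidate v).1.2.1 (toCandidate v).1.2.2.2)
      else trueClaim
    else falseClaim
  else if x.1 = 1 ∧ D (x.2.1, x.2.2.1, u) then trueClaim else falseClaim

/-- The claims that have to be verified for `e`. -/
def initClaim (e m : ℕ) : Claim :=
  if m % 2 = 0 then (1, e, m / 2, 0, 0)
  else (0, e, Nat.pair 2 (m / 2 + 1), Nat.pair 0 1, Nat.pair 2 1)

theorem primrecPred_baseClaim : PrimrecPred BaseClaim :=
  .and (Primrec.eq.comp .fst (.const 0)) (PrimrecRat.lt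
    (.ratVal (Primrec.snd.comp (Primrec.snd.comp (Primrec.snd.comp .snd))))
    (.ratVal (Primrec.fst.comp (Primrec.snd.comp (Primrec.snd.comp .snd)))))

theorem primrec_initClaim : Primrec₂ initClaim := by
  have hm : Primrec fun p : ℕ × ℕ => p.2 / 2 := Primrec.nat_div.comp .snd (.const 2)
  exact Primrec.ite (Primrec.eq.comp (Primrec.nat_mod.comp .snd (.const 2)) (.const 0))
    ((Primrec.const 1).pair (Primrec.fst.pair (hm.pair (.const (0, 0)))))
    ((Primrec.const 0).pair (Primrec.fst.pair ((Primrec₂.natPair.comp (.const 2)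
      (Primrec.succ.comp hm)).pair (.const (Nat.pair 0 1, Nat.pair 2 1)))))

theorem primrec_ite_ratVal_lt {α : Type*} [Primcodable α] {p q i j : α → ℕ} (hp : Primrec p)
    (hq : Primrec q) (hi : Primrec i) (hj : Primrec j) :
    Primrec fun z => if ratVal (p z) < ratVal (q z) then i z else j z :=
  Primrec.ite (PrimrecRat.lt (.ratVal hp) (.ratVal hq)) hi hj

variable {D}

theorem primrec_nextClaim (hD : PrimrecPred D) :
    Primrec fun z : Claim × ℕ × ℕ => nextClaim D z.1 z.2.1 z.2.2 := by
  have hv : Primrec fun z : Claim × ℕ × ℕ => toCandidate z.2.2 :=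
    (primrec_decode_getD Candidate).comp (Primrec.snd.comp .snd)
  have hu : Primrec fun z : Claim × ℕ × ℕ => z.2.1 := Primrec.fst.comp .snd
  have ht : Primrec fun z : Claim × ℕ × ℕ => z.1.1 := Primrec.fst.comp .fst
  have hx1 : Primrec fun z : Claim × ℕ × ℕ => z.1.2 := Primrec.snd.comp .fst
  have he : Primrec fun z : Claim × ℕ × ℕ => z.1.2.1 := Primrec.fst.comp hx1
  have hx2 : Primrec fun z : Claim × ℕ × ℕ => z.1.2.2 := Primrec.snd.comp hx1
  have hε : Primrec fun z : Claim × ℕ × ℕ => z.1.2.2.1 := Primrec.fst.comp hx2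
  have hx3 : Primrec fun z : Claim × ℕ × ℕ => z.1.2.2.2 := Primrec.snd.comp hx2
  have hv1 : Primrec fun z : Claim × ℕ × ℕ => (toCandidate z.2.2).1 := Primrec.fst.comp hv
  have hv2 : Primrec fun z : Claim × ℕ × ℕ => (toCandidate z.2.2).2 := Primrec.snd.comp hv
  have hp : Primrec fun z : Claim × ℕ × ℕ => (toCandidate z.2.2).1.1 := Primrec.fst.comp hv1
  have hv3 : Primrec fun z : Claim × ℕ × ℕ => (toCandidate z.2.2).1.2 := Primrec.snd.comp hv1
  have hq : Primrec fun z : Claim × ℕ × ℕ => (toCandidate z.2.2).1.2.1 := Primrec.fst.comp hv3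
  have hv4 : Primrec fun z : Claim × ℕ × ℕ => (toCandidate z.2.2).1.2.2 := Primrec.snd.comp hv3
  have hr : Primrec fun z : Claim × ℕ × ℕ => (toCandidate z.2.2).1.2.2.1 := Primrec.fst.comp hv4
  have hs : Primrec fun z : Claim × ℕ × ℕ => (toCandidate z.2.2).1.2.2.2 := Primrec.snd.comp hv4
  have hv5 : Primrec fun z : Claim × ℕ × ℕ => (toCandidate z.2.2).2.1 := Primrec.fst.comp hv2
  have hv6 : Primrec fun z : Claim × ℕ × ℕ => (toCandidate z.2.2).2.2 := Primrec.snd.comp hv2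
  have hv7 : Primrec fun z : Claim × ℕ × ℕ => (toCandidate z.2.2).2.2.2 := Primrec.snd.comp hv6
  have hv8 : Primrec fun z : Claim × ℕ × ℕ => (toCandidate z.2.2).2.2.2.2 := Primrec.snd.comp hv7
  have hW : PrimrecPred fun z : Claim × ℕ × ℕ =>
      (toCandidate z.2.2).IsWitness z.1.2.1 z.1.2.2.1 z.1.2.2.2.1 z.1.2.2.2.2 z.2.1 :=
    primrecPred_isWitness he hε (Primrec.fst.comp hx3) (Primrec.snd.comp hx3) hu hp hq hr hs
      (Primrec.fst.comp hv5) (Primrec.snd.comp hv5) (Primrec.fst.comp hv6) (Primrec.fst.comp hv7)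
      (Primrec.fst.comp hv8) (Primrec.snd.comp hv8)
  classical
  refine Primrec.ite (Primrec.eq.comp ht (.const 0)) (Primrec.ite (PrimrecRat.zero.lt (.ratVal hu))
    (Primrec.ite hW ?_ (.const _)) (.const _)) (Primrec.ite (.and (Primrec.eq.comp ht (.const 1))
      (hD.comp (he.pair (hε.pair hu)))) (.const _) (.const _))
  exact (Primrec.const 0).pair (he.pair (hε.pair ((primrec_ite_ratVal_lt hp hr hr hp).pair
    (primrec_ite_ratVal_lt hq hs hq hs))))

theorem baseClaim_trueClaim : BaseClaim trueClaim := by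
  simp [BaseClaim, trueClaim, ratVal_pair_one, ratVal_pair_zero]

/-- An empty interval contains no point `y`, so it has no witnesses and all its premises are
trivial. Any positive `u` works; this one is `1`. -/
theorem exists_baseClaim_nextClaim (x : Claim) (hx : BaseClaim x) :
    ∃ u, ∀ v, BaseClaim (nextClaim D x u v) := by
  refine ⟨Nat.pair 2 1, fun v => ?_⟩
  rw [nextClaim, if_pos hx.1, if_pos (by simp [ratVal_pair_one]), if_neg]
  · exact baseClaim_trueClaim
  · intro h
    exact absurd (h.2.2.1.1.trans h.2.2.1.2) hx.2.not_ge

/-- All premises of a false claim are false claims again, and stages decrease. -/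
theorem not_derivable_falseClaim (γ : Ordinal.{0}) :
    ¬ Derivable BaseClaim (nextClaim D) γ falseClaim := by
  induction γ using WellFoundedLT.induction with
  | _ γ ih =>
    rintro (⟨h, -⟩ | ⟨u, hβ, h⟩)
    · simp [falseClaim] at h
    · have := h 0
      simp only [nextClaim, falseClaim, OfNat.ofNat_ne_zero, if_false, OfNat.ofNat_ne_one,
        false_and] at this
      exact ih _ hβ this

/-- One step suffices: the right `u` makes every premise trivial, a wrong one makes them false. -/
theorem derivable_index_iff {γ : Ordinal.{0}} (hγ : 0 < γ) (e m a b : ℕ) :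
    Derivable BaseClaim (nextClaim D) γ (1, e, m, a, b) ↔ ∃ u, D (e, m, u) := by
  constructor
  · rintro (⟨h, -⟩ | ⟨u, hβ, h⟩)
    · simp at h
    · refine ⟨u, ?_⟩
      by_contra hD
      have := h 0
      simp only [nextClaim, one_ne_zero, if_false, hD, and_false] at this
      exact not_derivable_falseClaim _ this
  · rintro ⟨u, hu⟩
    refine .step u hγ fun v => .base ?_
    simp only [nextClaim, one_ne_zero, if_false, hu, and_self, if_true]
    exact baseClaim_trueClaim

theorem exists_rat_mem_Icc {a b : ℚ} {z δ : ℝ} (hz : z ∈ Icc (a : ℝ) b) (hδ : 0 < δ) :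
    ∃ y : ℚ, a ≤ y ∧ y ≤ b ∧ |z - y| < δ := by
  rcases hz.1.eq_or_lt with rfl | h0
  · exact ⟨a, le_rfl, by exact_mod_cast hz.2, by simpa using hδ⟩
  · obtain ⟨y, h1, h2⟩ := exists_rat_btwn (max_lt h0 (sub_lt_self z hδ))
    have h3 := (le_max_left _ _).trans h1.le
    have h4 := h2.le.trans hz.2
    refine ⟨y, by exact_mod_cast h3, by exact_mod_cast h4, ?_⟩
    rw [abs_lt]
    constructor <;> linarith [(le_max_right _ _).trans_lt h1]

variable {Φ : Set (ℕ × ℚ × ℚ × ℚ × ℚ)} {e : ℕ} {f : ℝ → ℝ}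

/-- A derived claim is true. -/
theorem Derivable.inter_kwIter_eq_empty (hΦ : Computes e (quintCode '' Φ)) (hf : IsCodeOf Φ f)
    {γ : Ordinal.{0}} {x : Claim} (h : Derivable BaseClaim (nextClaim D) γ x) (hx : x.1 = 0)
    (he : x.2.1 = e) {ε : ℝ} (hε : (ratVal x.2.2.1 : ℝ) < ε) :
    Icc (ratVal x.2.2.2.1 : ℝ) (ratVal x.2.2.2.2) ∩ kwIter f ε γ = ∅ := by
  induction h with
  | base h => rw [Icc_eq_empty (not_le.2 (by exact_mod_cast h.2)), empty_inter]
  | @step γ β x u hβ hnext ih =>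
    obtain ⟨t, e', ε', a, b⟩ := x
    obtain rfl : t = 0 := hx
    obtain rfl : e' = e := he
    have hu : 0 < ratVal u := by
      by_contra hu
      have := hnext 0
      simp only [nextClaim, if_true, hu, if_false] at this
      exact not_derivable_falseClaim _ this
    have hu' : (0 : ℝ) < ratVal u := by exact_mod_cast hu
    refine eq_empty_iff_forall_notMem.2 fun z ⟨hz, hzP⟩ => ?_
    -- The surviving point `z` may be irrational. Half of the radius is reserved for replacing it by
    -- a rational `y` in `[a, b]`.
    obtain ⟨p, q, r, s, hpq, hrs, hmem, hne, hosc⟩ :=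
      (mem_kwDeriv_iff.1 (kwIter_subset_kwDeriv hβ hzP)).2 (ratVal u / 2) (by positivity)
    obtain ⟨y, hay, hyb, hy⟩ := exists_rat_mem_Icc hz (half_pos hu')
    obtain ⟨η, w₁, w₂, w₃, w₄, hw⟩ := exists_isWitness (δ := u) hΦ hf hpq hrs (fun i hi => by
      refine ⟨(hmem i hi).2, ?_⟩
      have h1 := (hmem i hi).1
      rw [Metric.mem_ball, Real.dist_eq] at h1
      linarith [_root_.abs_sub_le (i : ℝ) z y]) hay hyb (hε.trans_le hosc)
    let c : Candidate := ((ratCode p, ratCode q, ratCode r, ratCode s), (ratCode y, η), w₁, w₂, w₃, w₄)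
    have hc : toCandidate (Encodable.encode c) = c := by
      rw [toCandidate, Encodable.encodek, Option.getD_some]
    have hcw : Candidate.IsWitness e' ε' a b u c := hw
    have hn : nextClaim D (0, e', ε', a, b) u (Encodable.encode c) =
        (0, e', ε', maxCode (ratCode p) (ratCode r), minCode (ratCode q) (ratCode s)) := by
      simp only [nextClaim, if_true, hu, hc, hcw]
      rfl
    have := ih (Encodable.encode c) (by rw [hn]) (by rw [hn]) (by rw [hn]; exact hε)
    rw [hn] at this
    simp only [ratVal_maxCode, ratVal_minCode, ratVal_ratCode, Rat.cast_max, Rat.cast_min] at this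
    -- The premise for this witness denies the very point in which both intervals meet the previous
    -- set.
    rw [Icc_inter_Icc] at hne
    exact hne.ne_empty this

/-- A true claim can be derived. -/
theorem derivable_of_inter_kwIter_eq_empty (hΦ : Computes e (quintCode '' Φ))
    (hf : IsCodeOf Φ f) {γ : Ordinal.{0}} {ε a b : ℕ} (ha : 0 ≤ ratVal a) (hb : ratVal b ≤ 1)
    (h : Icc (ratVal a : ℝ) (ratVal b) ∩ kwIter f (ratVal ε) γ = ∅) :
    Derivable BaseClaim (nextClaim D) γ (0, e, ε, a, b) := by
  have ha' : (0 : ℝ) ≤ ratVal a := by exact_mod_cast ha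
  have hb' : (ratVal b : ℝ) ≤ 1 := by exact_mod_cast hb
  induction γ using Ordinal.limitRecOn generalizing a b with
  | zero =>
    refine .base ⟨rfl, ?_⟩
    by_contra! hab
    have hab' : (ratVal a : ℝ) ≤ ratVal b := by exact_mod_cast hab
    refine notMem_empty (ratVal a : ℝ) (h ▸ ⟨⟨le_rfl, hab'⟩, ?_⟩)
    rw [kwIter_zero]
    exact ⟨ha', hab'.trans hb'⟩
  | add_one γ ih =>
    rw [kwIter_add_one] at h
    -- Compactness supplies the single `δ` that serves as `u`.
    obtain ⟨δ, hδ, hosc⟩ := exists_forall_not_oscillates isCompact_Icc (isClosed_kwIter γ) h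
    refine .step (ratCode δ) (Order.lt_add_one_iff.2 le_rfl) fun v => ?_
    simp only [nextClaim, if_true, ratVal_ratCode, hδ]
    split_ifs with hw
    · have hw' := hw
      obtain ⟨⟨hpq, hrs⟩, ⟨hp, hq, hr, hs⟩, ⟨hay, hyb⟩, -, -⟩ := hw
      have hmax : 0 ≤ ratVal (maxCode (toCandidate v).1.1 (toCandidate v).1.2.2.1) := by
        rw [ratVal_maxCode]
        exact le_max_of_le_left hp.1
      have hmin : ratVal (minCode (toCandidate v).1.2.1 (toCandidate v).1.2.2.2) ≤ 1 := by
        rw [ratVal_minCode]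
        exact min_le_of_left_le hq.2.1
      refine ih hmax hmin ?_ (by exact_mod_cast hmax) (by exact_mod_cast hmin)
      by_contra hne
      rw [← ne_eq, ← nonempty_iff_ne_empty, ratVal_maxCode, ratVal_minCode, Rat.cast_max,
        Rat.cast_min, ← Icc_inter_Icc] at hne
      refine hosc (ratVal (toCandidate v).2.1.1) ⟨by exact_mod_cast hay, by exact_mod_cast hyb⟩
        ⟨_, _, _, _, hpq, hrs, ?_, hne, (IsWitness.lt_abs_sub hΦ hf hw').le⟩
      have key (i : ℕ) (hi : IsNear (toCandidate v).2.1.1 (ratCode δ) i) :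
          (ratVal i : ℝ) ∈ Metric.ball (ratVal (toCandidate v).2.1.1 : ℝ) δ ∩ Icc 0 1 := by
        obtain ⟨h0, h1, h2⟩ := hi
        rw [ratVal_ratCode] at h2
        refine ⟨?_, by exact_mod_cast h0, by exact_mod_cast h1⟩
        rw [Metric.mem_ball, Real.dist_eq]
        exact_mod_cast h2
      rintro i (rfl | rfl | rfl | rfl)
      exacts [key _ hp, key _ hq, key _ hr, key _ hs]
    · exact .base baseClaim_trueClaim
  | limit l hl ih =>
    rw [kwIter_limit hl, ← iInter_subtype (fun β => β < l) fun β => kwIter f (ratVal ε) β] at h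
    have : Nonempty {β // β < l} := ⟨0, hl.bot_lt⟩
    -- A decreasing family of closed sets with empty intersection on a compact interval is empty
    -- there from some stage `β` on.
    obtain ⟨⟨β, hβ⟩, hemp⟩ := isCompact_Icc.elim_directed_family_closed _
      (fun β : {β // β < l} => isClosed_kwIter β.1) h
      (Antitone.directed_ge fun β β' hle => kwIter_antitone hle)
    exact (ih β hβ ha hb hemp ha' hb').mono hβ.le

/-- Even `m` verify that `e` is an index, odd `m` that the derivatives over `[0,1]` vanish at `ε =
1/(m/2 + 1)`. The loss of precision in `Derivable.inter_kwIter_eq_empty` is absorbed by taking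
`1/(m+1)` below the given `ε`. -/
theorem mem_DSet_iff (hD : ∀ e, IsIndex e ↔ ∀ m, ∃ u, D (e, m, u)) {α : Ordinal.{0}} (hα : 0 < α)
    (e : ℕ) :
    e ∈ DSet (α + 1) ↔ ∀ m, Derivable BaseClaim (nextClaim D) α (initClaim e m) := by
  have hodd (m : ℕ) : (2 * m + 1) % 2 ≠ 0 ∧ (2 * m + 1) / 2 = m := by omega
  constructor
  · rintro ⟨f, -, ⟨Φ, hΦ, hf⟩, -, hrank⟩ m
    have hidx := (hD e).1 (Encodes.isIndex ⟨Φ, hΦ, hf⟩)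
    rw [initClaim]
    split_ifs with hm
    · exact (derivable_index_iff hα _ _ _ _).2 (hidx _)
    · refine derivable_of_inter_kwIter_eq_empty hΦ hf (by simp [ratVal_pair_zero])
        (by simp [ratVal_pair_one]) ?_
      rw [kwRank_lt_add_one_iff.1 hrank, inter_empty]
      rw [ratVal_pair_one]
      push_cast
      positivity
  · intro h
    obtain ⟨f, hfe⟩ := IsIndex.exists_encodes ((hD e).2 fun m => by
      have := h (2 * m)
      rw [initClaim, if_pos (by omega), Nat.mul_div_cancel_left _ two_pos] at this
      exact (derivable_index_iff hα _ _ _ _).1 this)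
    obtain ⟨Φ, hΦ, hf⟩ := id hfe
    have hemp : ∀ ε > 0, kwIter f ε α = ∅ := by
      intro ε hε
      obtain ⟨m, hm⟩ := exists_nat_one_div_lt hε
      have := h (2 * m + 1)
      rw [initClaim, if_neg (hodd m).1, (hodd m).2] at this
      have := this.inter_kwIter_eq_empty hΦ hf rfl rfl (ε := ε)
        (by rw [ratVal_pair_one]; push_cast; exact hm)
      simp only [ratVal_pair_one, ratVal_pair_zero] at this
      have hsub : kwIter f ε α ⊆ Icc 0 1 := by
        rw [← kwIter_zero (f := f) (ε := ε)]
        exact kwIter_antitone hα.le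
      rwa [inter_eq_right.2 (by simpa using hsub)] at this
    exact ⟨f, hf.continuousOn, hfe, differentiableOn_of_kwIter_eq_empty hf.continuousOn hemp,
      kwRank_lt_add_one_iff.2 hemp⟩

end KW

/-- `D_{α+1}` is `Π_{2α+1}`, uniformly in the constructive ordinal `α > 0`: there is one computable
procedure `t` that turns a notation of `α` into one of `2α + 1`, and one partial computable `g` such
that, for all notations `a` of `α` and `b` of `2α + 1`, `g a b` is a one-one reduction of `D_{α+1}` to
the complement of the canonical complete `Σ_{2α+1}` set given by `b`. -/
theorem mainTheorem5 :
    ∃ (t : ℕ → ℕ) (g : ℕ → ℕ → ℕ →. ℕ),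
      Computable t ∧ Partrec (fun p : ℕ × ℕ × ℕ => g p.1 p.2.1 p.2.2) ∧
      ∀ α : Ordinal.{0}, 0 < α → ∀ a : ℕ, KW.IsNotation a α →
        KW.IsNotation (t a) (2 * α + 1) ∧
        ∀ b : ℕ, KW.IsNotation b (2 * α + 1) →
          ∃ f : ℕ → ℕ, (∀ e, f e ∈ g a b e) ∧ Function.Injective f ∧
            ∀ e, e ∈ KW.DSet (α + 1) ↔ f e ∉ KW.sigmaComplete b := by
  obtain ⟨D, hD, hidx⟩ := KW.isPiTwo_isIndex
  exact KW.exists_uniform_reduction KW.primrecPred_baseClaim.computablePred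
    (KW.primrec_nextClaim hD).to_comp KW.primrec_initClaim.to_comp
    KW.exists_baseClaim_nextClaim (D := fun α => KW.DSet (α + 1))
    fun α hα e => KW.mem_DSet_iff hidx hα e
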